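/- Let $r,m\ge 0$, $n=r+m$, let $Q\subset\mathbb{R}^n$ be an $n$-dimensional convex polytope, $\pi:\mathbb{R}^n\to\mathbb{R}^m$ a surjective linear map and $P=\pi(Q)$. Assume that $Q$ is simple in dimension $m$: each $m$-dimensional face of $Q$ lies in exactly $n-m$ facets. (No further genericity of $\pi$ is needed.) Let $\Sigma(Q,P)=\int_P (Q\cap\pi^{-1}(y))\,dy$ be the fiber polytope (the set of all $\int_P\gamma(y)\,dy$ for continuous sections $\gamma:P\to Q$ of $\pi$), and let the fiber fan $\mathcal{F}(Q,P)$ be its (outer) normal fan in $(\ker\pi)^*$. For a face $S$ of $Q$, its shadow $\mathfrak{S}_S\subset(\ker\pi)^*$ is the convex cone spanned by the restrictions to $\ker\pi$ of the outward normals of the facets of $Q$ containing $S$. For $\psi\in(\ker\pi)^*$, let $s_\psi(P)\subset Q$ be the union over $y\in P$ of the faces of $Q\cap\pi^{-1}(y)$ on which $\psi$ is maximal, and let $R_\psi(P)$ be the collection of faces of $Q$ contained in $s_\psi(P)$. Let $\sigma$ be a maximal cone of $\mathcal{F}(Q,P)$. Then $\sigma$ has non-empty interior, and for every $\psi$ in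 the interior of $\sigma$ the $m$-dimensional faces of $Q$ which appear in $R_\sigma(P):=R_\psi(P)$ are exactly those in $$\mathcal{C}_\sigma=\{S \text{ face of } Q \mid \dim S=m,\ \sigma\subset\mathfrak{S}_S\}.$$ The images $\pi(S)$, $S\in\mathcal{C}_\sigma$, are pairwise different and form a subdivision of $P$ (they are full-dimensional polytopes which cover $P$, and any two of them are disjoint or meet in a common proper face). Further, let $\mathbf{\Omega}(Q)=\Omega(Q)\,dx_1\wedge\dots\wedge dx_n$ and $\mathbf{\Omega}(P)=\Omega(P)\,dy_1\wedge\dots\wedge dy_m$ be the canonical forms of $Q$ and $P$, where the canonical form of a polytope is the rational top-degree form on projective space with simple poles along the facets and no other poles, whose residue along each facet is the canonical form of the facet, the canonical form of a point being $1$, with signs chosen so that the canonical function is positive inside the polytope. Let $\omega$ be an $(n-m)$-form with $\mathbf{\Omega}(Q)=\omega\wedge\pi^*(dy_1\wedge\dots\wedge dy_m)$, and let $\omega_\pi(y)=\omega|_{\pi^{-1}(y)}$ be the fiber volume form. For $S\in\mathcal{C}_\sigma$ and $y\in\mathbb{R}^m$, the fiber $\pi^{-1}(y)$ meets the affine span of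 $S$ in exactly one point $q_S$. If $q_S$ lies on no hyperplane spanned by a facet of $Q$ that does not contain $S$, then $\omega_\pi(y)$ has a residue $\mathrm{Res}_{q_S}\omega_\pi(y)$ at $q_S$, defined through the local coordinates on $\pi^{-1}(y)$ given by equations of the $n-m$ facets containing $S$. Its sign depends on $S$ but not on $y$, and can be chosen (uniquely) so that the residue is positive for all $y$ in the image under $\pi$ of the relative interior of $S$. With these signs, $$\Omega(P)(y)=\sum_{S\in\mathcal{C}_\sigma}\mathrm{Res}_{q_S}\,\omega_\pi(y)$$ for every $y\in\mathbb{R}^m$ for which, for all $S\in\mathcal{C}_\sigma$, the point $q_S$ lies on no hyperplane spanned by a facet of $Q$ that does not contain $S$. -/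

import Mathlib

noncomputable section

namespace FiberPolytope

open Set Filter Topology MeasureTheory

/-! ### Polytopes and their faces -/

section Polytopes

variable {E : Type*} [NormedAddCommGroup E] [NormedSpace ℝ E]

/-- A convex polytope: the convex hull of a finite set. -/
def IsPolytope (Q : Set E) : Prop :=
  ∃ V : Set E, V.Finite ∧ Q = convexHull ℝ V

/-- The `d`-dimensional (non-empty) faces of `Q`; `Q` itself counts as a face. -/
def faces (Q : Set E) (d : ℕ) : Set (Set E) :=
  {S | S.Nonempty ∧ IsExposed ℝ Q S ∧ Module.finrank ℝ (vectorSpan ℝ S) = d}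

/-- The facets of `Q`: the faces of dimension `dim Q - 1`. -/
def facets (Q : Set E) : Set (Set E) :=
  {G | G.Nonempty ∧ IsExposed ℝ Q G ∧
    Module.finrank ℝ (vectorSpan ℝ G) + 1 = Module.finrank ℝ (vectorSpan ℝ Q)}

/-- The facets of `Q` which contain `S`. -/
def facetsThrough (Q S : Set E) : Set (Set E) :=
  {G | G ∈ facets Q ∧ S ⊆ G}

/-- `Q` (of full dimension `r + m`) is simple in dimension `m`: every `m`-dimensional face lies in
exactly `r` facets. -/
def IsSimpleInDim (Q : Set E) (m r : ℕ) : Prop :=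
  ∀ S ∈ faces Q m, (facetsThrough Q S).ncard = r

/-- The points that lie on none of the hyperplanes spanned by the facets of a full-dimensional
polytope `Q`. -/
def offFacets (Q : Set E) : Set E :=
  {x | ∀ G ∈ facets Q, x ∉ affineSpan ℝ G}

/-- `ℓ` is an affine equation of the facet `G` of `Q`, non-negative on `Q`. -/
def IsFacetEquation (Q G : Set E) (ℓ : E →ᵃ[ℝ] ℝ) : Prop :=
  (∀ x ∈ Q, 0 ≤ ℓ x) ∧ G = {x ∈ Q | ℓ x = 0}

/-- The outward normals of the facet `G` of a full-dimensional polytope `Q`: the functionals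
whose maximum on `Q` is attained exactly along `G` (an open ray). -/
def outwardNormals (Q G : Set E) : Set (StrongDual ℝ E) :=
  {φ | G = φ.toExposed Q}

/-- A finite collection `𝒞` of full-dimensional polytopes is a subdivision of `P`: the members
cover `P` and two different members are disjoint or meet in a common proper face
(`IsExposed` allows the empty face). -/
def IsSubdivision (P : Set E) (𝒞 : Set (Set E)) : Prop :=
  𝒞.Finite ∧ (∀ A ∈ 𝒞, IsPolytope A ∧ (interior A).Nonempty) ∧ ⋃₀ 𝒞 = P ∧
    ∀ A ∈ 𝒞, ∀ B ∈ 𝒞, A ≠ B →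
      IsExposed ℝ A (A ∩ B) ∧ IsExposed ℝ B (A ∩ B) ∧ A ∩ B ≠ A ∧ A ∩ B ≠ B

end Polytopes

/-! ### The fiber polytope, the fiber fan, shadows and coherent subdivisions -/

section FiberFan

variable {n m : ℕ}

/-- The fiber polytope `Σ(Q, P)` of `π : Q → P = π '' Q`: the Minkowski integral
`∫_P (Q ∩ π⁻¹(y)) dy`, i.e. the set of integrals of the continuous sections of `π : Q → P`. -/
def fiberPolytope (π : EuclideanSpace ℝ (Fin n) →ₗ[ℝ] EuclideanSpace ℝ (Fin m))
    (Q : Set (EuclideanSpace ℝ (Fin n))) : Set (EuclideanSpace ℝ (Fin n)) :=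
  {w | ∃ γ : EuclideanSpace ℝ (Fin m) → EuclideanSpace ℝ (Fin n),
    ContinuousOn γ (π '' Q) ∧ (∀ y ∈ π '' Q, γ y ∈ Q ∧ π (γ y) = y) ∧
      w = ∫ y in π '' Q, γ y}

/-- The normal cone, in `(ker π)^*`, of a subset `Γ` of a set `A` contained in a translate of
`ker π`: the functionals whose maximum on `A` is attained along all of `Γ`. -/
def normalConeKer (π : EuclideanSpace ℝ (Fin n) →ₗ[ℝ] EuclideanSpace ℝ (Fin m))
    (A Γ : Set (EuclideanSpace ℝ (Fin n))) : Set (StrongDual ℝ (LinearMap.ker π)) :=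
  {ψ | ∀ a ∈ Γ, ∀ k : LinearMap.ker π, a + (k : EuclideanSpace ℝ (Fin n)) ∈ A → ψ k ≤ 0}

/-- The fiber fan `𝓕(Q, P)`: the normal fan, in `(ker π)^*`, of the fiber polytope. -/
def fiberFan (π : EuclideanSpace ℝ (Fin n) →ₗ[ℝ] EuclideanSpace ℝ (Fin m))
    (Q : Set (EuclideanSpace ℝ (Fin n))) : Set (Set (StrongDual ℝ (LinearMap.ker π))) :=
  {σ | ∃ Γ : Set (EuclideanSpace ℝ (Fin n)), Γ.Nonempty ∧ IsExposed ℝ (fiberPolytope π Q) Γ ∧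
    σ = normalConeKer π (fiberPolytope π Q) Γ}

/-- The maximal cones of the fiber fan. -/
def IsMaximalFiberCone (π : EuclideanSpace ℝ (Fin n) →ₗ[ℝ] EuclideanSpace ℝ (Fin m))
    (Q : Set (EuclideanSpace ℝ (Fin n))) (σ : Set (StrongDual ℝ (LinearMap.ker π))) : Prop :=
  Maximal (fun τ => τ ∈ fiberFan π Q) σ

/-- The shadow of a face `S` of `Q`: the convex cone in `(ker π)^*` spanned by the restrictions to
`ker π` of the rays of the normal cone of `S`, i.e. of the outward normals of the facets
containing `S`. -/
def shadow (π : EuclideanSpace ℝ (Fin n) →ₗ[ℝ] EuclideanSpace ℝ (Fin m))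
    (Q S : Set (EuclideanSpace ℝ (Fin n))) : Set (StrongDual ℝ (LinearMap.ker π)) :=
  (Submodule.span NNReal
    {ψ : StrongDual ℝ (LinearMap.ker π) | ∃ G ∈ facetsThrough Q S, ∃ φ ∈ outwardNormals Q G,
      ψ = φ.comp (LinearMap.ker π).subtypeL} : Set (StrongDual ℝ (LinearMap.ker π)))

/-- The image of the section `s_ψ`: the union over `y ∈ P` of the faces of the fibers
`Q ∩ π⁻¹(y)` on which `ψ ∈ (ker π)^*` attains its maximum. -/
def sectionImage (π : EuclideanSpace ℝ (Fin n) →ₗ[ℝ] EuclideanSpace ℝ (Fin m))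
    (Q : Set (EuclideanSpace ℝ (Fin n))) (ψ : StrongDual ℝ (LinearMap.ker π)) :
    Set (EuclideanSpace ℝ (Fin n)) :=
  {x | x ∈ Q ∧ ∀ k : LinearMap.ker π, x + (k : EuclideanSpace ℝ (Fin n)) ∈ Q → ψ k ≤ 0}

/-- The `d`-dimensional faces of `Q` which appear in the subdivision `R_ψ(P)`: those contained in
the image of the section `s_ψ`. -/
def subdivisionFaces (π : EuclideanSpace ℝ (Fin n) →ₗ[ℝ] EuclideanSpace ℝ (Fin m))
    (Q : Set (EuclideanSpace ℝ (Fin n))) (ψ : StrongDual ℝ (LinearMap.ker π)) (d : ℕ) :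
    Set (Set (EuclideanSpace ℝ (Fin n))) :=
  {S | S ∈ faces Q d ∧ S ⊆ sectionImage π Q ψ}

/-- The collection `𝓒_σ` of the `m`-dimensional faces of `Q` whose shadow contains `σ`. -/
def coneFaces (π : EuclideanSpace ℝ (Fin n) →ₗ[ℝ] EuclideanSpace ℝ (Fin m))
    (Q : Set (EuclideanSpace ℝ (Fin n))) (σ : Set (StrongDual ℝ (LinearMap.ker π))) :
    Set (Set (EuclideanSpace ℝ (Fin n))) :=
  {S | S ∈ faces Q m ∧ σ ⊆ shadow π Q S}

end FiberFan

/-! ### Canonical functions of polytopes -/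

section Canonical

/-- The point `(s, t)` of `ℝ^{d+1} = ℝ × ℝ^d`. -/
def consPoint {d : ℕ} (s : ℝ) (t : EuclideanSpace ℝ (Fin d)) : EuclideanSpace ℝ (Fin (d + 1)) :=
  WithLp.toLp 2 (Fin.cons s (fun i => t i))

/-- The form `f dx_1 ∧ … ∧ dx_d` is rational, with at most simple poles along the hyperplanes
spanned by the facets of `P` and no other pole on `ℙ^d`: off these hyperplanes, `f` is a polynomial
divided by the product of the facet equations, and the bound
`deg ≤ #facets - d - 1` says that there is no pole along the hyperplane at infinity. -/
def HasSimpleFacetPoles {d : ℕ} (P : Set (EuclideanSpace ℝ (Fin d)))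
    (f : EuclideanSpace ℝ (Fin d) → ℝ) : Prop :=
  ∃ (ℓ : Set (EuclideanSpace ℝ (Fin d)) → EuclideanSpace ℝ (Fin d) →ᵃ[ℝ] ℝ)
    (N : MvPolynomial (Fin d) ℝ),
    (∀ G ∈ facets P, IsFacetEquation P G (ℓ G)) ∧
    N.totalDegree + d + 1 ≤ (facets P).ncard ∧
    ∀ x ∈ offFacets P, f x = MvPolynomial.eval (fun i => x i) N / ∏ᶠ G ∈ facets P, ℓ G x

/-- `f` is the canonical function of the full-dimensional polytope `P ⊆ ℝ^d`, i.e.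
`f dx_1 ∧ … ∧ dx_d` is the canonical form of the positive geometry `(ℙ^d, P)`, with the sign
for which `f` is positive inside `P`. The canonical function of a point is `1`; in positive
dimension the canonical form has simple poles exactly along the facets, and its residue along
each facet is the canonical form of the facet. The residue is computed in affine coordinates
`x = Φ (s, t)` in which the facet is cut out by `s = 0` and `s ≥ 0` on `P`: there the form is,
up to orientation, `(ds / s) ∧ (s * f (Φ (s, t)) * |det Φ|) dt_1 ∧ … ∧ dt_d`.
The values of `f` on the hyperplanes spanned by the facets are irrelevant. -/
def IsCanonicalFunction : (d : ℕ) → Set (EuclideanSpace ℝ (Fin d)) →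
    (EuclideanSpace ℝ (Fin d) → ℝ) → Prop
  | 0, _, f => ∀ x, f x = 1
  | d + 1, P, f =>
    HasSimpleFacetPoles P f ∧ (∀ x ∈ interior P, 0 < f x) ∧
    ∀ G ∈ facets P,
      ∀ Φ : EuclideanSpace ℝ (Fin (d + 1)) ≃ᵃ[ℝ] EuclideanSpace ℝ (Fin (d + 1)),
        (∀ z, Φ z ∈ P → 0 ≤ z 0) → G = {x ∈ P | (Φ.symm x) 0 = 0} →
        ∃ h : EuclideanSpace ℝ (Fin d) → ℝ,
          IsCanonicalFunction d {t | Φ (consPoint 0 t) ∈ G} h ∧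
          ∀ t, (∀ G' ∈ facets P, G' ≠ G → Φ (consPoint 0 t) ∉ affineSpan ℝ G') →
            Tendsto (fun s : ℝ => s * f (Φ (consPoint s t)) *
              |LinearMap.det (Φ.linear : EuclideanSpace ℝ (Fin (d + 1)) →ₗ[ℝ]
                EuclideanSpace ℝ (Fin (d + 1)))|) (𝓝[≠] 0) (𝓝 (h t))

end Canonical

/-! ### The fiber volume form and its residues -/

section Forms

/-- The wedge product of alternating forms. -/
def wedge {E : Type*} [AddCommGroup E] [Module ℝ E] {r m : ℕ}
    (a : E [⋀^Fin r]→ₗ[ℝ] ℝ) (b : E [⋀^Fin m]→ₗ[ℝ] ℝ) : E [⋀^Fin (r + m)]→ₗ[ℝ] ℝ :=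
  ((LinearMap.mul' ℝ ℝ).compAlternatingMap (a.domCoprod b)).domDomCongr finSumFinEquiv

/-- The standard volume form `dx_1 ∧ … ∧ dx_d` of `ℝ^d`. -/
def stdVolume (d : ℕ) : EuclideanSpace ℝ (Fin d) [⋀^Fin d]→ₗ[ℝ] ℝ :=
  (EuclideanSpace.basisFun (Fin d) ℝ).toBasis.det

variable {r m : ℕ}

/-- `ω` is an `r`-form with `𝛀(Q) = ω ∧ π^* μ`, where `𝛀(Q) = g dx_1 ∧ … ∧ dx_{r+m}` and
`μ = dy_1 ∧ … ∧ dy_m` (wherever `𝛀(Q)` is regular). -/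
def IsFiberVolumeForm (π : EuclideanSpace ℝ (Fin (r + m)) →ₗ[ℝ] EuclideanSpace ℝ (Fin m))
    (Q : Set (EuclideanSpace ℝ (Fin (r + m)))) (g : EuclideanSpace ℝ (Fin (r + m)) → ℝ)
    (ω : EuclideanSpace ℝ (Fin (r + m)) → EuclideanSpace ℝ (Fin (r + m)) [⋀^Fin r]→ₗ[ℝ] ℝ) :
    Prop :=
  ∀ x ∈ offFacets Q,
    g x • stdVolume (r + m) = wedge (ω x) ((stdVolume m).compLinearMap π)

/-- The restriction `ω_π(y)` of `ω` to the fiber `π⁻¹(y)` through `q` (so `y = π q`), where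
the fiber is identified with `ker π` by `k ↦ q + k`. -/
def restrictToFiber (π : EuclideanSpace ℝ (Fin (r + m)) →ₗ[ℝ] EuclideanSpace ℝ (Fin m))
    (ω : EuclideanSpace ℝ (Fin (r + m)) → EuclideanSpace ℝ (Fin (r + m)) [⋀^Fin r]→ₗ[ℝ] ℝ)
    (q : EuclideanSpace ℝ (Fin (r + m))) (k : LinearMap.ker π) :
    LinearMap.ker π [⋀^Fin r]→ₗ[ℝ] ℝ :=
  (ω (q + (k : EuclideanSpace ℝ (Fin (r + m))))).compLinearMap (LinearMap.ker π).subtype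

/-- `c` is the residue at the point `p` of the top-degree form `η` with respect to the local
coordinates `α_1, …, α_r` centered at `p`: near `p` one has
`η = h (dα_1 / α_1) ∧ … ∧ (dα_r / α_r)` with `h` analytic at `p`, and `c = h p`. -/
def IsResidueAt {V : Type*} [NormedAddCommGroup V] [NormedSpace ℝ V]
    (η : V → V [⋀^Fin r]→ₗ[ℝ] ℝ) (α : Fin r → V → ℝ) (p : V) (c : ℝ) : Prop :=
  (∀ i, AnalyticAt ℝ (α i) p ∧ α i p = 0) ∧
  LinearIndependent ℝ (fun i => fderiv ℝ (α i) p) ∧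
  ∃ h : V → ℝ, AnalyticAt ℝ h p ∧ h p = c ∧
    ∀ᶠ x in 𝓝 p, (∀ i, α i x ≠ 0) → ∀ v : Fin r → V,
      η x v = h x / (∏ i, α i x) * Matrix.det (Matrix.of fun i j => fderiv ℝ (α i) x (v j))

/-- `ℓ_1, …, ℓ_r` is a list, without repetition, of equations of all the facets containing `S`. -/
def IsFacetListing (Q S : Set (EuclideanSpace ℝ (Fin (r + m))))
    (ℓ : Fin r → EuclideanSpace ℝ (Fin (r + m)) →ᵃ[ℝ] ℝ) : Prop :=
  ∃ e : Fin r ≃ facetsThrough Q S, ∀ i, IsFacetEquation Q (e i) (ℓ i)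

/-- `q` lies on no hyperplane spanned by a facet of `Q` which does not contain the face `S`. -/
def IsOffOtherFacets {n : ℕ} (Q S : Set (EuclideanSpace ℝ (Fin n)))
    (q : EuclideanSpace ℝ (Fin n)) : Prop :=
  ∀ G ∈ facets Q, ¬ S ⊆ G → q ∉ affineSpan ℝ G

/-- `R y` is the residue of `ω_π(y)` at the point `q_S = π⁻¹(y) ∩ aff S`, for every `y` for which
`q_S` lies on no facet hyperplane of `Q` other than those containing `S`, with the suitable sign.
A residue is defined up to the sign given by the order of the local coordinates (here the equations
of the facets containing `S`); this sign does not depend on `y` and is fixed by the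
requirement that the residue is positive for `y` in the (relative) interior of `π(S)`. -/
def IsResidueFunction (π : EuclideanSpace ℝ (Fin (r + m)) →ₗ[ℝ] EuclideanSpace ℝ (Fin m))
    (Q S : Set (EuclideanSpace ℝ (Fin (r + m))))
    (ω : EuclideanSpace ℝ (Fin (r + m)) → EuclideanSpace ℝ (Fin (r + m)) [⋀^Fin r]→ₗ[ℝ] ℝ)
    (R : EuclideanSpace ℝ (Fin m) → ℝ) : Prop :=
  (∀ ℓ : Fin r → EuclideanSpace ℝ (Fin (r + m)) →ᵃ[ℝ] ℝ, IsFacetListing Q S ℓ →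
    ∃ ε : ℝ, (ε = 1 ∨ ε = -1) ∧
      ∀ q ∈ affineSpan ℝ S, IsOffOtherFacets Q S q →
        IsResidueAt (restrictToFiber π ω q)
          (fun i (k : LinearMap.ker π) => ℓ i (q + (k : EuclideanSpace ℝ (Fin (r + m))))) 0
          (ε * R (π q))) ∧
  ∀ x ∈ intrinsicInterior ℝ S, 0 < R (π x)

end Forms

end FiberPolytope

end

open FiberPolytope

set_option linter.unusedSectionVars false

namespace FiberPolytope

open Set Filter Topology MeasureTheory

/-! ### Generic points -/

section Generic

variable {E : Type*} [NormedAddCommGroup E] [NormedSpace ℝ E] [FiniteDimensional ℝ E]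

/-! There are two halves: the combinatorics of the fiber fan, and the additivity of canonical
functions.

Fiber fan. The image of `s_ψ` is a union of faces of `Q`, hence one of finitely many sets. It
depends upper semicontinuously on `ψ` (`eventually_sectionImage_subset`), and for generic `ψ` the
projection is injective on it (`exists_generic_injOn`, `injOn_sectionImage`). The integral of a
section maximizes `ψ` on the fiber polytope exactly when the section maximizes `ψ` in every fiber:
one direction is monotonicity of the integral, the other a local modification by a bump function
(`mem_sectionImage_of_le_integral`). Hence a maximal cone has interior points, and all of these
share one continuous section (`exists_section_of_isMaximalFiberCone`). The `m`-dimensional faces in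
its image project to a subdivision of `P`. For such a face `S`, simplicity makes the `r` facet
equations through `S`, together with `π`, a coordinate system; expanding `ψ` in these coordinates
shows that `S` lies in the image of `s_ψ` if and only if `ψ` lies in the shadow of `S`.

Canonical functions. Every linear relation between indicator functions of full-dimensional
polytopes, valid at generic points, also holds between their canonical functions
(`respectsRelations`). This is an induction on the dimension: along any hyperplane the jump of the
indicator functions and the residue of the canonical functions are governed by the same slices and
signs. So a combination whose indicator relation vanishes has no residues, hence no poles, and the
degree bound on its numerator forces it to be zero. Applied to the subdivision, this writes `Ω(P)`
generically as the sum of the canonical functions of the cells `π(S)`.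

It remains to identify the summands. Taking residues successively along the `r` facets through `S`
gives the canonical function of `π(S)` (`exists_iterated_residue`, `exists_face_canonical`). The
residue of the fiber volume form at `q_S` is given by the same expression, namely the numerator of
`Ω(Q)` over the product of the other facet equations, up to a constant computed from a block
determinant (`exists_isResidueFunction`). Finally the generic identity extends to all admissible `y`
by continuity, since an admissible `y` lies on no facet hyperplane of `P` (`mem_offFacets_image`).
-/

/-- The filter of the sets which contain the complement of a finite union of zero sets of
non-zero affine functions. -/
def generic (E : Type*) [NormedAddCommGroup E] [NormedSpace ℝ E] : Filter E where
  sets := {s | ∃ F : Finset (E →ᵃ[ℝ] ℝ), (∀ a ∈ F, a ≠ 0) ∧ ∀ x, (∀ a ∈ F, a x ≠ 0) → x ∈ s}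
  univ_sets := ⟨∅, by simp, fun _ _ => mem_univ _⟩
  sets_of_superset := by
    rintro s t ⟨F, hF, h⟩ hst
    exact ⟨F, hF, fun x hx => hst (h x hx)⟩
  inter_sets := by
    classical
    rintro s t ⟨F, hF, h⟩ ⟨F', hF', h'⟩
    refine ⟨F ∪ F', fun a ha => ?_, fun x hx => ⟨h x fun a ha => hx a ?_, h' x fun a ha => hx a ?_⟩⟩
    · exact (Finset.mem_union.1 ha).elim (hF a) (hF' a)
    · exact Finset.mem_union_left _ ha
    · exact Finset.mem_union_right _ ha

theorem eventually_generic_ne_zero {a : E →ᵃ[ℝ] ℝ} (ha : a ≠ 0) : ∀ᶠ x in generic E, a x ≠ 0 :=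
  ⟨{a}, by simpa using ha, fun x hx => hx a (by simp)⟩

theorem isOpen_ne_zero (a : E →ᵃ[ℝ] ℝ) : IsOpen {x | a x ≠ 0} :=
  isOpen_ne_fun (AffineMap.continuous_of_finiteDimensional a) continuous_const

theorem dense_ne_zero {a : E →ᵃ[ℝ] ℝ} (ha : a ≠ 0) : Dense {x | a x ≠ 0} := by
  obtain ⟨x₁, hx₁⟩ : ∃ x, a x ≠ 0 := by
    by_contra! h
    exact ha (by ext x; simpa using h x)
  intro x
  by_cases hx : a x = 0
  -- On the line from the zero `x` to `x₁` the function is `t * a x₁`, which vanishes only at `t =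
  -- 0`.
  · have h1 : Tendsto (fun t : ℝ => AffineMap.lineMap x x₁ t) (𝓝[≠] 0) (𝓝 x) := by
      have : Continuous (fun t : ℝ => AffineMap.lineMap x x₁ t) := AffineMap.lineMap_continuous
      have := this.tendsto 0
      simp only [AffineMap.lineMap_apply_zero] at this
      exact this.mono_left nhdsWithin_le_nhds
    refine mem_closure_of_tendsto h1 ?_
    filter_upwards [self_mem_nhdsWithin] with t ht
    simp only [AffineMap.apply_lineMap, hx]
    simp [AffineMap.lineMap_apply, hx₁]
    exact ht
  · exact subset_closure hx

theorem dense_forall_ne_zero (F : Finset (E →ᵃ[ℝ] ℝ)) (hF : ∀ a ∈ F, a ≠ 0) :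
    Dense {x | ∀ a ∈ F, a x ≠ 0} := by
  classical
  induction F using Finset.induction_on with
  | empty => simp
  | insert a F _ ih =>
    have h := (dense_ne_zero (hF a (by simp))).inter_of_isOpen_left
      (ih fun b hb => hF b (by simp [hb])) (isOpen_ne_zero a)
    convert h using 1
    ext x
    simp

theorem dense_of_eventually_generic {p : E → Prop} (h : ∀ᶠ x in generic E, p x) :
    Dense {x | p x} := by
  obtain ⟨F, hF, h⟩ := h
  exact (dense_forall_ne_zero F hF).mono fun x hx => h x hx

theorem exists_generic_mem {p : E → Prop} (h : ∀ᶠ x in generic E, p x) {U : Set E}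
    (hU : IsOpen U) (hne : U.Nonempty) : ∃ x ∈ U, p x := by
  obtain ⟨x, hx, hp⟩ := (dense_of_eventually_generic h).inter_open_nonempty U hU hne
  exact ⟨x, hx, hp⟩

/-- Generic sets are dense. This instance is what turns a generic identity into a pointwise one: two
functions continuous at `x` that agree generically have the same limit along this filter. -/
instance nhds_inf_generic_neBot (x : E) : (𝓝 x ⊓ generic E).NeBot := by
  rw [Filter.inf_neBot_iff]
  intro s hs t ht
  obtain ⟨U, hUs, hU, hxU⟩ := mem_nhds_iff.1 hs
  obtain ⟨y, hy, hyt⟩ := exists_generic_mem (p := (· ∈ t)) ht hU ⟨x, hxU⟩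
  exact ⟨y, hUs hy, hyt⟩

instance generic_neBot : (generic E).NeBot := (nhds_inf_generic_neBot (0 : E)).mono inf_le_right

theorem finite_eventually_generic_ne_zero {ι : Type*} {s : Set ι} (hs : s.Finite)
    (a : ι → E →ᵃ[ℝ] ℝ) (h : ∀ i ∈ s, a i ≠ 0) : ∀ᶠ x in generic E, ∀ i ∈ s, a i x ≠ 0 :=
  (eventually_all_finite hs).2 fun i hi => eventually_generic_ne_zero (h i hi)

theorem eventually_generic_comp_equiv {E' : Type*} [NormedAddCommGroup E'] [NormedSpace ℝ E']
    (e : E ≃ᵃ[ℝ] E') {p : E' → Prop} (h : ∀ᶠ x in generic E', p x) :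
    ∀ᶠ x in generic E, p (e x) := by
  classical
  obtain ⟨F, hF, h⟩ := h
  refine ⟨F.image fun a => a.comp (e : E →ᵃ[ℝ] E'), ?_, fun x hx => h _ fun a ha => ?_⟩
  · simp only [Finset.mem_image, forall_exists_index, and_imp, forall_apply_eq_imp_iff₂]
    intro a ha h0
    refine hF a ha ?_
    ext x
    have := congrArg (fun b => b (e.symm x)) h0
    simpa using this
  · exact hx _ (Finset.mem_image_of_mem _ ha)

/-- A proper affine subspace contains no generic points. -/
theorem eventually_generic_notMem (A : AffineSubspace ℝ E) (hA : A ≠ ⊤) :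
    ∀ᶠ x in generic E, x ∉ A := by
  rcases (A : Set E).eq_empty_or_nonempty with h | ⟨p, hp⟩
  · exact Eventually.of_forall fun x hx => by
      have : x ∈ (A : Set E) := hx
      simp [h] at this
  · have hd : A.direction < ⊤ := by
      rw [lt_top_iff_ne_top]
      intro h
      exact hA ((AffineSubspace.direction_eq_top_iff_of_nonempty ⟨p, hp⟩).1 h)
    obtain ⟨f, hf0, hf⟩ := Submodule.exists_le_ker_of_lt_top _ hd
    let a : E →ᵃ[ℝ] ℝ := f.toAffineMap - AffineMap.const ℝ E (f p)
    have ha : a ≠ 0 := by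
      intro h
      apply hf0
      ext x
      have h1 : a (x + p) = 0 := by rw [h]; rfl
      simpa [a] using h1
    filter_upwards [eventually_generic_ne_zero ha] with x hx hxA
    apply hx
    have : f (x - p) = 0 := hf (A.vsub_mem_direction hxA hp)
    simpa [a] using this

end Generic

/-! ### The coordinates `(s, t)` near a hyperplane. -/

section Cons

variable {d : ℕ}

theorem consPoint_zero (s : ℝ) (t : EuclideanSpace ℝ (Fin d)) : consPoint s t 0 = s := rfl

/-- The point `t` of `ℝ^d` for the point `(s, t)` of `ℝ^{d+1}`. -/
def tailPoint : EuclideanSpace ℝ (Fin (d + 1)) →ₗ[ℝ] EuclideanSpace ℝ (Fin d) where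
  toFun z := WithLp.toLp 2 fun i => z i.succ
  map_add' _ _ := rfl
  map_smul' _ _ := rfl

theorem tailPoint_consPoint (s : ℝ) (t : EuclideanSpace ℝ (Fin d)) :
    tailPoint (consPoint s t) = t := rfl

theorem consPoint_tailPoint (z : EuclideanSpace ℝ (Fin (d + 1))) :
    consPoint (z 0) (tailPoint z) = z := by
  ext i
  refine Fin.cases ?_ (fun i => ?_) i <;> rfl

theorem consPoint_add (s s' : ℝ) (t t' : EuclideanSpace ℝ (Fin d)) :
    consPoint (s + s') (t + t') = consPoint s t + consPoint s' t' := by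
  ext i
  refine Fin.cases ?_ (fun i => ?_) i <;> rfl

theorem consPoint_smul (c s : ℝ) (t : EuclideanSpace ℝ (Fin d)) :
    consPoint (c * s) (c • t) = c • consPoint s t := by
  ext i
  refine Fin.cases ?_ (fun i => ?_) i <;> rfl

/-- `t ↦ (0, t)`. -/
def zeroCons : EuclideanSpace ℝ (Fin d) →ₗ[ℝ] EuclideanSpace ℝ (Fin (d + 1)) where
  toFun t := consPoint 0 t
  map_add' t t' := by rw [← consPoint_add, add_zero]
  map_smul' c t := by rw [RingHom.id_apply, ← consPoint_smul, mul_zero]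

@[simp] theorem zeroCons_apply (t : EuclideanSpace ℝ (Fin d)) : zeroCons t = consPoint 0 t := rfl

theorem consPoint_eq (s : ℝ) (t : EuclideanSpace ℝ (Fin d)) :
    consPoint s t = s • consPoint 1 0 + zeroCons t := by
  rw [zeroCons_apply, ← consPoint_smul, ← consPoint_add]
  simp

theorem continuous_consPoint :
    Continuous fun z : ℝ × EuclideanSpace ℝ (Fin d) => consPoint z.1 z.2 := by
  have : (fun z : ℝ × EuclideanSpace ℝ (Fin d) => consPoint z.1 z.2) =
      fun z => z.1 • consPoint 1 0 + zeroCons z.2 := by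
    ext1 z; exact consPoint_eq _ _
  rw [this]
  exact (continuous_fst.smul continuous_const).add
    ((LinearMap.continuous_of_finiteDimensional zeroCons).comp continuous_snd)

theorem affine_consPoint (a : EuclideanSpace ℝ (Fin (d + 1)) →ᵃ[ℝ] ℝ) (s : ℝ)
    (t : EuclideanSpace ℝ (Fin d)) :
    a (consPoint s t) = s * a.linear (consPoint 1 0) + a (consPoint 0 t) := by
  have h := a.map_vadd (consPoint 0 t) (s • consPoint 1 0)
  rw [consPoint_eq s t, zeroCons_apply]
  simpa using h

/-- An affine function which vanishes on the hyperplane `s = 0` is a multiple of `s`. -/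
theorem affine_eq_mul_of_zeroCons {a : EuclideanSpace ℝ (Fin (d + 1)) →ᵃ[ℝ] ℝ}
    (h : ∀ t, a (consPoint 0 t) = 0) (z : EuclideanSpace ℝ (Fin (d + 1))) :
    a z = z 0 * a.linear (consPoint 1 0) := by
  conv_lhs => rw [← consPoint_tailPoint z, affine_consPoint, h, add_zero]

theorem comp_zeroCons_ne_zero {a : EuclideanSpace ℝ (Fin (d + 1)) →ᵃ[ℝ] ℝ}
    (h : ¬ ∀ t, a (consPoint 0 t) = 0) : a.comp zeroCons.toAffineMap ≠ 0 := by
  intro h0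
  apply h
  intro t
  have := congrArg (fun b => b t) h0
  simpa using this

/-- A generic point of `ℝ^{d+1}` may be chosen on the line through a generic point of `ℝ^d`. -/
theorem eventually_generic_consPoint {p : EuclideanSpace ℝ (Fin (d + 1)) → Prop}
    (h : ∀ᶠ z in generic (EuclideanSpace ℝ (Fin (d + 1))), p z) :
    ∀ᶠ t in generic (EuclideanSpace ℝ (Fin d)), ∀ᶠ s : ℝ in 𝓝[≠] 0, p (consPoint s t) := by
  obtain ⟨F, hF, h⟩ := h
  have key : ∀ a ∈ (F : Set (EuclideanSpace ℝ (Fin (d + 1)) →ᵃ[ℝ] ℝ)),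
      ∀ᶠ t in generic (EuclideanSpace ℝ (Fin d)), ∀ᶠ s : ℝ in 𝓝[≠] 0, a (consPoint s t) ≠ 0 := by
    intro a ha
    -- If the zero set of `a` is the hyperplane `s = 0` itself, then `a` is a non-zero multiple of
    -- `s` and every `s ≠ 0` works. Otherwise `a` is already non-zero at `(0, t)` for generic `t`,
    -- and continuity in `s` suffices.
    by_cases h0 : ∀ t, a (consPoint 0 t) = 0
    · refine Eventually.of_forall fun t => ?_
      filter_upwards [self_mem_nhdsWithin] with s hs
      rw [affine_eq_mul_of_zeroCons h0, consPoint_zero]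
      refine mul_ne_zero hs fun h1 => hF a ha ?_
      ext z
      rw [affine_eq_mul_of_zeroCons h0, h1, mul_zero]
      rfl
    · filter_upwards [eventually_generic_ne_zero (comp_zeroCons_ne_zero h0)] with t ht
      have hc : Continuous fun s : ℝ => a (consPoint s t) :=
        (AffineMap.continuous_of_finiteDimensional a).comp
          (continuous_consPoint.comp (continuous_id.prodMk continuous_const))
      have : ∀ᶠ s : ℝ in 𝓝 0, a (consPoint s t) ≠ 0 :=
        hc.continuousAt.eventually_ne (by simpa using ht)
      exact this.filter_mono nhdsWithin_le_nhds
  have := (eventually_all_finite F.finite_toSet).2 key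
  filter_upwards [this] with t ht
  filter_upwards [(eventually_all_finite F.finite_toSet).2 ht] with s hs
  exact h _ fun a ha => hs a ha

end Cons

/-! ### Faces of polytopes -/

section Faces

variable {E : Type*} [NormedAddCommGroup E] [NormedSpace ℝ E] [FiniteDimensional ℝ E]
  {Q S G : Set E}

theorem IsPolytope.convex (hQ : IsPolytope Q) : Convex ℝ Q := by
  obtain ⟨V, -, rfl⟩ := hQ
  exact convex_convexHull ℝ V

theorem IsPolytope.isCompact (hQ : IsPolytope Q) : IsCompact Q := by
  obtain ⟨V, hV, rfl⟩ := hQ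
  exact hV.isCompact_convexHull ℝ

theorem IsPolytope.isClosed (hQ : IsPolytope Q) : IsClosed Q := hQ.isCompact.isClosed

/-- By Krein–Milman a face is the closed hull of its extreme points, and these are extreme in the
polytope, hence belong to `V`. This makes faces polytopes and shows that there are finitely many of
them. -/
theorem isExposed_convexHull_eq {V : Set E} (hV : V.Finite)
    (hS : IsExposed ℝ (convexHull ℝ V) S) : S = convexHull ℝ (V ∩ S) := by
  have hc : IsCompact S := hS.isCompact (hV.isCompact_convexHull ℝ)
  have hconv : Convex ℝ S := hS.convex (convex_convexHull ℝ V)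
  refine Subset.antisymm ?_ (convexHull_min inter_subset_right hconv)
  have h1 := closure_convexHull_extremePoints hc hconv
  have h2 : S.extremePoints ℝ ⊆ V ∩ S := fun x hx =>
    ⟨extremePoints_convexHull_subset
      (hS.isExtreme.extremePoints_subset_extremePoints hx), extremePoints_subset hx⟩
  calc S = closure (convexHull ℝ (S.extremePoints ℝ)) := h1.symm
    _ ⊆ closure (convexHull ℝ (V ∩ S)) := closure_mono (convexHull_mono h2)
    _ = convexHull ℝ (V ∩ S) := ((hV.inter_of_left S).isClosed_convexHull ℝ).closure_eq

theorem IsPolytope.of_isExposed (hQ : IsPolytope Q) (hS : IsExposed ℝ Q S) : IsPolytope S := by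
  obtain ⟨V, hV, rfl⟩ := hQ
  exact ⟨V ∩ S, hV.inter_of_left S, isExposed_convexHull_eq hV hS⟩

theorem IsPolytope.image {E' : Type*} [NormedAddCommGroup E'] [NormedSpace ℝ E']
    (hQ : IsPolytope Q) (f : E →ᵃ[ℝ] E') : IsPolytope (f '' Q) := by
  obtain ⟨V, hV, rfl⟩ := hQ
  exact ⟨f '' V, hV.image f, f.image_convexHull V⟩

theorem IsPolytope.finite_isExposed (hQ : IsPolytope Q) : {S | IsExposed ℝ Q S}.Finite := by
  obtain ⟨V, hV, rfl⟩ := hQ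
  refine (hV.finite_subsets.image (convexHull ℝ)).subset fun S hS => ?_
  exact ⟨V ∩ S, inter_subset_left, (isExposed_convexHull_eq hV hS).symm⟩

theorem IsPolytope.finite_facets (hQ : IsPolytope Q) : (facets Q).Finite :=
  hQ.finite_isExposed.subset fun _ hG => hG.2.1

theorem IsPolytope.finite_faces (hQ : IsPolytope Q) (d : ℕ) : (faces Q d).Finite :=
  hQ.finite_isExposed.subset fun _ hG => hG.2.1

theorem vectorSpan_eq_top_of_interior (hint : (interior Q).Nonempty) : vectorSpan ℝ Q = ⊤ := by
  have h : affineSpan ℝ Q = ⊤ :=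
    top_unique ((isOpen_interior.affineSpan_eq_top hint).symm.le.trans
      (affineSpan_mono ℝ interior_subset))
  rw [← direction_affineSpan, h, AffineSubspace.direction_top]

/-- A zero at an interior point is a local minimum, so the linear part is non-negative at both `v`
and `-v`; then the function is constant, equal to zero. -/
theorem pos_of_mem_interior {ℓ : E →ᵃ[ℝ] ℝ} (hℓ : ∀ x ∈ Q, 0 ≤ ℓ x) (h0 : ℓ ≠ 0) {x : E}
    (hx : x ∈ interior Q) : 0 < ℓ x := by
  refine lt_of_le_of_ne (hℓ x (interior_subset hx)) fun h => h0 ?_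
  have hlin : ∀ v, ℓ.linear v = 0 := by
    have key : ∀ v, 0 ≤ ℓ.linear v := by
      intro v
      have hc : Tendsto (fun t : ℝ => x + t • v) (𝓝[>] 0) (𝓝 x) := by
        have : Continuous fun t : ℝ => x + t • v := by fun_prop
        have := this.tendsto 0
        simp only [zero_smul, add_zero] at this
        exact this.mono_left nhdsWithin_le_nhds
      obtain ⟨t, ht, ht0⟩ := ((hc.eventually (isOpen_interior.mem_nhds hx)).and
        self_mem_nhdsWithin).exists
      have h1 := hℓ _ (interior_subset ht)
      have h2 := ℓ.map_vadd x (t • v)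
      rw [vadd_eq_add, add_comm] at h2
      rw [h2, ← h] at h1
      simp only [map_smul, smul_eq_mul, vadd_eq_add, add_zero] at h1
      exact nonneg_of_mul_nonneg_right h1 ht0
    intro v
    have h1 := key v
    have h2 := key (-v)
    rw [map_neg] at h2
    linarith
  ext y
  have := ℓ.map_vadd x (y - x)
  simp only [vadd_eq_add, sub_add_cancel, hlin, ← h, add_zero] at this
  simpa using this

theorem exists_isFacetEquation_of_isExposed (hS : IsExposed ℝ Q S) (hne : S.Nonempty) :
    ∃ ℓ : E →ᵃ[ℝ] ℝ, IsFacetEquation Q S ℓ := by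
  obtain ⟨p, hp⟩ := hne
  obtain ⟨l, hl⟩ := hS ⟨p, hp⟩
  refine ⟨AffineMap.const ℝ E (l p) - (l : E →ₗ[ℝ] ℝ).toAffineMap, ?_, ?_⟩
  · intro x hx
    rw [hl] at hp
    simpa using hp.2 x hx
  · rw [hl] at hp
    ext x
    rw [hl]
    constructor
    · rintro ⟨hx, h⟩
      exact ⟨hx, by simpa using sub_eq_zero.2 (le_antisymm (h p hp.1) (hp.2 x hx))⟩
    · rintro ⟨hx, h⟩
      refine ⟨hx, fun y hy => ?_⟩
      have h' : l p - l x = 0 := by simpa using h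
      rw [← sub_eq_zero.1 h']
      exact hp.2 y hy

theorem IsFacetEquation.neg_linear_mem_outwardNormals {ℓ : E →ᵃ[ℝ] ℝ} (h : IsFacetEquation Q S ℓ)
    (hne : S.Nonempty) : -(LinearMap.toContinuousLinearMap ℓ.linear) ∈ outwardNormals Q S := by
  obtain ⟨p, hp⟩ := hne
  have hsub : ∀ x y, ℓ.linear x - ℓ.linear y = ℓ x - ℓ y := fun x y => by
    rw [← map_sub]; exact ℓ.linearMap_vsub x y
  have hp' := hp
  rw [h.2] at hp'
  ext x
  constructor
  · intro hx
    rw [h.2] at hx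
    refine ⟨hx.1, fun y hy => ?_⟩
    have := hsub x y
    have h1 := h.1 y hy
    have h2 := hx.2
    simp
    linarith
  · rintro ⟨hx, h3⟩
    rw [h.2]
    refine ⟨hx, le_antisymm ?_ (h.1 x hx)⟩
    have h1 := h3 p hp'.1
    have := hsub x p
    have h2 := hp'.2
    simp at h1
    linarith

theorem IsFacetEquation.isExposed {ℓ : E →ᵃ[ℝ] ℝ} (h : IsFacetEquation Q S ℓ) :
    IsExposed ℝ Q S := fun hne => ⟨_, h.neg_linear_mem_outwardNormals hne⟩

theorem finrank_vectorSpan_of_interior (hint : (interior Q).Nonempty) :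
    Module.finrank ℝ (vectorSpan ℝ Q) = Module.finrank ℝ E := by
  rw [vectorSpan_eq_top_of_interior hint, finrank_top]

theorem ne_zero_of_isFacetEquation (hG : G ∈ facets Q) {ℓ : E →ᵃ[ℝ] ℝ}
    (hℓ : IsFacetEquation Q G ℓ) : ℓ ≠ 0 := by
  rintro rfl
  have h1 : G = Q := by rw [hℓ.2]; simp
  have := hG.2.2
  rw [h1] at this
  omega

theorem vectorSpan_le_ker {ℓ : E →ᵃ[ℝ] ℝ} (h : ∀ x ∈ S, ℓ x = 0) :
    vectorSpan ℝ S ≤ LinearMap.ker ℓ.linear := by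
  rw [vectorSpan_def, Submodule.span_le]
  rintro _ ⟨x, hx, y, hy, rfl⟩
  have := ℓ.linearMap_vsub x y
  simp only [SetLike.mem_coe, LinearMap.mem_ker]
  rw [this, h x hx, h y hy]
  simp

theorem mem_affineSpan_iff_vectorSpan {p : E} (hp : p ∈ S) (x : E) :
    x ∈ affineSpan ℝ S ↔ x - p ∈ vectorSpan ℝ S := by
  rw [← direction_affineSpan, ← vsub_eq_sub,
    AffineSubspace.vsub_right_mem_direction_iff_mem (subset_affineSpan ℝ S hp)]

theorem linear_ne_zero_of_isFacetEquation (hG : G ∈ facets Q) {ℓ : E →ᵃ[ℝ] ℝ}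
    (hℓ : IsFacetEquation Q G ℓ) : ℓ.linear ≠ 0 := by
  intro h
  refine ne_zero_of_isFacetEquation hG hℓ ?_
  obtain ⟨p, hp⟩ := hG.1
  rw [hℓ.2] at hp
  ext x
  have := ℓ.linearMap_vsub x p
  rw [h, hp.2] at this
  simpa using this.symm

theorem finrank_ker_add_one {f : E →ₗ[ℝ] ℝ} (hf : f ≠ 0) :
    Module.finrank ℝ (LinearMap.ker f) + 1 = Module.finrank ℝ E := by
  have h := LinearMap.finrank_range_add_finrank_ker f
  rw [LinearMap.range_eq_top.2 (LinearMap.surjective hf), finrank_top, Module.finrank_self] at h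
  omega

theorem vectorSpan_facet (hint : (interior Q).Nonempty) (hG : G ∈ facets Q) {ℓ : E →ᵃ[ℝ] ℝ}
    (hℓ : IsFacetEquation Q G ℓ) : vectorSpan ℝ G = LinearMap.ker ℓ.linear := by
  refine Submodule.eq_of_le_of_finrank_eq (vectorSpan_le_ker fun x hx => ?_) ?_
  · rw [hℓ.2] at hx; exact hx.2
  · have h1 := finrank_ker_add_one (linear_ne_zero_of_isFacetEquation hG hℓ)
    have h2 := hG.2.2
    rw [finrank_vectorSpan_of_interior hint] at h2
    omega

theorem mem_affineSpan_facet (hint : (interior Q).Nonempty) (hG : G ∈ facets Q) {ℓ : E →ᵃ[ℝ] ℝ}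
    (hℓ : IsFacetEquation Q G ℓ) (x : E) : x ∈ affineSpan ℝ G ↔ ℓ x = 0 := by
  obtain ⟨p, hp⟩ := hG.1
  have hp' := hp
  rw [hℓ.2] at hp'
  rw [mem_affineSpan_iff_vectorSpan hp, vectorSpan_facet hint hG hℓ, LinearMap.mem_ker]
  have := ℓ.linearMap_vsub x p
  rw [hp'.2] at this
  rw [← vsub_eq_sub, this]
  simp

/-- A chosen equation of a facet. -/
noncomputable def facetEq (Q G : Set E) : E →ᵃ[ℝ] ℝ :=
  open Classical in if h : ∃ ℓ, IsFacetEquation Q G ℓ then h.choose else 0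

theorem isFacetEquation_facetEq (hG : G ∈ facets Q) : IsFacetEquation Q G (facetEq Q G) := by
  have h := exists_isFacetEquation_of_isExposed hG.2.1 hG.1
  rw [facetEq, dif_pos h]
  exact h.choose_spec

theorem facetEq_ne_zero (hG : G ∈ facets Q) : facetEq Q G ≠ 0 :=
  ne_zero_of_isFacetEquation hG (isFacetEquation_facetEq hG)

theorem facetEq_nonneg (hG : G ∈ facets Q) {x : E} (hx : x ∈ Q) : 0 ≤ facetEq Q G x :=
  (isFacetEquation_facetEq hG).1 x hx

theorem mem_facet_iff (hG : G ∈ facets Q) {x : E} (hx : x ∈ Q) : x ∈ G ↔ facetEq Q G x = 0 := by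
  conv_lhs => rw [(isFacetEquation_facetEq hG).2]
  exact ⟨fun h => h.2, fun h => ⟨hx, h⟩⟩

/-- A polytope with interior points is the intersection of the half-spaces of its facets. -/
theorem exists_facet_neg (hQ : IsPolytope Q) (hint : (interior Q).Nonempty) {x : E} (hx : x ∉ Q) :
    ∃ G ∈ facets Q, facetEq Q G x < 0 := by
  have hQ' := hQ
  obtain ⟨V, hV, hQV⟩ := hQ'
  -- The segment from `q` to `x` should leave `Q` through a facet. For this, `q` must avoid the
  -- proper subspaces spanned by `x` and vertices of `Q`.
  have hgen : ∀ᶠ q in generic E, ∀ W ∈ {W | W ⊆ V},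
      affineSpan ℝ (insert x W) ≠ ⊤ → q ∉ affineSpan ℝ (insert x W) :=
    (eventually_all_finite hV.finite_subsets).2 fun W _ => by
      by_cases h : affineSpan ℝ (insert x W) = ⊤
      · simp [h]
      · filter_upwards [eventually_generic_notMem _ h] with q hq _ using hq
  obtain ⟨q, hq, hqW⟩ := exists_generic_mem hgen isOpen_interior hint
  have hcont : Continuous fun t : ℝ => AffineMap.lineMap q x t := AffineMap.lineMap_continuous
  have hcomp : IsCompact (Icc (0 : ℝ) 1 ∩ {t | AffineMap.lineMap q x t ∈ Q}) :=
    isCompact_Icc.inter_right (hQ.isClosed.preimage hcont)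
  -- `t` is the last parameter at which the segment is in `Q`; the exit point `p` is therefore on
  -- the boundary and has a supporting functional `φ`.
  obtain ⟨t, ⟨⟨ht0, ht1⟩, htQ⟩, htmax⟩ := hcomp.exists_isGreatest
    ⟨0, ⟨le_rfl, zero_le_one⟩, by simpa using interior_subset hq⟩
  have htQ' : AffineMap.lineMap q x t ∈ Q := htQ
  have ht1' : t < 1 := lt_of_le_of_ne ht1 fun h => hx (by simpa [h] using htQ')
  set p := AffineMap.lineMap q x t with hp
  have hpint : p ∉ interior Q := by
    intro h
    have h1 : ∀ᶠ s in 𝓝[>] t, AffineMap.lineMap q x s ∈ interior Q :=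
      (hcont.continuousAt.eventually_mem (isOpen_interior.mem_nhds h)).filter_mono
        nhdsWithin_le_nhds
    have h2 : ∀ᶠ s in 𝓝[>] t, s < 1 := (eventually_lt_nhds ht1').filter_mono nhdsWithin_le_nhds
    obtain ⟨s, ⟨hs1, hs2⟩, hs3⟩ := ((h1.and h2).and self_mem_nhdsWithin).exists
    have hs4 : AffineMap.lineMap q x s ∈ Q := interior_subset hs1
    exact absurd (htmax ⟨⟨ht0.trans (le_of_lt hs3), hs2.le⟩, hs4⟩) (not_le.2 hs3)
  obtain ⟨φ, hφ⟩ := geometric_hahn_banach_open_point hQ.convex.interior isOpen_interior hpint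
  have hφQ : ∀ a ∈ Q, φ a ≤ φ p := by
    intro a ha
    have h1 : closure (interior Q) = Q := by
      rw [hQ.convex.closure_interior_eq_closure_of_nonempty_interior hint, hQ.isClosed.closure_eq]
    rw [← h1] at ha
    exact closure_minimal (fun b hb => (hφ b hb).le) (isClosed_le φ.continuous continuous_const) ha
  have hpG : p ∈ φ.toExposed Q := ⟨htQ', hφQ⟩
  have hexp : IsExposed ℝ Q (φ.toExposed Q) := ContinuousLinearMap.toExposed.isExposed
  have hqp : φ q < φ p := hφ q hq
  have hpx : p ≠ x := fun h => hx (h ▸ htQ')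
  -- Otherwise `q`, which is on the line through `x` and `p`, would be in the proper span of `x` and
  -- the vertices of the supporting face. So the face has codimension at most one, and at least one
  -- because `φ` is not constant.
  have htop : affineSpan ℝ (insert x (φ.toExposed Q)) = ⊤ := by
    by_contra hne
    have hGV := isExposed_convexHull_eq hV (hQV ▸ hexp)
    rw [← hQV] at hGV
    have hins : affineSpan ℝ (insert x (φ.toExposed Q)) =
        affineSpan ℝ (insert x (V ∩ φ.toExposed Q)) := by
      apply le_antisymm
      · refine affineSpan_le.2 (insert_subset (subset_affineSpan ℝ _ (mem_insert _ _)) ?_)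
        intro z hz
        rw [hGV] at hz
        have := convexHull_subset_affineSpan _ hz
        exact affineSpan_mono ℝ (subset_insert _ _) this
      · exact affineSpan_mono ℝ (insert_subset_insert inter_subset_right)
    refine hqW _ inter_subset_left (hins ▸ hne) ?_
    rw [← hins]
    have hx' : x ∈ affineSpan ℝ (insert x (φ.toExposed Q)) :=
      subset_affineSpan ℝ _ (mem_insert _ _)
    have hp' : p ∈ affineSpan ℝ (insert x (φ.toExposed Q)) :=
      subset_affineSpan ℝ _ (mem_insert_of_mem _ hpG)
    have : q = AffineMap.lineMap x p (1 / (1 - t)) := by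
      have h1 : (1 - t) ≠ 0 := by linarith
      have h2 : p - x = (1 - t) • (q - x) := by
        rw [hp, AffineMap.lineMap_apply]
        simp only [vsub_eq_sub, vadd_eq_add]
        module
      rw [AffineMap.lineMap_apply, vsub_eq_sub, h2, smul_smul, one_div, inv_mul_cancel₀ h1]
      simp
    rw [this]
    exact AffineMap.lineMap_mem _ hx' hp'
  have hφ0 : (φ : E →ₗ[ℝ] ℝ) ≠ 0 := by
    intro h
    have h1 : ∀ z, φ z = 0 := fun z => LinearMap.congr_fun h z
    rw [h1, h1] at hqp
    exact lt_irrefl _ hqp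
  have hfacet : φ.toExposed Q ∈ facets Q := by
    refine ⟨⟨p, hpG⟩, hexp, ?_⟩
    rw [finrank_vectorSpan_of_interior hint]
    have h1 := finrank_vectorSpan_insert_le_set ℝ (φ.toExposed Q) x
    have h2 : vectorSpan ℝ (insert x (φ.toExposed Q)) = ⊤ := by
      rw [← direction_affineSpan, htop, AffineSubspace.direction_top]
    rw [h2, finrank_top] at h1
    have h3 := finrank_ker_add_one hφ0
    have h4 : vectorSpan ℝ (φ.toExposed Q) ≤ LinearMap.ker (φ : E →ₗ[ℝ] ℝ) := by
      rw [vectorSpan_def, Submodule.span_le]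
      rintro _ ⟨a, ha, b, hb, rfl⟩
      simp only [vsub_eq_sub, SetLike.mem_coe, LinearMap.mem_ker, map_sub,
        ContinuousLinearMap.coe_coe]
      exact sub_eq_zero.2 (le_antisymm (hb.2 a ha.1) (ha.2 b hb.1))
    have h5 := Submodule.finrank_mono h4
    omega
  refine ⟨_, hfacet, ?_⟩
  -- Along the segment the facet equation is positive at `q` and zero at `p`, hence negative at `x`,
  -- which lies beyond `p`.
  have hpos := pos_of_mem_interior (isFacetEquation_facetEq hfacet).1 (facetEq_ne_zero hfacet) hq
  have hzero := (mem_facet_iff hfacet htQ').1 hpG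
  rw [hp, AffineMap.apply_lineMap, AffineMap.lineMap_apply] at hzero
  simp only [vsub_eq_sub, smul_eq_mul, vadd_eq_add] at hzero
  by_contra hneg
  push Not at hneg
  nlinarith

theorem mem_iff_forall_facetEq (hQ : IsPolytope Q) (hint : (interior Q).Nonempty) (x : E) :
    x ∈ Q ↔ ∀ G ∈ facets Q, 0 ≤ facetEq Q G x := by
  refine ⟨fun hx G hG => facetEq_nonneg hG hx, fun h => ?_⟩
  by_contra hx
  obtain ⟨G, hG, hlt⟩ := exists_facet_neg hQ hint hx
  exact absurd (h G hG) (not_le.2 hlt)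

/-- Near a point `p`, a polytope is cut out by its facets through `p`. -/
theorem eventually_mem_of_facets (hQ : IsPolytope Q) (hint : (interior Q).Nonempty) {p : E}
    (hp : p ∈ Q) : ∀ᶠ x in 𝓝 p, (∀ G ∈ facets Q, p ∈ G → 0 ≤ facetEq Q G x) → x ∈ Q := by
  have h : ∀ᶠ x in 𝓝 p, ∀ G ∈ facets Q, p ∉ G → 0 < facetEq Q G x := by
    refine (eventually_all_finite hQ.finite_facets).2 fun G hG => ?_
    by_cases hpG : p ∈ G
    · simp [hpG]
    · have h1 : 0 < facetEq Q G p :=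
        lt_of_le_of_ne (facetEq_nonneg hG hp) fun h => hpG ((mem_facet_iff hG hp).2 h.symm)
      filter_upwards [(AffineMap.continuous_of_finiteDimensional (facetEq Q G)).continuousAt.eventually
        (lt_mem_nhds h1)] with x hx _ using hx
  filter_upwards [h] with x hx hx'
  refine (mem_iff_forall_facetEq hQ hint x).2 fun G hG => ?_
  by_cases hpG : p ∈ G
  · exact hx' G hG hpG
  · exact (hx G hG hpG).le

/-- The midpoint of two points of `Q` is in a facet only if both endpoints are. So a point avoiding
some facets and a point avoiding a further one have a midpoint that avoids all of them. -/
theorem exists_mem_forall_notMem_facets (hS : S ⊆ Q) (hconv : Convex ℝ S) (hne : S.Nonempty)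
    (F : Set (Set E)) (hF : F.Finite) (hFQ : F ⊆ facets Q) (hSF : ∀ G ∈ F, ¬ S ⊆ G) :
    ∃ p ∈ S, ∀ G ∈ F, p ∉ G := by
  induction F, hF using Set.Finite.induction_on with
  | empty => exact ⟨hne.some, hne.some_mem, by simp⟩
  | @insert G F _ _ ih =>
    obtain ⟨p, hp, hpF⟩ := ih (fun G' h => hFQ (mem_insert_of_mem _ h))
      fun G' h => hSF G' (mem_insert_of_mem _ h)
    obtain ⟨q, hq, hqG⟩ := not_subset.1 (hSF G (mem_insert _ _))
    have hmid : midpoint ℝ p q ∈ S := hconv.midpoint_mem hp hq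
    refine ⟨midpoint ℝ p q, hmid, ?_⟩
    have key : ∀ G' ∈ facets Q, (p ∉ G' ∨ q ∉ G') → midpoint ℝ p q ∉ G' := by
      intro G' hG' h hm
      rw [mem_facet_iff hG' (hS hmid)] at hm
      rw [mem_facet_iff hG' (hS hp), mem_facet_iff hG' (hS hq)] at h
      have h1 := facetEq_nonneg hG' (hS hp)
      have h2 := facetEq_nonneg hG' (hS hq)
      rw [AffineMap.map_midpoint, midpoint_eq_smul_add, invOf_eq_inv, smul_eq_mul] at hm
      have h3 : facetEq Q G' p + facetEq Q G' q = 0 := by linarith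
      rcases h with h | h
      · exact h (by linarith)
      · exact h (by linarith)
    rintro G' (rfl | hG')
    · exact key _ (hFQ (mem_insert _ _)) (Or.inr hqG)
    · exact key _ (hFQ (mem_insert_of_mem _ hG')) (Or.inl (hpF G' hG'))

/-- A face contains points which lie in no other facets than those that contain the face. -/
theorem exists_relint_point (hQ : IsPolytope Q) (hS : IsExposed ℝ Q S) (hne : S.Nonempty) :
    ∃ p ∈ S, ∀ G ∈ facets Q, p ∈ G → S ⊆ G := by
  obtain ⟨p, hp, h⟩ := exists_mem_forall_notMem_facets hS.subset (hS.convex hQ.convex) hne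
    {G | G ∈ facets Q ∧ ¬ S ⊆ G} (hQ.finite_facets.subset fun _ h => h.1) (fun _ h => h.1)
    fun _ h => h.2
  exact ⟨p, hp, fun G hG hpG => by_contra fun h' => h G ⟨hG, h'⟩ hpG⟩

/-- The equations of the facets through `p` vanish on the whole line through `p` and `x`, and the
remaining facets impose no condition near `p`. -/
theorem exists_move_back (hQ : IsPolytope Q) (hint : (interior Q).Nonempty) {p x : E}
    (hp : p ∈ Q) (hx : x ∈ Q) (h : ∀ G ∈ facets Q, p ∈ G → x ∈ G) :
    ∃ ε : ℝ, 0 < ε ∧ p - ε • (x - p) ∈ Q := by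
  have hc : Tendsto (fun t : ℝ => p - t • (x - p)) (𝓝[>] 0) (𝓝 p) := by
    have : Continuous fun t : ℝ => p - t • (x - p) := by fun_prop
    have := this.tendsto 0
    simp only [zero_smul, sub_zero] at this
    exact this.mono_left nhdsWithin_le_nhds
  obtain ⟨t, ht, ht0⟩ := ((hc.eventually (eventually_mem_of_facets hQ hint hp)).and
    self_mem_nhdsWithin).exists
  refine ⟨t, ht0, ht fun G hG hpG => ?_⟩
  have h1 := (mem_facet_iff hG hp).1 hpG
  have h2 := (mem_facet_iff hG hx).1 (h G hG hpG)
  have h3 : p - t • (x - p) = AffineMap.lineMap p x (-t) := by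
    rw [AffineMap.lineMap_apply, vsub_eq_sub, vadd_eq_add]; module
  rw [h3, AffineMap.apply_lineMap, h1, h2]
  simp

/-- A non-empty face is the intersection of the facets which contain it. -/
theorem mem_of_forall_facets (hQ : IsPolytope Q) (hint : (interior Q).Nonempty)
    (hS : IsExposed ℝ Q S) (hne : S.Nonempty) {x : E} (hx : x ∈ Q)
    (h : ∀ G ∈ facets Q, S ⊆ G → x ∈ G) : x ∈ S := by
  obtain ⟨p, hp, hpG⟩ := exists_relint_point hQ hS hne
  obtain ⟨ε, hε, hback⟩ := exists_move_back hQ hint (hS.subset hp) hx fun G hG h' =>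
    h G hG (hpG G hG h')
  -- `p` lies strictly between `x` and `p - ε (x - p)`, with weights `ε / (1 + ε)` and `1 / (1 +
  -- ε)`, so extremality of the face puts `x` in it.
  refine hS.isExtreme.2 hx hback hp ?_
  refine ⟨ε / (1 + ε), 1 / (1 + ε), by positivity, by positivity, by field_simp; ring, ?_⟩
  have h1 : (1 + ε) ≠ 0 := by positivity
  rw [div_eq_inv_mul, one_div]
  have : p = (1 + ε)⁻¹ • ((1 + ε) • p) := by rw [smul_smul, inv_mul_cancel₀ h1, one_smul]
  conv_rhs => rw [this]
  rw [mul_smul, ← smul_add]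
  congr 1
  module

/-- The smallest face of `Q` containing the point `x`. -/
def minFace (Q : Set E) (x : E) : Set E := {z ∈ Q | ∀ G ∈ facets Q, x ∈ G → z ∈ G}

theorem mem_minFace {x : E} (hx : x ∈ Q) : x ∈ minFace Q x := ⟨hx, fun _ _ h => h⟩

theorem isExposed_setOf_forall_mem {F : Set (Set E)} (hF : F.Finite)
    (hFQ : ∀ G ∈ F, IsExposed ℝ Q G) : IsExposed ℝ Q {z ∈ Q | ∀ G ∈ F, z ∈ G} := by
  induction F, hF using Set.Finite.induction_on with
  | empty => simpa using IsExposed.refl Q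
  | @insert G F _ _ ih =>
    have h := (hFQ G (mem_insert _ _)).inter (ih fun G' h => hFQ G' (mem_insert_of_mem _ h))
    have h' : {z ∈ Q | ∀ G' ∈ insert G F, z ∈ G'} = G ∩ {z ∈ Q | ∀ G' ∈ F, z ∈ G'} := by
      ext z
      simp only [mem_insert_iff, forall_eq_or_imp]
      change (z ∈ Q ∧ _) ↔ (_ ∧ (z ∈ Q ∧ _))
      tauto
    rwa [h']

theorem isExposed_minFace (hQ : IsPolytope Q) (x : E) : IsExposed ℝ Q (minFace Q x) := by
  have h := isExposed_setOf_forall_mem (Q := Q) (F := {G | G ∈ facets Q ∧ x ∈ G})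
    (hQ.finite_facets.subset fun _ h => h.1) fun G h => h.1.2.1
  have h' : minFace Q x = {z ∈ Q | ∀ G ∈ {G | G ∈ facets Q ∧ x ∈ G}, z ∈ G} := by
    ext z
    exact ⟨fun h => ⟨h.1, fun G hG => h.2 G hG.1 hG.2⟩,
      fun h => ⟨h.1, fun G h1 h2 => h.2 G ⟨h1, h2⟩⟩⟩
  rwa [h']

theorem facet_eq_of_zero_iff {G' : Set E} {ℓ ℓ' : E →ᵃ[ℝ] ℝ} (hℓ : IsFacetEquation Q G ℓ)
    (hℓ' : IsFacetEquation Q G' ℓ') (h : ∀ x, ℓ x = 0 ↔ ℓ' x = 0) : G = G' := by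
  rw [hℓ.2, hℓ'.2]
  ext x
  exact and_congr_right fun _ => h x

/-- Near `p` the whole hyperplane belongs to `Q`, so the face contains a small piece of every
direction in the kernel of the equation and has codimension one. -/
theorem mem_facets_of_isFacetEquation (hint : (interior Q).Nonempty) {ℓ : E →ᵃ[ℝ] ℝ}
    (hℓ : IsFacetEquation Q G ℓ) (h0 : ℓ.linear ≠ 0) {p : E} (hp : p ∈ G)
    (hloc : ∀ᶠ x in 𝓝 p, ℓ x = 0 → x ∈ Q) : G ∈ facets Q := by
  refine ⟨⟨p, hp⟩, hℓ.isExposed, ?_⟩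
  have hp0 : ℓ p = 0 := by rw [hℓ.2] at hp; exact hp.2
  have hspan : vectorSpan ℝ G = LinearMap.ker ℓ.linear := by
    refine le_antisymm (vectorSpan_le_ker fun x hx => by rw [hℓ.2] at hx; exact hx.2) ?_
    intro v hv
    have hc : Tendsto (fun t : ℝ => p + t • v) (𝓝[>] 0) (𝓝 p) := by
      have : Continuous fun t : ℝ => p + t • v := by fun_prop
      have := this.tendsto 0
      simp only [zero_smul, add_zero] at this
      exact this.mono_left nhdsWithin_le_nhds
    obtain ⟨t, ht, ht0⟩ := ((hc.eventually hloc).and self_mem_nhdsWithin).exists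
    have h1 : ℓ (p + t • v) = 0 := by
      have := ℓ.map_vadd p (t • v)
      rw [vadd_eq_add, add_comm] at this
      rw [this, map_smul, LinearMap.mem_ker.1 hv, hp0]
      simp
    have h2 : p + t • v ∈ G := by rw [hℓ.2]; exact ⟨ht h1, h1⟩
    have h3 := vsub_mem_vectorSpan ℝ h2 hp
    rw [vsub_eq_sub, add_sub_cancel_left] at h3
    exact (Submodule.smul_mem_iff _ (ne_of_gt ht0)).1 h3
  rw [hspan, finrank_vectorSpan_of_interior hint]
  exact finrank_ker_add_one h0

end Faces

/-! ### Numerators of canonical functions -/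

section Numerators

variable {E E' : Type*} [NormedAddCommGroup E] [NormedSpace ℝ E] [FiniteDimensional ℝ E]
  [NormedAddCommGroup E'] [NormedSpace ℝ E'] [FiniteDimensional ℝ E'] {P G : Set E'}

/-- `N` restricts to a polynomial of degree at most `k` on every line. -/
def IsLinePolynomial (N : E → ℝ) (k : ℕ) : Prop :=
  ∀ x v : E, ∃ p : Polynomial ℝ, p.natDegree ≤ k ∧ ∀ t : ℝ, N (x + t • v) = p.eval t

theorem IsLinePolynomial.comp {N : E' → ℝ} {k : ℕ} (h : IsLinePolynomial N k) (e : E →ᵃ[ℝ] E') :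
    IsLinePolynomial (fun x => N (e x)) k := by
  intro x v
  obtain ⟨p, hp, hN⟩ := h (e x) (e.linear v)
  refine ⟨p, hp, fun t => ?_⟩
  beta_reduce
  rw [← hN t]
  have := e.map_vadd x (t • v)
  rw [vadd_eq_add, vadd_eq_add, map_smul, add_comm] at this
  rw [this, add_comm]

theorem IsLinePolynomial.mono {N : E → ℝ} {k k' : ℕ} (h : IsLinePolynomial N k) (hk : k ≤ k') :
    IsLinePolynomial N k' := fun x v =>
  let ⟨p, hp, hN⟩ := h x v
  ⟨p, hp.trans hk, hN⟩

theorem IsLinePolynomial.mul {N N' : E → ℝ} {k k' : ℕ} (h : IsLinePolynomial N k)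
    (h' : IsLinePolynomial N' k') : IsLinePolynomial (fun x => N x * N' x) (k + k') := by
  intro x v
  obtain ⟨p, hp, hN⟩ := h x v
  obtain ⟨p', hp', hN'⟩ := h' x v
  exact ⟨p * p', Polynomial.natDegree_mul_le.trans (add_le_add hp hp'), fun t => by
    beta_reduce
    rw [hN, hN', Polynomial.eval_mul]⟩

theorem isLinePolynomial_const (c : ℝ) : IsLinePolynomial (fun _ : E => c) 0 :=
  fun _ _ => ⟨Polynomial.C c, by simp, fun t => by simp⟩

theorem isLinePolynomial_affine (a : E →ᵃ[ℝ] ℝ) : IsLinePolynomial (fun x => a x) 1 := by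
  intro x v
  refine ⟨Polynomial.C (a.linear v) * Polynomial.X + Polynomial.C (a x),
    Polynomial.natDegree_linear_le, fun t => ?_⟩
  have := a.map_vadd x (t • v)
  rw [vadd_eq_add, vadd_eq_add, map_smul, add_comm, smul_eq_mul] at this
  beta_reduce
  rw [this]
  simp
  ring

theorem isLinePolynomial_sum {ι : Type*} (s : Finset ι) {N : ι → E → ℝ} {k : ℕ}
    (h : ∀ i ∈ s, IsLinePolynomial (N i) k) : IsLinePolynomial (fun x => ∑ i ∈ s, N i x) k := by
  intro x v
  choose! p hp hN using fun i hi => h i hi x v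
  refine ⟨∑ i ∈ s, p i, Polynomial.natDegree_sum_le_of_forall_le _ _ hp, fun t => ?_⟩
  rw [Polynomial.eval_finsetSum]
  exact Finset.sum_congr rfl fun i hi => hN i hi t

theorem isLinePolynomial_prod (s : Finset (E →ᵃ[ℝ] ℝ)) :
    IsLinePolynomial (fun x => ∏ a ∈ s, a x) s.card := by
  classical
  induction s using Finset.induction_on with
  | empty => simpa using isLinePolynomial_const (E := E) 1
  | insert a s ha ih =>
    have := (isLinePolynomial_affine a).mul ih
    rw [Finset.card_insert_of_notMem ha, add_comm]
    simpa only [Finset.prod_insert ha] using this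

theorem isLinePolynomial_eval {d : ℕ} (N : MvPolynomial (Fin d) ℝ) :
    IsLinePolynomial (fun x : EuclideanSpace ℝ (Fin d) => MvPolynomial.eval (fun i => x i) N)
      N.totalDegree := by
  intro x v
  refine ⟨MvPolynomial.aeval (fun i => Polynomial.C (v i) * Polynomial.X + Polynomial.C (x i)) N,
    ?_, fun t => ?_⟩
  · have h := MvPolynomial.aeval_natDegree_le (m := N.totalDegree) (n := 1) N le_rfl
      (fun i => Polynomial.C (v i) * Polynomial.X + Polynomial.C (x i))
      fun i => Polynomial.natDegree_linear_le
    simpa using h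
  · beta_reduce
    rw [← Polynomial.coe_evalRingHom, MvPolynomial.aeval_def, MvPolynomial.hom_eval₂,
      MvPolynomial.eval_eq', MvPolynomial.eval₂_eq']
    have h : ∀ i, Polynomial.evalRingHom t
        (Polynomial.C (v i) * Polynomial.X + Polynomial.C (x i)) = (x + t • v) i := fun i => by
      simp
      ring
    simp only [h]
    refine Finset.sum_congr rfl fun m _ => ?_
    simp

theorem analyticOnNhd_eval {d : ℕ} (N : MvPolynomial (Fin d) ℝ) :
    AnalyticOnNhd ℝ
      (fun x : EuclideanSpace ℝ (Fin d) => MvPolynomial.eval (fun i => x i) N) univ := by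
  have h := AnalyticOnNhd.eval_mvPolynomial (𝕜 := ℝ) N
  intro x _
  have h1 := h (WithLp.ofLp x) (mem_univ _)
  exact h1.comp ((EuclideanSpace.equiv (Fin d) ℝ).toContinuousLinearMap.analyticAt x)

theorem analyticAt_affine (a : E →ᵃ[ℝ] E') (x : E) : AnalyticAt ℝ (fun x => a x) x := by
  have : (fun x => a x) = fun x => LinearMap.toContinuousLinearMap a.linear x + a 0 := by
    ext x
    have := a.map_vadd 0 x
    simpa using this
  rw [this]
  exact ((LinearMap.toContinuousLinearMap a.linear).analyticAt x).add analyticAt_const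

theorem affineEquiv_preimage_symm_preimage (e : E ≃ᵃ[ℝ] E') (S : Set E) :
    e ⁻¹' (e.symm ⁻¹' S) = S := by
  ext x; simp

theorem IsFacetEquation.preimage {ℓ : E' →ᵃ[ℝ] ℝ} (h : IsFacetEquation P G ℓ) (e : E →ᵃ[ℝ] E') :
    IsFacetEquation (e ⁻¹' P) (e ⁻¹' G) (ℓ.comp e) := by
  refine ⟨fun x hx => h.1 _ hx, ?_⟩
  conv_lhs => rw [h.2]
  rfl

theorem finrank_vectorSpan_preimage (e : E ≃ᵃ[ℝ] E') (S : Set E') :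
    Module.finrank ℝ (vectorSpan ℝ (e ⁻¹' S)) = Module.finrank ℝ (vectorSpan ℝ S) := by
  have h1 : S = (e : E →ᵃ[ℝ] E') '' (e ⁻¹' S) := by
    rw [AffineEquiv.coe_toAffineMap, image_preimage_eq _ e.surjective]
  conv_rhs => rw [h1, ← AffineMap.map_vectorSpan]
  exact (LinearEquiv.finrank_map_eq e.linear _).symm

theorem preimage_mem_facets (e : E ≃ᵃ[ℝ] E') (hG : G ∈ facets P) :
    e ⁻¹' G ∈ facets (e ⁻¹' P) := by
  refine ⟨hG.1.preimage e.surjective,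
    ((isFacetEquation_facetEq hG).preimage (e : E →ᵃ[ℝ] E')).isExposed, ?_⟩
  rw [finrank_vectorSpan_preimage, finrank_vectorSpan_preimage]
  exact hG.2.2

theorem affineEquiv_symm_preimage_preimage (e : E ≃ᵃ[ℝ] E') (S : Set E') :
    e.symm ⁻¹' (e ⁻¹' S) = S :=
  affineEquiv_preimage_symm_preimage e.symm S

theorem affineEquiv_preimage_interior (e : E ≃ᵃ[ℝ] E') (S : Set E') :
    e ⁻¹' interior S = interior (e ⁻¹' S) :=
  e.toContinuousAffineEquiv.toHomeomorph.preimage_interior S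

theorem bijOn_facets (e : E ≃ᵃ[ℝ] E') (P : Set E') :
    BijOn (fun G => e.symm ⁻¹' G) (facets (e ⁻¹' P)) (facets P) := by
  refine ⟨fun G hG => ?_, fun G _ G' _ h => ?_, fun G hG => ⟨e ⁻¹' G, preimage_mem_facets e hG,
    affineEquiv_symm_preimage_preimage e G⟩⟩
  · have := preimage_mem_facets e.symm hG
    rwa [affineEquiv_symm_preimage_preimage] at this
  · have h' := congrArg (fun S => e ⁻¹' S) h
    simpa only [affineEquiv_preimage_symm_preimage] using h'

theorem mem_affineSpan_preimage (e : E ≃ᵃ[ℝ] E') (S : Set E') (x : E) :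
    x ∈ affineSpan ℝ (e ⁻¹' S) ↔ e x ∈ affineSpan ℝ S := by
  have h1 : S = (e : E →ᵃ[ℝ] E') '' (e ⁻¹' S) := by
    rw [AffineEquiv.coe_toAffineMap, image_preimage_eq _ e.surjective]
  conv_rhs => rw [h1, ← AffineSubspace.map_span]
  rw [AffineSubspace.mem_map]
  constructor
  · exact fun h => ⟨x, h, rfl⟩
  · rintro ⟨y, hy, hyx⟩
    rwa [← e.injective hyx]

theorem mem_offFacets_preimage (e : E ≃ᵃ[ℝ] E') (P : Set E') (x : E) :
    x ∈ offFacets (e ⁻¹' P) ↔ e x ∈ offFacets P := by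
  constructor
  · intro h G hG hx
    exact h _ (preimage_mem_facets e hG) ((mem_affineSpan_preimage e G x).2 hx)
  · intro h G hG hx
    refine h _ ((bijOn_facets e P).mapsTo hG) ?_
    rw [← mem_affineSpan_preimage, affineEquiv_preimage_symm_preimage]
    exact hx

end Numerators

/-! ### A coordinate-free weakening of canonical functions. -/

section WeakCanonical

/-- Off the facet hyperplanes, `f` is a quotient of an analytic function, whose restrictions to
lines are polynomials of low degree, and the product of the facet equations. -/
def HasFacetPoles {d : ℕ} (P : Set (EuclideanSpace ℝ (Fin d)))
    (f : EuclideanSpace ℝ (Fin d) → ℝ) : Prop :=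
  ∃ (ℓ : Set (EuclideanSpace ℝ (Fin d)) → EuclideanSpace ℝ (Fin d) →ᵃ[ℝ] ℝ)
    (N : EuclideanSpace ℝ (Fin d) → ℝ) (k : ℕ),
    (∀ G ∈ facets P, IsFacetEquation P G (ℓ G)) ∧ AnalyticOnNhd ℝ N univ ∧
    IsLinePolynomial N k ∧ k + d + 1 ≤ (facets P).ncard ∧
    ∀ x ∈ offFacets P, f x = N x / ∏ᶠ G ∈ facets P, ℓ G x

/-- The properties of canonical functions that determine them, in a form which is invariant under
affine changes of coordinates. -/
def IsWeakCanonical : (d : ℕ) → Set (EuclideanSpace ℝ (Fin d)) →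
    (EuclideanSpace ℝ (Fin d) → ℝ) → Prop
  | 0, _, f => ∀ x, f x = 1
  | d + 1, P, f =>
    HasFacetPoles P f ∧ (∀ x ∈ interior P, 0 < f x) ∧
    ∀ G ∈ facets P,
      ∀ Φ : EuclideanSpace ℝ (Fin (d + 1)) ≃ᵃ[ℝ] EuclideanSpace ℝ (Fin (d + 1)),
        (∀ z, Φ z ∈ P → 0 ≤ z 0) → G = {x ∈ P | (Φ.symm x) 0 = 0} →
        ∃ h : EuclideanSpace ℝ (Fin d) → ℝ,
          IsWeakCanonical d {t | Φ (consPoint 0 t) ∈ G} h ∧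
          ∀ t, (∀ G' ∈ facets P, G' ≠ G → Φ (consPoint 0 t) ∉ affineSpan ℝ G') →
            Tendsto (fun s : ℝ => s * f (Φ (consPoint s t)) *
              |LinearMap.det (Φ.linear : EuclideanSpace ℝ (Fin (d + 1)) →ₗ[ℝ]
                EuclideanSpace ℝ (Fin (d + 1)))|) (𝓝[≠] 0) (𝓝 (h t))

theorem HasSimpleFacetPoles.hasFacetPoles {d : ℕ} {P : Set (EuclideanSpace ℝ (Fin d))}
    {f : EuclideanSpace ℝ (Fin d) → ℝ} (h : HasSimpleFacetPoles P f) : HasFacetPoles P f := by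
  obtain ⟨ℓ, N, hℓ, hdeg, hf⟩ := h
  exact ⟨ℓ, _, _, hℓ, analyticOnNhd_eval N, isLinePolynomial_eval N, hdeg, hf⟩

theorem IsCanonicalFunction.isWeakCanonical : ∀ {d : ℕ} {P : Set (EuclideanSpace ℝ (Fin d))}
    {f : EuclideanSpace ℝ (Fin d) → ℝ}, IsCanonicalFunction d P f → IsWeakCanonical d P f
  | 0, _, _, h => h
  | _ + 1, _, _, ⟨h1, h2, h3⟩ => ⟨h1.hasFacetPoles, h2, fun G hG Φ hΦ hGΦ =>
    let ⟨h, hh, hlim⟩ := h3 G hG Φ hΦ hGΦ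
    ⟨h, hh.isWeakCanonical, hlim⟩⟩

theorem HasFacetPoles.comp {d : ℕ} {P : Set (EuclideanSpace ℝ (Fin d))}
    {f : EuclideanSpace ℝ (Fin d) → ℝ} (h : HasFacetPoles P f)
    (A : EuclideanSpace ℝ (Fin d) ≃ᵃ[ℝ] EuclideanSpace ℝ (Fin d)) (c : ℝ) :
    HasFacetPoles (A ⁻¹' P) fun x => f (A x) * c := by
  obtain ⟨ℓ, N, k, hℓ, hN, hk, hdeg, hf⟩ := h
  have hbij := bijOn_facets A P
  refine ⟨fun G => (ℓ (A.symm ⁻¹' G)).comp (A : EuclideanSpace ℝ (Fin d) →ᵃ[ℝ] _),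
    fun x => N (A x) * c, k, fun G hG => ?_, ?_, ?_, ?_, fun x hx => ?_⟩
  · have := (hℓ _ (hbij.mapsTo hG)).preimage (A : EuclideanSpace ℝ (Fin d) →ᵃ[ℝ] _)
    rwa [AffineEquiv.coe_toAffineMap, affineEquiv_preimage_symm_preimage] at this
  · intro x _
    have hA : AnalyticAt ℝ A x := analyticAt_affine A.toAffineMap x
    exact (AnalyticAt.comp (g := N) (hN (A x) (mem_univ _)) hA).mul analyticAt_const
  · simpa using (hk.comp (A : EuclideanSpace ℝ (Fin d) →ᵃ[ℝ] _)).mul (isLinePolynomial_const c)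
  · rwa [← hbij.injOn.ncard_image, hbij.image_eq]
  · beta_reduce
    rw [hf _ ((mem_offFacets_preimage A P x).1 hx), div_mul_eq_mul_div]
    congr 1
    exact (finprod_mem_eq_of_bijOn _ hbij fun G hG => rfl).symm

/-- A residue chart `Φ` for the preimage becomes the chart `Φ.trans A` for `P`, and multiplicativity
of the determinant accounts for the factor. Polynomial numerators are not needed here, which is the
advantage of the weak notion. -/
theorem IsWeakCanonical.comp : ∀ {d : ℕ} {P : Set (EuclideanSpace ℝ (Fin d))}
    {f : EuclideanSpace ℝ (Fin d) → ℝ}, IsWeakCanonical d P f →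
    ∀ A : EuclideanSpace ℝ (Fin d) ≃ᵃ[ℝ] EuclideanSpace ℝ (Fin d),
    IsWeakCanonical d (A ⁻¹' P) fun x => f (A x) * |LinearMap.det (A.linear :
      EuclideanSpace ℝ (Fin d) →ₗ[ℝ] EuclideanSpace ℝ (Fin d))|
  | 0, P, f, h, A => by
    intro x
    beta_reduce
    rw [h (A x), LinearMap.det_eq_one_of_finrank_eq_zero (by simp)]
    simp
  | d + 1, P, f, h, A => by
    obtain ⟨h1, h2, h3⟩ := h
    refine ⟨h1.comp A _, fun x hx => ?_, fun G hG Φ hΦ hGΦ => ?_⟩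
    · have hx' : A x ∈ interior P := by
        rwa [← affineEquiv_preimage_interior] at hx
      refine mul_pos (h2 _ hx') (abs_pos.2 ?_)
      exact (LinearEquiv.isUnit_det' A.linear).ne_zero
    · have hbij := bijOn_facets A P
      obtain ⟨h, hh, hlim⟩ := h3 (A.symm ⁻¹' G) (hbij.mapsTo hG) (Φ.trans A) (fun z hz => hΦ z hz) (by
        rw [hGΦ]
        ext x
        change (A (A.symm x) ∈ P ∧ _) ↔ (_ ∧ _)
        rw [AffineEquiv.apply_symm_apply]
        rfl)
      refine ⟨h, ?_, fun t ht => ?_⟩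
      · convert hh using 1
        ext t
        change _ ↔ A.symm (A _) ∈ G
        rw [AffineEquiv.symm_apply_apply]
        rfl
      · refine (hlim t fun G' hG' hne hmem => ?_).congr fun s => ?_
        · refine ht (A ⁻¹' G') (preimage_mem_facets A hG') ?_ ?_
          · rintro rfl
            exact hne (affineEquiv_symm_preimage_preimage A G').symm
          · rw [mem_affineSpan_preimage]
            exact hmem
        · change _ * f (A (Φ _)) * |LinearMap.det ((A.linear : EuclideanSpace ℝ (Fin (d + 1)) →ₗ[ℝ] _) ∘ₗ
            (Φ.linear : EuclideanSpace ℝ (Fin (d + 1)) →ₗ[ℝ] _))| = _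
          rw [LinearMap.det_comp, abs_mul]
          ring

end WeakCanonical

/-! ### Uniqueness of facet equations and the complement of the facet hyperplanes. -/

section FacetEquations

variable {E : Type*} [NormedAddCommGroup E] [NormedSpace ℝ E] [FiniteDimensional ℝ E]
  {P G : Set E}

/-- The equation of a facet is unique up to a positive factor. -/
theorem IsFacetEquation.exists_pos_mul (hint : (interior P).Nonempty) (hG : G ∈ facets P)
    {ℓ ℓ' : E →ᵃ[ℝ] ℝ} (hℓ : IsFacetEquation P G ℓ) (hℓ' : IsFacetEquation P G ℓ') :
    ∃ c : ℝ, 0 < c ∧ ∀ x, ℓ x = c * ℓ' x := by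
  obtain ⟨q, hq⟩ := hint
  obtain ⟨p, hp⟩ := hG.1
  have h1 := pos_of_mem_interior hℓ.1 (ne_zero_of_isFacetEquation hG hℓ) hq
  have h2 := pos_of_mem_interior hℓ'.1 (ne_zero_of_isFacetEquation hG hℓ') hq
  refine ⟨ℓ q / ℓ' q, div_pos h1 h2, fun x => ?_⟩
  have hp0 : ℓ p = 0 := by rw [hℓ.2] at hp; exact hp.2
  have hp0' : ℓ' p = 0 := by rw [hℓ'.2] at hp; exact hp.2
  -- With this `s` the point `x - s (q - p)` lies on the facet hyperplane. Both equations vanish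
  -- there, which gives `ℓ x = s * ℓ q`.
  set s := ℓ' x / ℓ' q
  have key : ∀ a : E →ᵃ[ℝ] ℝ, a p = 0 → a (x - s • (q - p)) = a x - s * a q := by
    intro a ha
    have e1 := a.map_vadd x (-(s • (q - p)))
    have e2 := a.linearMap_vsub q p
    rw [vsub_eq_sub, vsub_eq_sub, ha, sub_zero] at e2
    rw [map_neg, map_smul, e2, vadd_eq_add, vadd_eq_add, neg_add_eq_sub] at e1
    rw [e1, smul_eq_mul]
    ring
  have h3 : ℓ' (x - s • (q - p)) = 0 := by
    rw [key ℓ' hp0', div_mul_cancel₀ _ h2.ne', sub_self]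
  have h4 := (mem_affineSpan_facet ⟨q, hq⟩ hG hℓ' _).2 h3
  have h5 := (mem_affineSpan_facet ⟨q, hq⟩ hG hℓ _).1 h4
  rw [key ℓ hp0] at h5
  have : ℓ x = s * ℓ q := by linarith
  rw [this]
  simp only [s]
  ring

theorem mem_offFacets_iff (hint : (interior P).Nonempty) (x : E) :
    x ∈ offFacets P ↔ ∀ G ∈ facets P, facetEq P G x ≠ 0 :=
  forall₂_congr fun _ hG => not_congr (mem_affineSpan_facet hint hG (isFacetEquation_facetEq hG) x)

theorem eventually_generic_offFacets (hP : IsPolytope P) (hint : (interior P).Nonempty) :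
    ∀ᶠ x in generic E, x ∈ offFacets P := by
  filter_upwards [finite_eventually_generic_ne_zero hP.finite_facets (facetEq P)
    fun G hG => facetEq_ne_zero hG] with x hx
  exact (mem_offFacets_iff hint x).2 hx

theorem isOpen_offFacets (hP : IsPolytope P) (hint : (interior P).Nonempty) :
    IsOpen (offFacets P) := by
  have : offFacets P = ⋂ G ∈ facets P, {x | facetEq P G x ≠ 0} := by
    ext x
    rw [mem_offFacets_iff hint]
    simp only [mem_iInter]
    rfl
  rw [this]
  exact hP.finite_facets.isOpen_biInter fun G _ => isOpen_ne_zero _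

theorem interior_subset_offFacets (hint : (interior P).Nonempty) :
    interior P ⊆ offFacets P := fun x hx =>
  (mem_offFacets_iff hint x).2 fun _ hG =>
    (pos_of_mem_interior (isFacetEquation_facetEq hG).1 (facetEq_ne_zero hG) hx).ne'

end FacetEquations

/-! ### Numerators with respect to chosen facet equations. -/

section

variable {d : ℕ} {P : Set (EuclideanSpace ℝ (Fin d))} {f : EuclideanSpace ℝ (Fin d) → ℝ}

/-- The positive factors between the given equations and `facetEq` are absorbed into the numerator.
-/
theorem HasFacetPoles.exists_numerator (hf : HasFacetPoles P f) (hP : IsPolytope P)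
    (hint : (interior P).Nonempty) :
    ∃ (N : EuclideanSpace ℝ (Fin d) → ℝ) (k : ℕ), AnalyticOnNhd ℝ N univ ∧
      IsLinePolynomial N k ∧ k + d + 1 ≤ (facets P).ncard ∧
      ∀ x ∈ offFacets P, f x = N x / ∏ G ∈ hP.finite_facets.toFinset, facetEq P G x := by
  obtain ⟨ℓ, N, k, hℓ, hN, hk, hdeg, hform⟩ := hf
  choose! c hc hcl using fun G hG =>
    (hℓ G hG).exists_pos_mul hint hG (isFacetEquation_facetEq hG)
  set C := ∏ G ∈ hP.finite_facets.toFinset, c G with hC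
  have hC0 : C ≠ 0 := Finset.prod_ne_zero_iff.2 fun G hG => (hc G (by simpa using hG)).ne'
  refine ⟨fun x => N x * C⁻¹, k, fun x hx => (hN x hx).mul analyticAt_const,
    by simpa using hk.mul (isLinePolynomial_const C⁻¹), hdeg, fun x hx => ?_⟩
  have hprod : ∏ᶠ G ∈ facets P, ℓ G x =
      C * ∏ G ∈ hP.finite_facets.toFinset, facetEq P G x := by
    rw [finprod_mem_eq_finite_toFinset_prod _ hP.finite_facets, hC, ← Finset.prod_mul_distrib]
    exact Finset.prod_congr rfl fun G hG => hcl G (by simpa using hG) x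
  beta_reduce
  rw [hform x hx, hprod, div_mul_eq_div_div, div_eq_mul_inv (N x)]

theorem facets_eq_empty_of_finrank (P : Set (EuclideanSpace ℝ (Fin 0))) : facets P = ∅ := by
  ext G
  refine ⟨fun hG => ?_, fun h => h.elim⟩
  have h1 := hG.2.2
  have h2 := Submodule.finrank_le (vectorSpan ℝ P)
  rw [finrank_euclideanSpace, Fintype.card_fin] at h2
  omega

theorem IsWeakCanonical.exists_numerator (hf : IsWeakCanonical d P f) (hP : IsPolytope P)
    (hint : (interior P).Nonempty) :
    ∃ N : EuclideanSpace ℝ (Fin d) → ℝ, AnalyticOnNhd ℝ N univ ∧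
      ∀ x ∈ offFacets P, f x = N x / ∏ G ∈ hP.finite_facets.toFinset, facetEq P G x := by
  cases d with
  | zero =>
    refine ⟨fun _ => 1, fun _ _ => analyticAt_const, fun x _ => ?_⟩
    rw [hf x, Finset.prod_eq_one, div_one]
    intro G hG
    have : G ∈ facets P := by simpa using hG
    rw [facets_eq_empty_of_finrank] at this
    exact this.elim
  | succ d =>
    obtain ⟨N, k, hN, -, -, h⟩ := hf.1.exists_numerator hP hint
    exact ⟨N, hN, h⟩

theorem IsWeakCanonical.continuousAt (hf : IsWeakCanonical d P f) (hP : IsPolytope P)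
    (hint : (interior P).Nonempty) {x : EuclideanSpace ℝ (Fin d)} (hx : x ∈ offFacets P) :
    ContinuousAt f x := by
  obtain ⟨N, hN, h⟩ := hf.exists_numerator hP hint
  have h1 : ContinuousAt
      (fun x => N x / ∏ G ∈ hP.finite_facets.toFinset, facetEq P G x) x := by
    refine (hN x (mem_univ x)).continuousAt.div ?_ ?_
    · exact (continuous_finsetProd _ fun G _ =>
        AffineMap.continuous_of_finiteDimensional (facetEq P G)).continuousAt
    · exact Finset.prod_ne_zero_iff.2 fun G hG =>
        (mem_offFacets_iff hint x).1 hx G (by simpa using hG)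
  refine h1.congr ?_
  filter_upwards [(isOpen_offFacets hP hint).mem_nhds hx] with z hz
  exact (h z hz).symm

theorem IsWeakCanonical.pos (hf : IsWeakCanonical d P f) {x : EuclideanSpace ℝ (Fin d)}
    (hx : x ∈ interior P) : 0 < f x := by
  cases d with
  | zero => rw [hf x]; exact one_pos
  | succ d => exact hf.2.1 x hx

/-- A normalized numerator and denominator of a canonical function. -/
theorem HasFacetPoles.exists_normalized (hf : HasFacetPoles P f) (hP : IsPolytope P)
    (hint : (interior P).Nonempty) {x₀ : EuclideanSpace ℝ (Fin d)} (hx₀ : x₀ ∈ offFacets P) :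
    ∃ (A : Finset (EuclideanSpace ℝ (Fin d) →ᵃ[ℝ] ℝ)) (N : EuclideanSpace ℝ (Fin d) → ℝ) (k : ℕ),
      (∀ a ∈ A, a x₀ = 1 ∧ a.linear ≠ 0) ∧ Continuous N ∧ IsLinePolynomial N k ∧
      k + d + 1 ≤ A.card ∧ ∀ x, (∀ a ∈ A, a x ≠ 0) → f x = N x / ∏ a ∈ A, a x := by
  classical
  obtain ⟨N, k, hN, hk, hdeg, hform⟩ := hf.exists_numerator hP hint
  have hne := (mem_offFacets_iff hint x₀).1 hx₀
  -- An equation with value `1` at `x₀` is determined by its hyperplane. Denominators of different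
  -- polytopes can then be compared as finite sets of affine functions.
  let ν : Set (EuclideanSpace ℝ (Fin d)) → EuclideanSpace ℝ (Fin d) →ᵃ[ℝ] ℝ :=
    fun G => (facetEq P G x₀)⁻¹ • facetEq P G
  have hν : ∀ G x, ν G x = (facetEq P G x₀)⁻¹ * facetEq P G x := fun G x => rfl
  have hinj : InjOn ν (hP.finite_facets.toFinset : Set (Set (EuclideanSpace ℝ (Fin d)))) := by
    intro G hG G' hG' h
    have hG : G ∈ facets P := by simpa using hG
    have hG' : G' ∈ facets P := by simpa using hG'
    refine facet_eq_of_zero_iff (isFacetEquation_facetEq hG) (isFacetEquation_facetEq hG')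
      fun x => ?_
    have := congrArg (fun a => a x = 0) h
    simpa [hν, hne G hG, hne G' hG'] using this
  set C := ∏ G ∈ hP.finite_facets.toFinset, facetEq P G x₀ with hC
  have hprod : ∀ x, ∏ a ∈ hP.finite_facets.toFinset.image ν, a x =
      C⁻¹ * ∏ G ∈ hP.finite_facets.toFinset, facetEq P G x := by
    intro x
    rw [Finset.prod_image hinj, hC, ← Finset.prod_inv_distrib, ← Finset.prod_mul_distrib]
    exact Finset.prod_congr rfl fun G _ => hν G x
  have hC0 : C ≠ 0 := Finset.prod_ne_zero_iff.2 fun G hG => hne G (by simpa using hG)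
  refine ⟨hP.finite_facets.toFinset.image ν, fun x => N x * C⁻¹, k, ?_,
    (continuous_iff_continuousAt.2 fun x => (hN x (mem_univ x)).continuousAt).mul continuous_const,
    by simpa using hk.mul (isLinePolynomial_const C⁻¹), ?_, fun x hx => ?_⟩
  · simp only [Finset.mem_image, Finite.mem_toFinset, forall_exists_index, and_imp,
      forall_apply_eq_imp_iff₂]
    intro G hG
    refine ⟨by rw [hν, inv_mul_cancel₀ (hne G hG)], ?_⟩
    change (facetEq P G x₀)⁻¹ • (facetEq P G).linear ≠ 0
    exact smul_ne_zero (inv_ne_zero (hne G hG))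
      (linear_ne_zero_of_isFacetEquation hG (isFacetEquation_facetEq hG))
  · rw [Finset.card_image_of_injOn hinj]
    rwa [ncard_eq_toFinset_card _ hP.finite_facets] at hdeg
  · rw [hprod, hform x, mul_comm C⁻¹, mul_div_mul_right _ _ (inv_ne_zero hC0)]
    refine (mem_offFacets_iff hint x).2 fun G hG h0 => hx (ν G) ?_ ?_
    · exact Finset.mem_image_of_mem _ (by simpa using hG)
    · rw [hν, h0, mul_zero]

end

/-! ### Reflections and slices by a coordinate hyperplane. -/

section Residues

variable {d : ℕ} {P : Set (EuclideanSpace ℝ (Fin (d + 1)))}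
  {f : EuclideanSpace ℝ (Fin (d + 1)) → ℝ}

/-- The reflection `(s, t) ↦ (-s, t)`. -/
def flipHead : EuclideanSpace ℝ (Fin (d + 1)) ≃ₗ[ℝ] EuclideanSpace ℝ (Fin (d + 1)) :=
  LinearEquiv.ofInvolutive
    { toFun := fun z => consPoint (-z 0) (tailPoint z)
      map_add' := fun z z' => by
        rw [← consPoint_add, map_add]
        congr 1
        change -(z 0 + z' 0) = _
        ring
      map_smul' := fun c z => by
        rw [RingHom.id_apply, ← consPoint_smul, map_smul]
        congr 1
        change -(c * z 0) = _
        ring }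
    fun z => by
      change consPoint (- -z 0) (tailPoint z) = z
      rw [neg_neg, consPoint_tailPoint]

theorem flipHead_consPoint (s : ℝ) (t : EuclideanSpace ℝ (Fin d)) :
    flipHead (consPoint s t) = consPoint (-s) t := rfl

theorem abs_det_flipHead : |LinearMap.det (flipHead (d := d) :
    EuclideanSpace ℝ (Fin (d + 1)) →ₗ[ℝ] EuclideanSpace ℝ (Fin (d + 1)))| = 1 := by
  have h : (flipHead (d := d) : EuclideanSpace ℝ (Fin (d + 1)) →ₗ[ℝ] _) ∘ₗ
      (flipHead (d := d) : EuclideanSpace ℝ (Fin (d + 1)) →ₗ[ℝ] _) = LinearMap.id := by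
    ext1 z
    change consPoint (- -z 0) (tailPoint z) = z
    rw [neg_neg, consPoint_tailPoint]
  have h2 := congrArg LinearMap.det h
  rw [LinearMap.det_comp, LinearMap.det_id] at h2
  have h3 : |LinearMap.det (flipHead (d := d) :
    EuclideanSpace ℝ (Fin (d + 1)) →ₗ[ℝ] EuclideanSpace ℝ (Fin (d + 1)))| ^ 2 = 1 := by
    rw [sq_abs, sq, h2]
  exact (pow_eq_one_iff_of_nonneg (abs_nonneg _) two_ne_zero).1 h3

theorem tendsto_consPoint (t : EuclideanSpace ℝ (Fin d)) :
    Tendsto (fun s : ℝ => consPoint s t) (𝓝 0) (𝓝 (consPoint 0 t)) :=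
  (continuous_consPoint.comp (continuous_id.prodMk continuous_const)).tendsto 0

theorem isPolytope_slice (hP : IsPolytope P) {G : Set (EuclideanSpace ℝ (Fin (d + 1)))}
    (hG : G ∈ facets P) (hG0 : ∀ z ∈ G, z 0 = 0) :
    IsPolytope {t : EuclideanSpace ℝ (Fin d) | consPoint 0 t ∈ G} := by
  have h : {t : EuclideanSpace ℝ (Fin d) | consPoint 0 t ∈ G} =
      (tailPoint : EuclideanSpace ℝ (Fin (d + 1)) →ₗ[ℝ] _).toAffineMap '' G := by
    ext t
    constructor
    · exact fun ht => ⟨_, ht, tailPoint_consPoint 0 t⟩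
    · rintro ⟨z, hz, rfl⟩
      change consPoint 0 (tailPoint z) ∈ G
      rwa [← hG0 z hz, consPoint_tailPoint]
  rw [h]
  exact (hP.of_isExposed hG.2.1).image _

/-- The direction of the facet lies in `s = 0`, so forgetting the coordinate `s` does not lower its
dimension `d`. -/
theorem interior_slice_nonempty (hP : IsPolytope P) (hint : (interior P).Nonempty)
    {G : Set (EuclideanSpace ℝ (Fin (d + 1)))} (hG : G ∈ facets P) (hG0 : ∀ z ∈ G, z 0 = 0) :
    (interior {t : EuclideanSpace ℝ (Fin d) | consPoint 0 t ∈ G}).Nonempty := by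
  have hconv := (isPolytope_slice hP hG hG0).convex
  rw [hconv.interior_nonempty_iff_affineSpan_eq_top]
  obtain ⟨p, hp⟩ := hG.1
  have hp' : tailPoint p ∈ {t : EuclideanSpace ℝ (Fin d) | consPoint 0 t ∈ G} := by
    change consPoint 0 (tailPoint p) ∈ G
    rwa [← hG0 p hp, consPoint_tailPoint]
  have himg : {t : EuclideanSpace ℝ (Fin d) | consPoint 0 t ∈ G} =
      (tailPoint : EuclideanSpace ℝ (Fin (d + 1)) →ₗ[ℝ] _).toAffineMap '' G := by
    ext t
    constructor
    · exact fun ht => ⟨_, ht, tailPoint_consPoint 0 t⟩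
    · rintro ⟨z, hz, rfl⟩
      change consPoint 0 (tailPoint z) ∈ G
      rwa [← hG0 z hz, consPoint_tailPoint]
  rw [← AffineSubspace.direction_eq_top_iff_of_nonempty ((affineSpan_nonempty ℝ).2 ⟨_, hp'⟩),
    direction_affineSpan]
  refine Submodule.eq_top_of_finrank_eq ?_
  rw [himg, ← AffineMap.map_vectorSpan]
  have hz : ∀ v ∈ vectorSpan ℝ G, v 0 = 0 := by
    intro v hv
    have h := vectorSpan_le_ker (ℓ := (EuclideanSpace.proj (𝕜 := ℝ) (0 : Fin (d + 1)) :
      EuclideanSpace ℝ (Fin (d + 1)) →ₗ[ℝ] ℝ).toAffineMap) (S := G)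
      (fun z hz => by simpa using hG0 z hz) hv
    simpa using h
  have hle : vectorSpan ℝ G ≤ ((vectorSpan ℝ G).map tailPoint).map zeroCons := fun v hv =>
    ⟨tailPoint v, ⟨v, hv, rfl⟩, by rw [zeroCons_apply, ← hz v hv, consPoint_tailPoint]⟩
  have h1 := (Submodule.finrank_mono hle).trans (Submodule.finrank_map_le _ _)
  have h2 := hG.2.2
  have h3 := Submodule.finrank_le ((vectorSpan ℝ G).map (tailPoint (d := d)))
  rw [finrank_vectorSpan_of_interior hint] at h2
  simp only [finrank_euclideanSpace, Fintype.card_fin] at h2 h3 ⊢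
  change Module.finrank ℝ ((vectorSpan ℝ G).map tailPoint) = d
  omega

theorem eventually_sign_eq {X : Type*} [TopologicalSpace X] {a : X → ℝ} {x : X}
    (ha : ContinuousAt a x) (h0 : a x ≠ 0) : ∀ᶠ y in 𝓝 x, (0 ≤ a y ↔ 0 ≤ a x) := by
  rcases lt_or_gt_of_ne h0 with h | h
  · filter_upwards [ha.eventually (gt_mem_nhds h)] with y hy
    exact iff_of_false (not_le.2 hy) (not_le.2 h)
  · filter_upwards [ha.eventually (lt_mem_nhds h)] with y hy
    exact iff_of_true hy.le h.le

end Residues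

/-! ### Jumps, residues and linear relations of canonical functions. -/

section Residues

variable {d : ℕ} {P : Set (EuclideanSpace ℝ (Fin (d + 1)))}
  {f : EuclideanSpace ℝ (Fin (d + 1)) → ℝ}

theorem continuous_facetEq_consPoint (P G : Set (EuclideanSpace ℝ (Fin (d + 1))))
    (t : EuclideanSpace ℝ (Fin d)) : Continuous fun s : ℝ => facetEq P G (consPoint s t) :=
  (AffineMap.continuous_of_finiteDimensional _).comp
    (continuous_consPoint.comp (continuous_id.prodMk continuous_const))

/-- The slice by `s = 0`, the sign and the residue along `s = 0` of a canonical function; they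
describe the residue and the jump of the indicator function at generic points. -/
theorem exists_residue_of_nonneg (hP : IsPolytope P) (hint : (interior P).Nonempty)
    (hf : IsWeakCanonical (d + 1) P f) {G : Set (EuclideanSpace ℝ (Fin (d + 1)))}
    (hG : G ∈ facets P) {κ : ℝ} (hκ : 0 < κ) (hGκ : ∀ z, facetEq P G z = z 0 * κ) :
    ∃ h : EuclideanSpace ℝ (Fin d) → ℝ,
      IsPolytope {t : EuclideanSpace ℝ (Fin d) | consPoint 0 t ∈ P} ∧
      (interior {t : EuclideanSpace ℝ (Fin d) | consPoint 0 t ∈ P}).Nonempty ∧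
      IsWeakCanonical d {t | consPoint 0 t ∈ P} h ∧
      ∀ᶠ t in generic (EuclideanSpace ℝ (Fin d)),
        Tendsto (fun s : ℝ => s * f (consPoint s t)) (𝓝[≠] 0) (𝓝 (h t)) ∧
        ∀ᶠ s : ℝ in 𝓝[>] 0, (consPoint s t ∈ P ↔ consPoint 0 t ∈ P) ∧ consPoint (-s) t ∉ P := by
  have hfe := isFacetEquation_facetEq hG
  have hGz : ∀ z, z ∈ G ↔ z ∈ P ∧ z 0 = 0 := by
    intro z
    conv_lhs => rw [hfe.2]
    refine and_congr_right fun _ => ?_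
    rw [hGκ]
    simp [hκ.ne']
  have hG0 : ∀ z ∈ G, z 0 = 0 := fun z hz => ((hGz z).1 hz).2
  have hslice : {t : EuclideanSpace ℝ (Fin d) | consPoint 0 t ∈ G} =
      {t : EuclideanSpace ℝ (Fin d) | consPoint 0 t ∈ P} := by
    ext t
    exact (hGz _).trans (and_iff_left rfl)
  have hP0 : ∀ z ∈ P, 0 ≤ z 0 := fun z hz => by
    have := hfe.1 z hz
    rw [hGκ] at this
    exact nonneg_of_mul_nonneg_left this hκ
  obtain ⟨h, hh, hlim⟩ := hf.2.2 G hG (AffineEquiv.refl ℝ _) hP0 (by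
    ext z
    exact hGz z)
  have hh' : IsWeakCanonical d {t | consPoint 0 t ∈ G} h := hh
  refine ⟨h, hslice ▸ isPolytope_slice hP hG hG0, hslice ▸ interior_slice_nonempty hP hint hG hG0,
    hslice ▸ hh', ?_⟩
  -- A facet whose equation vanishes on all of `s = 0` has the same hyperplane as `G` and equals
  -- `G`. The other facet hyperplanes cut `s = 0` in proper subspaces, avoided by a generic `t`.
  have hgen : ∀ᶠ t in generic (EuclideanSpace ℝ (Fin d)), ∀ G' ∈ facets P \ {G},
      ((facetEq P G').comp zeroCons.toAffineMap) t ≠ 0 := by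
    refine finite_eventually_generic_ne_zero (hP.finite_facets.subset sdiff_subset)
      (fun G' => (facetEq P G').comp zeroCons.toAffineMap) fun G' hG' => ?_
    refine comp_zeroCons_ne_zero fun h0 => hG'.2 ?_
    have h1 := affine_eq_mul_of_zeroCons h0
    refine facet_eq_of_zero_iff (isFacetEquation_facetEq hG'.1) hfe fun z => ?_
    have h2 : (facetEq P G').linear (consPoint 1 0) ≠ 0 := by
      intro h2
      refine facetEq_ne_zero hG'.1 ?_
      ext z
      rw [h1, h2, mul_zero]
      rfl
    rw [h1, hGκ]
    simp [h2, hκ.ne']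
  filter_upwards [hgen] with t ht
  have ht' : ∀ G' ∈ facets P, G' ≠ G → facetEq P G' (consPoint 0 t) ≠ 0 := fun G' hG' hne =>
    ht G' ⟨hG', hne⟩
  constructor
  · have := hlim t fun G' hG' hne hmem => ht' G' hG' hne
      ((mem_affineSpan_facet hint hG' (isFacetEquation_facetEq hG') _).1 hmem)
    have hdet : |LinearMap.det ((AffineEquiv.refl ℝ (EuclideanSpace ℝ (Fin (d + 1)))).linear :
        EuclideanSpace ℝ (Fin (d + 1)) →ₗ[ℝ] EuclideanSpace ℝ (Fin (d + 1)))| = 1 := by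
      simp
    rw [hdet] at this
    simpa using this
  -- For small `s` the other equations keep their signs, so membership of `(s, t)` is decided by the
  -- sign of `s` and by membership of `(0, t)`.
  · have hsign : ∀ᶠ s : ℝ in 𝓝 0, ∀ G' ∈ facets P, G' ≠ G →
        (0 ≤ facetEq P G' (consPoint s t) ↔ 0 ≤ facetEq P G' (consPoint 0 t)) := by
      refine (eventually_all_finite hP.finite_facets).2 fun G' hG' => ?_
      by_cases hne : G' = G
      · simp [hne]
      · filter_upwards [eventually_sign_eq (continuous_facetEq_consPoint P G' t).continuousAt
          (ht' G' hG' hne)] with s hs _ using hs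
    filter_upwards [hsign.filter_mono nhdsWithin_le_nhds, self_mem_nhdsWithin] with s hs hs0
    have hs0' : 0 < s := hs0
    constructor
    · rw [mem_iff_forall_facetEq hP hint, mem_iff_forall_facetEq hP hint]
      refine forall₂_congr fun G' hG' => ?_
      by_cases hne : G' = G
      · rw [hne, hGκ, hGκ, consPoint_zero, consPoint_zero, zero_mul]
        exact iff_of_true (by positivity) le_rfl
      · exact hs G' hG' hne
    · intro hmem
      have := hP0 _ hmem
      rw [consPoint_zero] at this
      linarith

/-- The number `ε` is `1` or `-1` if a facet lies on `s = 0` and `P` is on the positive or negative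
side, and `0` if no facet lies there. The point of the statement is that the same `ε` and the same
slice govern both the residue of `f` and the jump of the indicator function. -/
theorem exists_residue (hP : IsPolytope P) (hint : (interior P).Nonempty)
    (hf : IsWeakCanonical (d + 1) P f) :
    ∃ (ε : ℝ) (h : EuclideanSpace ℝ (Fin d) → ℝ),
      (ε ≠ 0 → IsPolytope {t : EuclideanSpace ℝ (Fin d) | consPoint 0 t ∈ P} ∧
        (interior {t : EuclideanSpace ℝ (Fin d) | consPoint 0 t ∈ P}).Nonempty ∧
        IsWeakCanonical d {t | consPoint 0 t ∈ P} h) ∧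
      ∀ᶠ t in generic (EuclideanSpace ℝ (Fin d)),
        Tendsto (fun s : ℝ => s * f (consPoint s t)) (𝓝[≠] 0) (𝓝 (ε * h t)) ∧
        ∀ᶠ s : ℝ in 𝓝[>] 0, P.indicator (fun _ => (1 : ℝ)) (consPoint s t) -
          P.indicator (fun _ => (1 : ℝ)) (consPoint (-s) t) =
          ε * {t : EuclideanSpace ℝ (Fin d) | consPoint 0 t ∈ P}.indicator (fun _ => (1 : ℝ)) t := by
  classical
  by_cases hex : ∃ G ∈ facets P, ∀ t, facetEq P G (consPoint 0 t) = 0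
  · obtain ⟨G, hG, hG0⟩ := hex
    have hGκ := affine_eq_mul_of_zeroCons hG0
    set κ := (facetEq P G).linear (consPoint 1 0)
    have hκ0 : κ ≠ 0 := by
      intro h2
      refine facetEq_ne_zero hG ?_
      ext z
      rw [hGκ, h2, mul_zero]
      rfl
    rcases lt_or_gt_of_ne hκ0 with hκ | hκ
    -- Here `P` is on the side `s ≤ 0`. Reflection reduces to the other side; it changes the sign of
    -- the residue and of the jump alike.
    · let ρ := (flipHead (d := d)).toAffineEquiv
      have hρ : ∀ s (t : EuclideanSpace ℝ (Fin d)), ρ (consPoint s t) = consPoint (-s) t :=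
        fun s t => flipHead_consPoint s t
      have hf' := hf.comp ρ
      have hdet : |LinearMap.det (ρ.linear : EuclideanSpace ℝ (Fin (d + 1)) →ₗ[ℝ]
          EuclideanSpace ℝ (Fin (d + 1)))| = 1 := abs_det_flipHead
      have hmem : ∀ s (t : EuclideanSpace ℝ (Fin d)),
          consPoint s t ∈ ρ ⁻¹' P ↔ consPoint (-s) t ∈ P := fun s t => by
        rw [mem_preimage, hρ]
      have hPρ : IsPolytope (ρ ⁻¹' P) := by
        rw [show ρ ⁻¹' P = ρ.symm.toAffineMap '' P from (ρ.symm.toEquiv.image_eq_preimage_symm P).symm]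
        exact hP.image _
      have hintρ : (interior (ρ ⁻¹' P)).Nonempty := by
        rw [← affineEquiv_preimage_interior]
        exact hint.preimage ρ.surjective
      have hGρ := preimage_mem_facets ρ hG
      obtain ⟨c, hc, hcl⟩ := (isFacetEquation_facetEq hGρ).exists_pos_mul hintρ hGρ
        ((isFacetEquation_facetEq hG).preimage ρ.toAffineMap)
      obtain ⟨h, h1, h2, h3, h4⟩ := exists_residue_of_nonneg hPρ hintρ hf' hGρ (κ := -κ * c)
        (by nlinarith) (fun z => by
          rw [hcl]
          change c * facetEq P G (ρ z) = _
          rw [hGκ]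
          change c * (-z 0 * κ) = _
          ring)
      have hset : {t : EuclideanSpace ℝ (Fin d) | consPoint 0 t ∈ ρ ⁻¹' P} =
          {t : EuclideanSpace ℝ (Fin d) | consPoint 0 t ∈ P} := by
        ext t
        change consPoint 0 t ∈ ρ ⁻¹' P ↔ consPoint 0 t ∈ P
        rw [hmem, neg_zero]
      rw [hset] at h1 h2 h3
      refine ⟨-1, h, fun _ => ⟨h1, h2, h3⟩, ?_⟩
      filter_upwards [h4] with t ht
      constructor
      · have hneg : Tendsto (fun s : ℝ => -s) (𝓝[≠] 0) (𝓝[≠] 0) := by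
          have : Tendsto (fun s : ℝ => -s) (𝓝 0) (𝓝 0) := by
            simpa using (continuous_neg (G := ℝ)).tendsto 0
          refine tendsto_nhdsWithin_of_tendsto_nhds_of_eventually_within _
            (this.mono_left nhdsWithin_le_nhds) ?_
          filter_upwards [self_mem_nhdsWithin] with s hs
          exact neg_ne_zero.2 hs
        have := (ht.1.comp hneg).neg
        rw [neg_one_mul]
        refine this.congr fun s => ?_
        simp only [Function.comp_apply, hρ, neg_neg, hdet]
        ring
      · filter_upwards [ht.2] with s hs
        rw [hmem, hmem, hmem, neg_neg, neg_zero] at hs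
        simp only [indicator_apply, hs.2]
        change _ = -1 * (if consPoint 0 t ∈ P then (1 : ℝ) else 0)
        simp only [← hs.1, if_false]
        ring
    · obtain ⟨h, h1, h2, h3, h4⟩ := exists_residue_of_nonneg hP hint hf hG hκ hGκ
      refine ⟨1, h, fun _ => ⟨h1, h2, h3⟩, ?_⟩
      filter_upwards [h4] with t ht
      refine ⟨by simpa using ht.1, ?_⟩
      filter_upwards [ht.2] with s hs
      simp only [indicator_apply, hs.2, hs.1]
      change _ = 1 * (if consPoint 0 t ∈ P then (1 : ℝ) else 0)
      simp
  · push Not at hex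
    refine ⟨0, 0, fun h => absurd rfl h, ?_⟩
    have hgen := finite_eventually_generic_ne_zero hP.finite_facets
      (fun G => (facetEq P G).comp (zeroCons (d := d)).toAffineMap) fun G hG =>
        comp_zeroCons_ne_zero fun h0 => (hex G hG).elim fun t ht => ht (h0 t)
    filter_upwards [hgen] with t ht
    have ht' : ∀ G ∈ facets P, facetEq P G (consPoint 0 t) ≠ 0 := ht
    constructor
    -- No facet lies on `s = 0`, so `f` is continuous at `(0, t)` and `s * f` tends to zero.
    · have h1 := hf.continuousAt hP hint ((mem_offFacets_iff hint _).2 ht')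
      have h2 : Tendsto (fun s : ℝ => s * f (consPoint s t)) (𝓝 0)
          (𝓝 (0 * f (consPoint 0 t))) :=
        tendsto_id.mul (h1.tendsto.comp (tendsto_consPoint t))
      simpa using h2.mono_left nhdsWithin_le_nhds
    · have hsign : ∀ᶠ s : ℝ in 𝓝 0, ∀ G ∈ facets P,
          (0 ≤ facetEq P G (consPoint s t) ↔ 0 ≤ facetEq P G (consPoint 0 t)) :=
        (eventually_all_finite hP.finite_facets).2 fun G hG =>
          eventually_sign_eq (continuous_facetEq_consPoint P G t).continuousAt (ht' G hG)
      have hneg : Tendsto (fun s : ℝ => -s) (𝓝 0) (𝓝 0) := by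
        simpa using (continuous_neg (G := ℝ)).tendsto 0
      filter_upwards [hsign.filter_mono nhdsWithin_le_nhds,
        (hneg.eventually hsign).filter_mono nhdsWithin_le_nhds] with s hs hs'
      have e1 : consPoint s t ∈ P ↔ consPoint (-s) t ∈ P := by
        rw [mem_iff_forall_facetEq hP hint, mem_iff_forall_facetEq hP hint]
        exact forall₂_congr fun G hG => (hs G hG).trans (hs' G hG).symm
      simp [indicator_apply, e1]

/-- The conclusion of the theorem on linear relations between canonical functions. -/
def RespectsRelations (ι : Type*) (d : ℕ) : Prop :=
  ∀ (s : Finset ι) (P : ι → Set (EuclideanSpace ℝ (Fin d)))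
    (f : ι → EuclideanSpace ℝ (Fin d) → ℝ) (c : ι → ℝ),
    (∀ i ∈ s, IsPolytope (P i) ∧ (interior (P i)).Nonempty ∧ IsWeakCanonical d (P i) (f i)) →
    (∀ᶠ x in generic (EuclideanSpace ℝ (Fin d)),
      ∑ i ∈ s, c i * (P i).indicator (fun _ => (1 : ℝ)) x = 0) →
    ∀ᶠ x in generic (EuclideanSpace ℝ (Fin d)), ∑ i ∈ s, c i * f i x = 0

variable {ι : Type*}

/-- A linear combination of canonical functions has no residue along a hyperplane, if the same
combination of indicator functions vanishes. -/
theorem tendsto_sum_residue (ih : RespectsRelations ι d) (s : Finset ι)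
    (P : ι → Set (EuclideanSpace ℝ (Fin (d + 1))))
    (f : ι → EuclideanSpace ℝ (Fin (d + 1)) → ℝ) (c : ι → ℝ)
    (hP : ∀ i ∈ s, IsPolytope (P i) ∧ (interior (P i)).Nonempty ∧
      IsWeakCanonical (d + 1) (P i) (f i))
    (hrel : ∀ᶠ x in generic (EuclideanSpace ℝ (Fin (d + 1))),
      ∑ i ∈ s, c i * (P i).indicator (fun _ => (1 : ℝ)) x = 0) :
    ∀ᶠ t in generic (EuclideanSpace ℝ (Fin d)),
      Tendsto (fun u : ℝ => u * ∑ i ∈ s, c i * f i (consPoint u t)) (𝓝[≠] 0) (𝓝 0) := by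
  classical
  choose! ε h hε hgen using fun i hi => exists_residue (hP i hi).1 (hP i hi).2.1 (hP i hi).2.2
  have hgen' := (eventually_all_finset s).2 hgen
  -- The sum is restricted to `ε i ≠ 0` because only then is the slice known to be a
  -- full-dimensional polytope with canonical function `h i`, as the induction hypothesis requires.
  have hzero : ∀ᶠ t in generic (EuclideanSpace ℝ (Fin d)), ∑ i ∈ s with ε i ≠ 0,
      (c i * ε i) * {t : EuclideanSpace ℝ (Fin d) | consPoint 0 t ∈ P i}.indicator
        (fun _ => (1 : ℝ)) t = 0 := by
    filter_upwards [hgen', eventually_generic_consPoint hrel] with t ht hrel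
    have h1 : ∀ᶠ u : ℝ in 𝓝[>] 0, ∀ i ∈ s, (P i).indicator (fun _ => (1 : ℝ)) (consPoint u t) -
          (P i).indicator (fun _ => (1 : ℝ)) (consPoint (-u) t) =
          ε i * {t : EuclideanSpace ℝ (Fin d) | consPoint 0 t ∈ P i}.indicator (fun _ => (1 : ℝ)) t :=
      (eventually_all_finset s).2 fun i hi => (ht i hi).2
    have hneg : Tendsto (fun s : ℝ => -s) (𝓝[>] 0) (𝓝[≠] 0) := by
      have : Tendsto (fun s : ℝ => -s) (𝓝 0) (𝓝 0) := by
        simpa using (continuous_neg (G := ℝ)).tendsto 0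
      refine tendsto_nhdsWithin_of_tendsto_nhds_of_eventually_within _
        (this.mono_left nhdsWithin_le_nhds) ?_
      filter_upwards [self_mem_nhdsWithin] with s hs
      exact neg_ne_zero.2 (ne_of_gt hs)
    have h2 : ∀ᶠ u : ℝ in 𝓝[>] 0,
        ∑ i ∈ s, c i * (P i).indicator (fun _ => (1 : ℝ)) (consPoint u t) = 0 :=
      hrel.filter_mono (nhdsWithin_mono _ fun x hx => ne_of_gt hx)
    -- The relation is used at `(u, t)` and at `(-u, t)`; the difference is the relation between the
    -- jumps.
    obtain ⟨u, ⟨hu1, hu2⟩, hu3⟩ := ((h1.and h2).and (hneg.eventually hrel)).exists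
    rw [Finset.sum_filter_of_ne (p := fun i => ε i ≠ 0) fun i _ h0 => by
      rintro h; simp [h] at h0]
    refine Eq.trans ?_ (sub_eq_zero.2 (hu2.trans hu3.symm))
    rw [← Finset.sum_sub_distrib]
    refine Finset.sum_congr rfl fun i hi => ?_
    rw [mul_assoc, ← hu1 i hi, mul_sub]
  have hres := ih (s.filter fun i => ε i ≠ 0) _ h (fun i => c i * ε i)
    (fun i hi => hε i (Finset.mem_filter.1 hi).1 (Finset.mem_filter.1 hi).2) hzero
  filter_upwards [hres, hgen'] with t hres ht
  rw [Finset.sum_filter_of_ne (p := fun i => ε i ≠ 0) fun i _ h0 => by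
      rintro h; simp [h] at h0] at hres
  have hres' : ∑ i ∈ s, c i * ε i * h i t = 0 := hres
  have := tendsto_finsetSum s fun i hi => ((ht i hi).1.const_mul (c i))
  simp only [Finset.mul_sum]
  simp only [← mul_assoc] at this ⊢
  rw [hres'] at this
  refine this.congr fun u => Finset.sum_congr rfl fun i _ => ?_
  ring

/-- An affine function is the first coordinate of some affine coordinate system. -/
theorem exists_affineEquiv_head (a : EuclideanSpace ℝ (Fin (d + 1)) →ᵃ[ℝ] ℝ)
    (ha : a.linear ≠ 0) :
    ∃ Φ : EuclideanSpace ℝ (Fin (d + 1)) ≃ᵃ[ℝ] EuclideanSpace ℝ (Fin (d + 1)),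
      ∀ z, a (Φ z) = z 0 := by
  -- `v` is the new first coordinate direction and `w`, a zero of `a`, the new origin; the kernel of
  -- the linear part supplies the other directions.
  obtain ⟨v, hv⟩ := LinearMap.surjective ha 1
  obtain ⟨w, hw⟩ := LinearMap.surjective ha (-(a 0))
  have hp : a w = 0 := by
    have := a.map_vadd 0 w
    simp only [vadd_eq_add, add_zero] at this
    rw [this, hw]
    ring
  have hdim : Module.finrank ℝ (EuclideanSpace ℝ (Fin d)) =
      Module.finrank ℝ (LinearMap.ker a.linear) := by
    have := finrank_ker_add_one ha
    simp only [finrank_euclideanSpace, Fintype.card_fin] at this ⊢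
    omega
  let e := LinearEquiv.ofFinrankEq _ _ hdim
  let L : EuclideanSpace ℝ (Fin (d + 1)) →ₗ[ℝ] EuclideanSpace ℝ (Fin (d + 1)) :=
    (LinearMap.toSpanSingleton ℝ _ v) ∘ₗ
      (EuclideanSpace.proj (𝕜 := ℝ) (0 : Fin (d + 1)) : EuclideanSpace ℝ (Fin (d + 1)) →ₗ[ℝ] ℝ) +
    (LinearMap.ker a.linear).subtype ∘ₗ (e : EuclideanSpace ℝ (Fin d) →ₗ[ℝ] _) ∘ₗ tailPoint
  have hL : ∀ z, L z = z 0 • v + (e (tailPoint z) : EuclideanSpace ℝ (Fin (d + 1))) :=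
    fun z => rfl
  have haL : ∀ z, a.linear (L z) = z 0 := by
    intro z
    rw [hL, map_add, map_smul, hv, LinearMap.mem_ker.1 (e (tailPoint z)).2]
    simp
  have hinj : Function.Injective L := by
    rw [← LinearMap.ker_eq_bot, LinearMap.ker_eq_bot']
    intro z hz
    have h0 : z 0 = 0 := by rw [← haL z, hz, map_zero]
    have h1 : (e (tailPoint z) : EuclideanSpace ℝ (Fin (d + 1))) = 0 := by
      rw [← hz, hL, h0, zero_smul, zero_add]
    have h2 : tailPoint z = 0 := by
      rw [← e.map_eq_zero_iff]
      exact Subtype.ext h1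
    rw [← consPoint_tailPoint z, h0, h2]
    exact map_zero zeroCons
  refine ⟨(LinearEquiv.ofInjectiveEndo L hinj).toAffineEquiv.trans
    (AffineEquiv.constVAdd ℝ _ w), fun z => ?_⟩
  change a (w + L z) = _
  have := a.map_vadd w (L z)
  rw [haL, hp] at this
  rw [add_comm w]
  simpa using this

/-- A generic line through `x₀` meets the hyperplanes in as many different points as there are
hyperplanes. The restriction of `N` to it thus has more zeros than its degree allows, and it
vanishes at `x₀` too. -/
theorem polynomial_vanishing_on_line {E : Type*} [NormedAddCommGroup E] [NormedSpace ℝ E]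
    [FiniteDimensional ℝ E] {A : Finset (E →ᵃ[ℝ] ℝ)} {x₀ : E}
    (hA : ∀ a ∈ A, a x₀ = 1 ∧ a.linear ≠ 0) {N : E → ℝ} {k : ℕ} (hN : IsLinePolynomial N k)
    (hk : k < A.card) (hzero : ∀ a ∈ A, ∀ x, a x = 0 → N x = 0) : N x₀ = 0 := by
  classical
  have hval : ∀ a : E →ᵃ[ℝ] ℝ, ∀ (t : ℝ) v, a (x₀ + t • v) = a x₀ + t * a.linear v := by
    intro a t v
    have := a.map_vadd x₀ (t • v)
    rw [vadd_eq_add, vadd_eq_add, map_smul, add_comm, smul_eq_mul] at this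
    rw [this, add_comm]
  have h1 := finite_eventually_generic_ne_zero (E := E) (A.finite_toSet)
    (fun a => a.linear.toAffineMap) fun a ha h0 => (hA a ha).2 (by
      ext v; simpa using congrArg (fun b => b v) h0)
  -- Different members of `A` agree at `x₀`, so they differ in their linear parts, and a generic
  -- direction `v` separates these. The line meets `a = 0` at the parameter `-(a.linear v)⁻¹`.
  have h2 := finite_eventually_generic_ne_zero (E := E) (A ×ˢ A \ A.diag).finite_toSet
    (fun ab => (ab.1.linear - ab.2.linear).toAffineMap) fun ab hab h0 => by
      obtain ⟨hab1, hab2⟩ := Finset.mem_sdiff.1 hab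
      obtain ⟨ha, hb⟩ := Finset.mem_product.1 hab1
      refine hab2 (Finset.mem_diag.2 ⟨ha, ?_⟩)
      ext x
      have h3 := congrArg (fun b => b (x - x₀)) h0
      have h4 : ab.1.linear (x - x₀) = ab.2.linear (x - x₀) := sub_eq_zero.1 (by simpa using h3)
      have e1 := hval ab.1 1 (x - x₀)
      have e2 := hval ab.2 1 (x - x₀)
      rw [one_smul, add_sub_cancel, (hA _ ha).1] at e1
      rw [one_smul, add_sub_cancel, (hA _ hb).1] at e2
      rw [e1, e2, h4]
  obtain ⟨v, hv1, hv2⟩ := (h1.and h2).exists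
  obtain ⟨p, hp, hNp⟩ := hN x₀ v
  have hinj : InjOn (fun a : E →ᵃ[ℝ] ℝ => -(a.linear v)⁻¹) (A : Set (E →ᵃ[ℝ] ℝ)) := by
    intro a ha b hb hab
    by_contra hne
    refine hv2 (a, b) ?_ ?_
    · simp only [Finset.coe_sdiff, Finset.coe_product]
      exact ⟨⟨ha, hb⟩, fun h => hne (Finset.mem_diag.1 h).2⟩
    · have : a.linear v = b.linear v := by simpa using hab
      simp [this]
  have hp0 : p = 0 := by
    refine Polynomial.eq_zero_of_natDegree_lt_card_of_eval_eq_zero' p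
      (A.image fun a => -(a.linear v)⁻¹) ?_ ?_
    · intro t ht
      obtain ⟨a, ha, rfl⟩ := Finset.mem_image.1 ht
      rw [← hNp]
      refine hzero a ha _ ?_
      have : a.linear v ≠ 0 := hv1 a ha
      rw [hval, (hA a ha).1, neg_mul, inv_mul_cancel₀ this]
      ring
    · rw [Finset.card_image_of_injOn hinj]
      omega
  have := hNp 0
  rw [hp0] at this
  simpa using this

/-- The combination is written over a common denominator. Vanishing residues force the numerator to
vanish on every hyperplane of the denominator, and its degree is too small for that unless it is
zero. The base point of the normalization is the generic point at which the claim is to be shown. -/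
theorem respectsRelations_succ (ih : RespectsRelations ι d) : RespectsRelations ι (d + 1) := by
  classical
  intro s P f c hP hrel
  rcases s.eq_empty_or_nonempty with rfl | ⟨i₀, hi₀⟩
  · simp
  have hoff := (eventually_all_finset s).2 fun i hi =>
    eventually_generic_offFacets (hP i hi).1 (hP i hi).2.1
  filter_upwards [hoff] with x₀ hx₀
  choose! A N k hA hNc hNl hdeg hform using fun i hi =>
    (hP i hi).2.2.1.exists_normalized (hP i hi).1 (hP i hi).2.1 (hx₀ i hi)
  set B := s.biUnion A with hB
  have hBA : ∀ i ∈ s, A i ⊆ B := fun i hi => Finset.subset_biUnion_of_mem A hi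
  have hBprop : ∀ a ∈ B, a x₀ = 1 ∧ a.linear ≠ 0 := by
    intro a ha
    obtain ⟨i, hi, hai⟩ := Finset.mem_biUnion.1 ha
    exact hA i hi a hai
  let M : EuclideanSpace ℝ (Fin (d + 1)) → ℝ :=
    fun x => ∑ i ∈ s, c i * (N i x * ∏ a ∈ B \ A i, a x)
  have hMc : Continuous M := by
    refine continuous_finsetSum _ fun i hi => continuous_const.mul ((hNc i hi).mul ?_)
    exact continuous_finsetProd _ fun a _ => AffineMap.continuous_of_finiteDimensional a
  have hsum : ∀ x, (∀ a ∈ B, a x ≠ 0) → ∑ i ∈ s, c i * f i x = M x / ∏ a ∈ B, a x := by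
    intro x hx
    rw [Finset.sum_div]
    refine Finset.sum_congr rfl fun i hi => ?_
    rw [hform i hi x fun a ha => hx a (hBA i hi ha), mul_div_assoc, ← Finset.prod_sdiff (hBA i hi),
      mul_comm (N i x), mul_div_mul_left]
    exact Finset.prod_ne_zero_iff.2 fun a ha => hx a (Finset.sdiff_subset ha)
  -- Each numerator has degree at most `(A i).card - d - 2`, and the factor bringing it to the
  -- common denominator adds `(B \ A i).card`. The bound at infinity thus leaves more than enough
  -- room.
  have hMl : IsLinePolynomial M (B.card - 1) := by
    refine isLinePolynomial_sum s fun i hi => ?_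
    have h1 := (isLinePolynomial_const (c i)).mul
      ((hNl i hi).mul (isLinePolynomial_prod (B \ A i)))
    refine h1.mono ?_
    have h2 := hdeg i hi
    have h3 := Finset.card_sdiff_add_card_eq_card (hBA i hi)
    omega
  have hcard : B.card - 1 < B.card := by
    have h2 := hdeg i₀ hi₀
    have h3 := Finset.card_le_card (hBA i₀ hi₀)
    omega
  have hx₀' : ∀ a ∈ B, a x₀ ≠ 0 := fun a ha => by rw [(hBprop a ha).1]; exact one_ne_zero
  rw [hsum x₀ hx₀', polynomial_vanishing_on_line hBprop hMl hcard, zero_div]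
  intro a ha
  obtain ⟨Φ, hΦ⟩ := exists_affineEquiv_head a (hBprop a ha).2
  set D := |LinearMap.det (Φ.linear : EuclideanSpace ℝ (Fin (d + 1)) →ₗ[ℝ]
    EuclideanSpace ℝ (Fin (d + 1)))| with hD
  have hD0 : D ≠ 0 := abs_ne_zero.2 (LinearEquiv.isUnit_det' Φ.linear).ne_zero
  have hres := tendsto_sum_residue ih s (fun i => Φ ⁻¹' P i) (fun i x => f i (Φ x) * D) c
    (fun i hi => ⟨by
      rw [show Φ ⁻¹' P i = Φ.symm.toAffineMap '' P i from
        (Φ.symm.toEquiv.image_eq_preimage_symm (P i)).symm]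
      exact (hP i hi).1.image _, by
      rw [← affineEquiv_preimage_interior]
      exact (hP i hi).2.1.preimage Φ.surjective, (hP i hi).2.2.comp Φ⟩)
    (eventually_generic_comp_equiv Φ hrel)
  have hother : ∀ᶠ t in generic (EuclideanSpace ℝ (Fin d)),
      ∀ b ∈ ((B.erase a : Finset _) : Set (EuclideanSpace ℝ (Fin (d + 1)) →ᵃ[ℝ] ℝ)),
      ((b.comp Φ.toAffineMap).comp zeroCons.toAffineMap) t ≠ 0 := by
    refine finite_eventually_generic_ne_zero (B.erase a).finite_toSet
      (fun b => (b.comp Φ.toAffineMap).comp zeroCons.toAffineMap) fun b hb => ?_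
    refine comp_zeroCons_ne_zero fun h0 => ?_
    have hb' := Finset.mem_erase.1 (Finset.mem_coe.1 hb)
    apply hb'.1
    have h1 : ∀ x, b x = a x * (b.comp Φ.toAffineMap).linear (consPoint 1 0) := by
      intro x
      have := affine_eq_mul_of_zeroCons h0 (Φ.symm x)
      rw [← hΦ, AffineEquiv.apply_symm_apply] at this
      rw [← this]
      change b x = b (Φ (Φ.symm x))
      rw [AffineEquiv.apply_symm_apply]
    have h2 := h1 x₀
    rw [(hBprop a ha).1, (hBprop b hb'.2).1, one_mul] at h2
    ext x
    rw [h1, ← h2, mul_one]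
  -- In a chart with first coordinate `a`, the residue along `a = 0` is `M` over the product of the
  -- other factors, times `D`. It is zero by the induction hypothesis on relations.
  have hMzero : ∀ᶠ t in generic (EuclideanSpace ℝ (Fin d)), M (Φ (consPoint 0 t)) = 0 := by
    filter_upwards [hres, hother] with t ht1 ht2
    have hΦc : Continuous Φ := AffineMap.continuous_of_finiteDimensional Φ.toAffineMap
    have hlim : Tendsto (fun u : ℝ => Φ (consPoint u t)) (𝓝 0) (𝓝 (Φ (consPoint 0 t))) :=
      (hΦc.tendsto _).comp (tendsto_consPoint t)
    have hprod0 : ∏ b ∈ B.erase a, b (Φ (consPoint 0 t)) ≠ 0 :=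
      Finset.prod_ne_zero_iff.2 fun b hb => ht2 b hb
    have hpc : Continuous fun x => ∏ b ∈ B.erase a, b x :=
      continuous_finsetProd _ fun b _ => AffineMap.continuous_of_finiteDimensional b
    have hlim2 : Tendsto (fun u : ℝ => M (Φ (consPoint u t)) /
        (∏ b ∈ B.erase a, b (Φ (consPoint u t))) * D) (𝓝[≠] 0)
        (𝓝 (M (Φ (consPoint 0 t)) / (∏ b ∈ B.erase a, b (Φ (consPoint 0 t))) * D)) := by
      refine Tendsto.mono_left ?_ nhdsWithin_le_nhds
      exact (((hMc.tendsto _).comp hlim).div ((hpc.tendsto _).comp hlim) hprod0).mul_const D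
    have hne : ∀ᶠ u : ℝ in 𝓝[≠] 0, ∏ b ∈ B.erase a, b (Φ (consPoint u t)) ≠ 0 :=
      (((hpc.tendsto _).comp hlim).eventually_ne hprod0).filter_mono nhdsWithin_le_nhds
    have heq : (fun u : ℝ => u * ∑ i ∈ s, c i * (f i (Φ (consPoint u t)) * D)) =ᶠ[𝓝[≠] 0]
        fun u : ℝ => M (Φ (consPoint u t)) / (∏ b ∈ B.erase a, b (Φ (consPoint u t))) * D := by
      filter_upwards [hne, self_mem_nhdsWithin] with u hu hu0
      have hu0' : u ≠ 0 := hu0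
      have hall : ∀ b ∈ B, b (Φ (consPoint u t)) ≠ 0 := by
        intro b hb
        by_cases hba : b = a
        · rw [hba, hΦ, consPoint_zero]; exact hu0'
        · exact Finset.prod_ne_zero_iff.1 hu b (Finset.mem_erase.2 ⟨hba, hb⟩)
      simp only [← mul_assoc, ← Finset.sum_mul]
      rw [hsum _ hall, ← Finset.mul_prod_erase B _ ha, hΦ, consPoint_zero]
      field_simp
    have huniq := tendsto_nhds_unique (hlim2.congr' heq.symm) ht1
    have h3 := (mul_eq_zero.1 huniq).resolve_right hD0
    exact (div_eq_zero_iff.1 h3).resolve_right hprod0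
  have hall : ∀ t, M (Φ (consPoint 0 t)) = 0 := by
    have hd := dense_of_eventually_generic hMzero
    have hcl : IsClosed {t : EuclideanSpace ℝ (Fin d) | M (Φ (consPoint 0 t)) = 0} := by
      refine isClosed_eq (hMc.comp ?_) continuous_const
      exact (AffineMap.continuous_of_finiteDimensional Φ.toAffineMap).comp
        (continuous_consPoint.comp (continuous_const.prodMk continuous_id))
    intro t
    have : t ∈ closure {t : EuclideanSpace ℝ (Fin d) | M (Φ (consPoint 0 t)) = 0} := hd t
    rw [hcl.closure_eq] at this
    exact this
  intro x hx
  have h1 : Φ.symm x 0 = 0 := by rw [← hΦ, AffineEquiv.apply_symm_apply, hx]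
  have h2 := hall (tailPoint (Φ.symm x))
  have h3 : consPoint 0 (tailPoint (Φ.symm x)) = Φ.symm x := by
    rw [← h1, consPoint_tailPoint]
  rwa [h3, AffineEquiv.apply_symm_apply] at h2

/-- Canonical functions satisfy the linear relations of the indicator functions. -/
theorem respectsRelations (ι : Type*) : ∀ d, RespectsRelations ι d
  | 0 => by
    intro s P f c hP hrel
    -- In dimension zero every polytope in the sum is the whole space and every canonical function
    -- is `1`, so the two relations coincide.
    obtain ⟨x, hx⟩ := hrel.exists
    refine Eventually.of_forall fun y => ?_
    rw [← hx]
    refine Finset.sum_congr rfl fun i hi => ?_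
    have hmem : x ∈ P i := by
      obtain ⟨z, hz⟩ := (hP i hi).2.1
      rw [Subsingleton.elim x z]
      exact interior_subset hz
    have := (hP i hi).2.2 y
    rw [this, indicator_of_mem hmem]
  | d + 1 => respectsRelations_succ (respectsRelations ι d)

end Residues

/-! ### Successive residues down to a simple face. -/

section IteratedResidues

variable {m : ℕ}

/-- `t ↦ (0, …, 0, t)`. -/
def padZero : (r : ℕ) → EuclideanSpace ℝ (Fin m) →ₗ[ℝ] EuclideanSpace ℝ (Fin (m + r))
  | 0 => LinearMap.id
  | r + 1 => zeroCons ∘ₗ padZero r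

theorem padZero_head (r : ℕ) (t : EuclideanSpace ℝ (Fin m)) (i : ℕ) (hi : i < r) :
    padZero r t ⟨i, by omega⟩ = 0 := by
  induction r generalizing i with
  | zero => omega
  | succ r ih =>
    cases i with
    | zero => rfl
    | succ i => exact ih i (by omega)

theorem padZero_tail (r : ℕ) (t : EuclideanSpace ℝ (Fin m)) (j : Fin m) :
    padZero r t ⟨r + j, by omega⟩ = t j := by
  induction r with
  | zero =>
    have : (⟨0 + j, by omega⟩ : Fin (m + 0)) = j := Fin.ext (Nat.zero_add _)
    change t _ = t j
    rw [this]
  | succ r ih =>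
    rw [← ih]
    have : (⟨r + 1 + j, by omega⟩ : Fin (m + r + 1)) =
        Fin.succ (⟨r + j, by omega⟩ : Fin (m + r)) := Fin.ext (by simp; omega)
    change padZero (r + 1) t (⟨r + 1 + j, _⟩ : Fin (m + r + 1)) = _
    rw [this]
    rfl

/-- The `i`-th coordinate, `i < r`, of a point of `ℝ^{m+r}`. -/
def headCoord (r : ℕ) (i : Fin r) (z : EuclideanSpace ℝ (Fin (m + r))) : ℝ := z ⟨i, by omega⟩

theorem headCoord_consPoint_zero (r : ℕ) (s : ℝ) (z : EuclideanSpace ℝ (Fin (m + r))) :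
    headCoord (m := m) (r + 1) 0 (consPoint s z) = s := rfl

theorem headCoord_consPoint_succ (r : ℕ) (i : Fin r) (s : ℝ)
    (z : EuclideanSpace ℝ (Fin (m + r))) :
    headCoord (m := m) (r + 1) i.succ (consPoint s z) = headCoord r i z := rfl

theorem headCoord_padZero (r : ℕ) (i : Fin r) (t : EuclideanSpace ℝ (Fin m)) :
    headCoord r i (padZero r t) = 0 := padZero_head r t i i.2

/-- The residue of a canonical function along a coordinate subspace which meets the polytope in a
face with orthant-like neighbourhood is the canonical function of that face. -/
theorem exists_iterated_residue : ∀ (r : ℕ) {Q : Set (EuclideanSpace ℝ (Fin (m + r)))}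
    {f : EuclideanSpace ℝ (Fin (m + r)) → ℝ}, IsPolytope Q → (interior Q).Nonempty →
    IsWeakCanonical (m + r) Q f → (∀ z ∈ Q, ∀ i, 0 ≤ headCoord r i z) →
    ∀ x₀ : EuclideanSpace ℝ (Fin m),
    (∀ᶠ z in 𝓝 (padZero r x₀), (∀ i, 0 ≤ headCoord r i z) → z ∈ Q) →
    ∃ h : EuclideanSpace ℝ (Fin m) → ℝ,
      IsPolytope {t | padZero r t ∈ Q} ∧ (interior {t | padZero r t ∈ Q}).Nonempty ∧
      IsWeakCanonical m {t | padZero r t ∈ Q} h ∧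
      ∀ᶠ t in generic (EuclideanSpace ℝ (Fin m)), ∀ c,
        Tendsto (fun z => (∏ i, headCoord r i z) * f z)
          (𝓝 (padZero r t) ⊓ generic (EuclideanSpace ℝ (Fin (m + r)))) (𝓝 c) → c = h t
  | 0, Q, f, hQ, hint, hf, _, x₀, _ => by
    refine ⟨f, hQ, hint, hf, ?_⟩
    have hgen : ∀ᶠ t in generic (EuclideanSpace ℝ (Fin m)), t ∈ offFacets Q :=
      eventually_generic_offFacets hQ hint
    filter_upwards [hgen] with t ht c hc
    have h1 : Tendsto (fun z => (∏ i, headCoord 0 i z) * f z)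
        (𝓝 t ⊓ generic (EuclideanSpace ℝ (Fin m))) (𝓝 (f t)) := by
      simp only [Finset.univ_eq_empty, Finset.prod_empty, one_mul]
      exact (hf.continuousAt hQ hint ht).tendsto.mono_left inf_le_left
    exact tendsto_nhds_unique hc h1
  | r + 1, Q, f, hQ, hint, hf, hpos, x₀, hloc => by
    let ℓ : EuclideanSpace ℝ (Fin (m + r + 1)) →ᵃ[ℝ] ℝ :=
      (EuclideanSpace.proj (𝕜 := ℝ) (0 : Fin (m + r + 1)) :
        EuclideanSpace ℝ (Fin (m + r + 1)) →ₗ[ℝ] ℝ).toAffineMap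
    have hℓ : ∀ z, ℓ z = z 0 := fun z => rfl
    have hfe : IsFacetEquation Q {z ∈ Q | ℓ z = 0} ℓ := ⟨fun z hz => hpos z hz 0, rfl⟩
    have hlin : ℓ.linear ≠ 0 := by
      intro h0
      have h1 : ℓ.linear (consPoint 1 0) = 1 := rfl
      rw [h0] at h1
      simp at h1
    -- Moving from the given point by a small `u` in all coordinates but the first makes the
    -- remaining head coordinates positive. Near the new point only the condition on the first
    -- coordinate is left, so its zero set is a facet.
    have hG : {z ∈ Q | ℓ z = 0} ∈ facets Q := by
      let w : EuclideanSpace ℝ (Fin (m + r)) := WithLp.toLp 2 fun _ => 1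
      have hc : Tendsto (fun u : ℝ => padZero (r + 1) x₀ + u • consPoint 0 w) (𝓝[>] 0)
          (𝓝 (padZero (r + 1) x₀)) := by
        have : Continuous fun u : ℝ => padZero (r + 1) x₀ + u • consPoint 0 w := by fun_prop
        have := this.tendsto 0
        simp only [zero_smul, add_zero] at this
        exact this.mono_left nhdsWithin_le_nhds
      obtain ⟨u, hu, hu0⟩ := ((hc.eventually hloc.eventually_nhds).and self_mem_nhdsWithin).exists
      have hu0' : 0 < u := hu0
      set p := padZero (r + 1) x₀ + u • consPoint 0 w with hp
      have hp0 : p 0 = 0 := by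
        change (0 : ℝ) + u * 0 = 0
        ring
      have hps : ∀ i : Fin r, headCoord (m := m) (r + 1) i.succ p = u := by
        intro i
        have h1 : headCoord (m := m) (r + 1) i.succ p =
          headCoord (m := m) (r + 1) i.succ (padZero (r + 1) x₀) + u * 1 := rfl
        rw [h1, headCoord_padZero]
        ring
      have hpQ : p ∈ Q := by
        refine hu.self_of_nhds fun i => ?_
        refine Fin.cases ?_ (fun i => ?_) i
        · exact hp0.ge
        · rw [hps]; exact hu0'.le
      refine mem_facets_of_isFacetEquation hint hfe hlin (p := p) ⟨hpQ, hp0⟩ ?_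
      have hnear : ∀ᶠ x in 𝓝 p, ∀ i : Fin r, 0 < headCoord (m := m) (r + 1) i.succ x := by
        refine eventually_all.2 fun i => ?_
        have hcont : Continuous fun x => headCoord (m := m) (r + 1) i.succ x :=
          (EuclideanSpace.proj (𝕜 := ℝ) _).continuous
        refine hcont.continuousAt.eventually (lt_mem_nhds ?_)
        exact hu0'.trans_eq (hps i).symm
      filter_upwards [hu, hnear] with x hx1 hx2 hx3
      refine hx1 fun i => ?_
      refine Fin.cases ?_ (fun i => ?_) i
      · exact hx3.ge
      · exact (hx2 i).le
    obtain ⟨κ, hκ, hGκ⟩ := (isFacetEquation_facetEq hG).exists_pos_mul hint hG hfe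
    obtain ⟨h₁, hT, hTint, hh₁, hres⟩ := exists_residue_of_nonneg hQ hint hf hG hκ
      fun z => by rw [hGκ, hℓ, mul_comm]
    have hloc' : ∀ᶠ z in 𝓝 (padZero r x₀), (∀ i, 0 ≤ headCoord r i z) →
        z ∈ {z : EuclideanSpace ℝ (Fin (m + r)) | consPoint 0 z ∈ Q} := by
      have hcont : Continuous fun z : EuclideanSpace ℝ (Fin (m + r)) => consPoint 0 z :=
        continuous_consPoint.comp (continuous_const.prodMk continuous_id)
      filter_upwards [(hcont.tendsto (padZero r x₀)).eventually hloc] with z hz hz'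
      refine hz fun i => ?_
      refine Fin.cases ?_ (fun i => ?_) i
      · exact le_rfl
      · exact hz' i
    obtain ⟨h, h1, h2, h3, h4⟩ := exists_iterated_residue r hT hTint hh₁
      (fun z hz i => hpos _ hz i.succ) x₀ hloc'
    refine ⟨h, h1, h2, h3, ?_⟩
    filter_upwards [h4] with t ht c hc
    refine ht c ?_
    -- The joint limit determines the iterated one: for generic `z` close to the face, the points
    -- `(s, z)` eventually lie where the function takes values in a closed neighbourhood of `c`, so
    -- the residue in `s` has its value there as well.
    rw [(closed_nhds_basis c).tendsto_right_iff]
    rintro V ⟨hV, hVc⟩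
    have hev := hc.eventually_mem hV
    rw [Filter.Eventually, Filter.mem_inf_iff_superset] at hev
    obtain ⟨U, hU, B, hB, hUB⟩ := hev
    rw [eventually_iff, Filter.mem_inf_iff_superset]
    obtain ⟨O, hOU, hO, htO⟩ := mem_nhds_iff.1 hU
    have hcont : Continuous fun z : EuclideanSpace ℝ (Fin (m + r)) => consPoint 0 z :=
      continuous_consPoint.comp (continuous_const.prodMk continuous_id)
    refine ⟨{z | consPoint 0 z ∈ O}, (hO.preimage hcont).mem_nhds htO, _,
      inter_mem hres (eventually_generic_consPoint (p := (· ∈ B)) hB), ?_⟩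
    rintro z ⟨hzO, hz1, hz2⟩
    have hz1 := hz1.1
    have hz2 : ∀ᶠ s : ℝ in 𝓝[≠] 0, consPoint s z ∈ B := hz2
    have hzO' : ∀ᶠ s : ℝ in 𝓝[≠] 0, consPoint s z ∈ O :=
      ((tendsto_consPoint z).eventually_mem (hO.mem_nhds hzO)).filter_mono nhdsWithin_le_nhds
    have hlim : Tendsto (fun s : ℝ => (∏ i, headCoord (m := m) (r + 1) i (consPoint s z)) *
        f (consPoint s z)) (𝓝[≠] 0) (𝓝 ((∏ i, headCoord r i z) * h₁ z)) := by
      refine (hz1.const_mul (∏ i, headCoord r i z)).congr fun s => ?_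
      rw [Fin.prod_univ_succ, headCoord_consPoint_zero]
      simp only [headCoord_consPoint_succ]
      ring
    refine hVc.mem_of_tendsto hlim ?_
    filter_upwards [hz2, hzO'] with s hs1 hs2
    exact hUB ⟨hOU hs2, hs1⟩

theorem stdVolume_apply (d : ℕ) (v : Fin d → EuclideanSpace ℝ (Fin d)) :
    stdVolume d v = Matrix.det (Matrix.of fun i j => v j i) := rfl

theorem stdVolume_map {d : ℕ} (L : EuclideanSpace ℝ (Fin d) →ₗ[ℝ] EuclideanSpace ℝ (Fin d))
    (v : Fin d → EuclideanSpace ℝ (Fin d)) :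
    stdVolume d (L ∘ v) = LinearMap.det L * stdVolume d v :=
  Module.Basis.det_comp _ L v

/-- The canonical function of a simple face, in the coordinates given by an affine map `τ` which
is injective on the face, as the limit of the canonical function of the polytope. -/
theorem exists_face_canonical {d r : ℕ} (hd : d = m + r) {Q : Set (EuclideanSpace ℝ (Fin d))}
    {f : EuclideanSpace ℝ (Fin d) → ℝ} (hQ : IsPolytope Q) (hint : (interior Q).Nonempty)
    (hf : IsWeakCanonical d Q f) (ℓ : Fin r → EuclideanSpace ℝ (Fin d) →ᵃ[ℝ] ℝ)
    (τ : EuclideanSpace ℝ (Fin d) →ₗ[ℝ] EuclideanSpace ℝ (Fin m))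
    (hℓ : ∀ x ∈ Q, ∀ i, 0 ≤ ℓ i x)
    (hbij : Function.Bijective fun x => ((fun i => ℓ i x, τ x) : (Fin r → ℝ) × _))
    (x₀ : EuclideanSpace ℝ (Fin d)) (hx₀ : ∀ i, ℓ i x₀ = 0)
    (hloc : ∀ᶠ x in 𝓝 x₀, (∀ i, 0 ≤ ℓ i x) → x ∈ Q) :
    ∃ (D : ℝ) (h : EuclideanSpace ℝ (Fin m) → ℝ), 0 < D ∧
      (∀ (e : Fin r ⊕ Fin m ≃ Fin d) (v : Fin r → EuclideanSpace ℝ (Fin d))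
        (w : Fin m → EuclideanSpace ℝ (Fin d)), (∀ j, τ (v j) = 0) →
        (∀ j, τ (w j) = EuclideanSpace.single j 1) →
        D * |Matrix.det (Matrix.of fun i j => (ℓ i).linear (v j))| =
          |stdVolume d (Sum.elim v w ∘ e.symm)|) ∧
      IsPolytope (τ '' {x ∈ Q | ∀ i, ℓ i x = 0}) ∧
      (interior (τ '' {x ∈ Q | ∀ i, ℓ i x = 0})).Nonempty ∧
      IsWeakCanonical m (τ '' {x ∈ Q | ∀ i, ℓ i x = 0}) h ∧
      ∀ᶠ y in generic (EuclideanSpace ℝ (Fin m)), ∀ q, (∀ i, ℓ i q = 0) → τ q = y → ∀ c,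
        Tendsto (fun x => (∏ i, ℓ i x) * f x)
          (𝓝 q ⊓ generic (EuclideanSpace ℝ (Fin d))) (𝓝 c) → D * c = h y := by
  subst hd
  -- The facet equations occupy the first `r` coordinates and `τ` the last `m`, as `padZero` and
  -- `headCoord` expect.
  let e₀ : Fin r ⊕ Fin m ≃ Fin (m + r) := finSumFinEquiv.trans (finCongr (add_comm r m))
  have he₀l : ∀ i : Fin r, e₀ (Sum.inl i) = ⟨i, by omega⟩ := fun i => rfl
  have he₀r : ∀ j : Fin m, e₀ (Sum.inr j) = ⟨r + j, by omega⟩ := fun j => rfl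
  let A : EuclideanSpace ℝ (Fin (m + r)) →ᵃ[ℝ] EuclideanSpace ℝ (Fin (m + r)) :=
    { toFun := fun x => WithLp.toLp 2 fun k => Sum.elim (fun i => ℓ i x) (fun j => τ x j) (e₀.symm k)
      linear :=
        { toFun := fun x =>
            WithLp.toLp 2 fun k => Sum.elim (fun i => (ℓ i).linear x) (fun j => τ x j) (e₀.symm k)
          map_add' := fun x y => by
            ext k
            rcases h : e₀.symm k with i | j <;> simp [h]
          map_smul' := fun c x => by
            ext k
            rcases h : e₀.symm k with i | j <;> simp [h] }
      map_vadd' := fun x v => by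
        ext k
        rcases h : e₀.symm k with i | j
        · simpa [h] using (ℓ i).map_vadd x v
        · simp [h] }
  have hAl : ∀ x i, headCoord r i (A x) = ℓ i x := by
    intro x i
    change Sum.elim (fun i => ℓ i x) (fun j => τ x j) (e₀.symm ⟨i, _⟩) = _
    rw [← he₀l, Equiv.symm_apply_apply]
    rfl
  have hAr : ∀ x j, A x ⟨r + (j : Fin m), by omega⟩ = τ x j := by
    intro x j
    change Sum.elim (fun i => ℓ i x) (fun j => τ x j) (e₀.symm ⟨r + j, _⟩) = _
    rw [← he₀r, Equiv.symm_apply_apply]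
    rfl
  have hlin : ∀ v i, (A.linear v) (e₀ (Sum.inl i)) = (ℓ i).linear v := by
    intro v i
    change Sum.elim (fun i => (ℓ i).linear v) (fun j => τ v j) (e₀.symm (e₀ _)) = _
    rw [Equiv.symm_apply_apply]
    rfl
  have hlinr : ∀ v j, (A.linear v) (e₀ (Sum.inr j)) = τ v j := by
    intro v i
    change Sum.elim (fun i => (ℓ i).linear v) (fun j => τ v j) (e₀.symm (e₀ _)) = _
    rw [Equiv.symm_apply_apply]
    rfl
  have hAbij : Function.Bijective A := by
    constructor
    · intro x y hxy
      refine hbij.1 (Prod.ext (funext fun i => ?_) ?_)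
      · change ℓ i x = ℓ i y
        rw [← hAl x, ← hAl y, hxy]
      · ext j
        change τ x j = τ y j
        rw [← hAr x, ← hAr y, hxy]
    · intro z
      obtain ⟨x, hx⟩ := hbij.2 (fun i => headCoord r i z, WithLp.toLp 2 fun j => z ⟨r + j, by omega⟩)
      refine ⟨x, ?_⟩
      have hx1 : ∀ i, ℓ i x = headCoord r i z := fun i => congrFun (congrArg Prod.fst hx) i
      have hx2 : ∀ j, τ x j = z ⟨r + j, by omega⟩ := fun j =>
        congrFun (congrArg (fun p => WithLp.ofLp p.2) hx) j
      ext k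
      obtain ⟨i | j, rfl⟩ := e₀.surjective k
      · exact (hAl x i).trans (hx1 i)
      · exact (hAr x j).trans (hx2 j)
  let Ψ := (AffineEquiv.ofBijective hAbij).symm
  have hΨA : ∀ x, Ψ (A x) = x := fun x => (AffineEquiv.ofBijective hAbij).symm_apply_apply x
  have hAΨ : ∀ z, A (Ψ z) = z := fun z => (AffineEquiv.ofBijective hAbij).apply_symm_apply z
  have hℓΨ : ∀ z i, ℓ i (Ψ z) = headCoord r i z := fun z i => by rw [← hAl, hAΨ]
  set D := |LinearMap.det (Ψ.linear : EuclideanSpace ℝ (Fin (m + r)) →ₗ[ℝ]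
    EuclideanSpace ℝ (Fin (m + r)))| with hD
  have hD0 : 0 < D := abs_pos.2 (LinearEquiv.isUnit_det' Ψ.linear).ne_zero
  have hpadmem : ∀ x, (∀ i, ℓ i x = 0) → A x = padZero r (τ x) := by
    intro x hx
    ext k
    obtain ⟨i | j, rfl⟩ := e₀.surjective k
    · exact (hAl x i).trans ((hx i).trans (headCoord_padZero r i _).symm)
    · exact (hAr x j).trans (padZero_tail r (τ x) j).symm
  have hτΨ : ∀ t, τ (Ψ (padZero r t)) = t := by
    intro t
    ext j
    rw [← hAr, hAΨ, padZero_tail]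
  have hset : {t | padZero r t ∈ Ψ ⁻¹' Q} = τ '' {x ∈ Q | ∀ i, ℓ i x = 0} := by
    ext t
    constructor
    · intro ht
      exact ⟨Ψ (padZero r t), ⟨ht, fun i => by rw [hℓΨ, headCoord_padZero]⟩, hτΨ t⟩
    · rintro ⟨x, ⟨hxQ, hx⟩, rfl⟩
      change Ψ (padZero r (τ x)) ∈ Q
      rwa [← hpadmem x hx, hΨA]
  have hQΨ : IsPolytope (Ψ ⁻¹' Q) := by
    rw [show Ψ ⁻¹' Q = Ψ.symm.toAffineMap '' Q from (Ψ.symm.toEquiv.image_eq_preimage_symm Q).symm]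
    exact hQ.image _
  have hintΨ : (interior (Ψ ⁻¹' Q)).Nonempty := by
    rw [← affineEquiv_preimage_interior]
    exact hint.preimage Ψ.surjective
  have hΨc : Continuous Ψ := AffineMap.continuous_of_finiteDimensional Ψ.toAffineMap
  obtain ⟨h, h1, h2, h3, h4⟩ := exists_iterated_residue r hQΨ hintΨ (hf.comp Ψ)
    (fun z hz i => by rw [← hℓΨ]; exact hℓ _ hz i) (τ x₀) (by
      rw [← hpadmem x₀ hx₀]
      have : Tendsto Ψ (𝓝 (A x₀)) (𝓝 x₀) := by
        have := hΨc.tendsto (A x₀)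
        rwa [hΨA] at this
      filter_upwards [this.eventually hloc] with z hz hz'
      exact hz fun i => by rw [hℓΨ]; exact hz' i)
  rw [hset] at h1 h2 h3
  refine ⟨D, h, hD0, ?_, h1, h2, h3, ?_⟩
  · intro e v w hv hw
    have hcomp : (Ψ.linear : EuclideanSpace ℝ (Fin (m + r)) →ₗ[ℝ] _) ∘
        (A.linear ∘ (Sum.elim v w ∘ e.symm)) = Sum.elim v w ∘ e.symm := by
      ext1 k
      exact (AffineEquiv.ofBijective hAbij).linear.symm_apply_apply _
    have h5 := stdVolume_map (Ψ.linear : EuclideanSpace ℝ (Fin (m + r)) →ₗ[ℝ] _)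
      (A.linear ∘ (Sum.elim v w ∘ e.symm))
    rw [hcomp] at h5
    rw [h5, abs_mul, ← hD]
    congr 1
    rw [stdVolume_apply, ← Matrix.abs_det_submatrix_equiv_equiv e₀ e]
    congr 1
    -- The vectors `v` are killed by `τ` and the `w` lift the standard basis. The matrix is block
    -- triangular with an identity block, and only the determinant of the facet equations on `v`
    -- survives.
    have h6 : (Matrix.of fun i j => (A.linear ∘ (Sum.elim v w ∘ e.symm)) j i).submatrix e₀ e =
        Matrix.fromBlocks (Matrix.of fun i j => (ℓ i).linear (v j))
          (Matrix.of fun i j => (ℓ i).linear (w j)) 0 1 := by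
      ext i j
      rcases i with i | i <;> rcases j with j | j
      · simp [hlin]
      · simp [hlin]
      · simp [hlinr, hv]
      · simp [hlinr, hw, Matrix.one_apply]
    rw [h6, Matrix.det_fromBlocks_zero₂₁, Matrix.det_one, mul_one]
  · filter_upwards [h4] with y hy q hq hqy c hc
    refine hy _ ?_
    have hqpad : Ψ (padZero r y) = q := by rw [← hqy, ← hpadmem q hq, hΨA]
    have hΨlim : Tendsto Ψ (𝓝 (padZero r y) ⊓ generic _) (𝓝 q ⊓ generic _) := by
      refine tendsto_inf.2 ⟨?_, ?_⟩
      · rw [← hqpad]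
        exact (hΨc.tendsto _).mono_left inf_le_left
      · have h7 : Tendsto Ψ (generic _) (generic _) := fun s hs =>
          eventually_generic_comp_equiv (p := (· ∈ s)) Ψ hs
        exact h7.mono_left inf_le_right
    have := (hc.comp hΨlim).const_mul D
    refine this.congr fun z => ?_
    simp only [Function.comp_apply, hℓΨ]
    ring

end IteratedResidues

/-! ### Fiberwise maximal sections and the fiber polytope. -/

section Sections

variable {n m : ℕ} {π : EuclideanSpace ℝ (Fin n) →ₗ[ℝ] EuclideanSpace ℝ (Fin m)}
  {Q : Set (EuclideanSpace ℝ (Fin n))}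

/-- `γ` is a continuous section of `π : Q → π '' Q`. -/
def IsFiberSection (π : EuclideanSpace ℝ (Fin n) →ₗ[ℝ] EuclideanSpace ℝ (Fin m))
    (Q : Set (EuclideanSpace ℝ (Fin n)))
    (γ : EuclideanSpace ℝ (Fin m) → EuclideanSpace ℝ (Fin n)) : Prop :=
  ContinuousOn γ (π '' Q) ∧ ∀ y ∈ π '' Q, γ y ∈ Q ∧ π (γ y) = y

theorem continuous_linear : Continuous π := LinearMap.continuous_of_finiteDimensional π

theorem isCompact_image (hQ : IsPolytope Q) : IsCompact (π '' Q) :=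
  hQ.isCompact.image continuous_linear

theorem isPolytope_image (hQ : IsPolytope Q) : IsPolytope (π '' Q) := hQ.image π.toAffineMap

theorem interior_image_nonempty (hπ : Function.Surjective π) (hint : (interior Q).Nonempty) :
    (interior (π '' Q)).Nonempty := by
  have hopen : IsOpen (π '' interior Q) :=
    LinearMap.isOpenMap_of_finiteDimensional π hπ _ isOpen_interior
  exact (hint.image π).mono (interior_maximal (image_mono interior_subset) hopen)

/-- `y` lies between the image of an interior point of `Q` and a point of `π '' Q` slightly beyond
`y`. The corresponding convex combination upstairs is interior. -/
theorem exists_interior_preimage (hQ : IsPolytope Q) (hint : (interior Q).Nonempty)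
    {y : EuclideanSpace ℝ (Fin m)} (hy : y ∈ interior (π '' Q)) :
    ∃ x ∈ interior Q, π x = y := by
  obtain ⟨q, hq⟩ := hint
  have hc : Tendsto (fun t : ℝ => y + t • (y - π q)) (𝓝[>] 0) (𝓝 y) := by
    have : Continuous fun t : ℝ => y + t • (y - π q) := by fun_prop
    have := this.tendsto 0
    simp only [zero_smul, add_zero] at this
    exact this.mono_left nhdsWithin_le_nhds
  obtain ⟨t, ht, ht0⟩ := ((hc.eventually_mem (isOpen_interior.mem_nhds hy)).and
    self_mem_nhdsWithin).exists
  have ht0' : 0 < t := ht0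
  obtain ⟨x, hx, hxy⟩ := interior_subset ht
  have h1 : (1 + t) ≠ 0 := by positivity
  refine ⟨(t / (1 + t)) • q + (1 / (1 + t)) • x,
    hQ.convex.combo_interior_self_mem_interior hq hx (by positivity) (by positivity)
      (by field_simp; ring), ?_⟩
  rw [map_add, map_smul, map_smul, hxy]
  have : y = (1 + t)⁻¹ • ((1 + t) • y) := by rw [smul_smul, inv_mul_cancel₀ h1, one_smul]
  conv_rhs => rw [this]
  rw [div_eq_inv_mul, one_div, mul_smul, ← smul_add]
  congr 1
  module

theorem exists_extension (ψ : StrongDual ℝ (LinearMap.ker π)) :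
    ∃ φ : StrongDual ℝ (EuclideanSpace ℝ (Fin n)), ∀ k : LinearMap.ker π, φ k = ψ k :=
  let ⟨φ, h, _⟩ := exists_extension_norm_eq (LinearMap.ker π) ψ
  ⟨φ, h⟩

theorem mem_sectionImage_iff {ψ : StrongDual ℝ (LinearMap.ker π)}
    {φ : StrongDual ℝ (EuclideanSpace ℝ (Fin n))} (hφ : ∀ k : LinearMap.ker π, φ k = ψ k)
    (x : EuclideanSpace ℝ (Fin n)) :
    x ∈ sectionImage π Q ψ ↔ x ∈ Q ∧ ∀ z ∈ Q, π z = π x → φ z ≤ φ x := by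
  refine and_congr_right fun _ => ⟨fun h z hz hzx => ?_, fun h k hk => ?_⟩
  · have hk : z - x ∈ LinearMap.ker π := by rw [LinearMap.mem_ker, map_sub, hzx, sub_self]
    have := h ⟨z - x, hk⟩ (by simpa using hz)
    rw [← hφ] at this
    simpa using this
  · have := h _ hk (by rw [map_add, LinearMap.mem_ker.1 k.2, add_zero])
    rw [map_add, hφ] at this
    linarith

theorem sectionImage_subset {ψ : StrongDual ℝ (LinearMap.ker π)} : sectionImage π Q ψ ⊆ Q :=
  fun _ hx => hx.1

/-- Maximality at `x` spreads over its minimal face: `x` is a convex combination of a given `y` in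
that face and of a point of `Q` on the other side, so a move by `k` admissible at `y` gives a
shorter admissible move at `x`. -/
theorem minFace_subset_sectionImage (hQ : IsPolytope Q) (hint : (interior Q).Nonempty)
    {ψ : StrongDual ℝ (LinearMap.ker π)} {x : EuclideanSpace ℝ (Fin n)}
    (hx : x ∈ sectionImage π Q ψ) : minFace Q x ⊆ sectionImage π Q ψ := by
  intro y hy
  refine ⟨hy.1, fun k hk => ?_⟩
  obtain ⟨ε, hε, hback⟩ := exists_move_back hQ hint hx.1 hy.1 hy.2
  have h1 : (1 + ε) ≠ 0 := by positivity
  have h2 : x + (ε / (1 + ε)) • (k : EuclideanSpace ℝ (Fin n)) =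
      (1 / (1 + ε)) • (x - ε • (y - x)) + (ε / (1 + ε)) • (y + k) := by
    have : x = (1 + ε)⁻¹ • ((1 + ε) • x) := by rw [smul_smul, inv_mul_cancel₀ h1, one_smul]
    conv_lhs => rw [this]
    rw [div_eq_inv_mul, one_div, mul_smul, mul_smul, ← smul_add, ← smul_add]
    congr 1
    module
  have h3 := hx.2 ((ε / (1 + ε)) • k) (by
    rw [Submodule.coe_smul, h2]
    exact hQ.convex hback hk (by positivity) (by positivity) (by field_simp))
  rw [map_smul, smul_eq_mul] at h3
  exact nonpos_of_mul_nonpos_right h3 (by positivity)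

theorem sectionImage_eq_sUnion (hQ : IsPolytope Q) (hint : (interior Q).Nonempty)
    (ψ : StrongDual ℝ (LinearMap.ker π)) :
    sectionImage π Q ψ = ⋃₀ {T | IsExposed ℝ Q T ∧ T ⊆ sectionImage π Q ψ} := by
  refine Subset.antisymm (fun x hx => ?_) (sUnion_subset fun T hT => hT.2)
  exact ⟨minFace Q x, ⟨isExposed_minFace hQ x, minFace_subset_sectionImage hQ hint hx⟩,
    mem_minFace hx.1⟩

theorem isClosed_sectionImage (hQ : IsPolytope Q) (hint : (interior Q).Nonempty)
    (ψ : StrongDual ℝ (LinearMap.ker π)) : IsClosed (sectionImage π Q ψ) := by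
  rw [sectionImage_eq_sUnion hQ hint, sUnion_eq_biUnion]
  have hfin : {T | IsExposed ℝ Q T ∧ T ⊆ sectionImage π Q ψ}.Finite :=
    hQ.finite_isExposed.subset fun _ h => h.1
  exact hfin.isClosed_biUnion fun T hT => hT.1.isClosed hQ.isClosed

/-- The set of the `ψ` for which a face is contained in the section of `ψ` is closed. -/
theorem isClosed_setOf_subset_sectionImage (T : Set (EuclideanSpace ℝ (Fin n))) :
    IsClosed {ψ : StrongDual ℝ (LinearMap.ker π) | T ⊆ sectionImage π Q ψ} := by
  by_cases hT : T ⊆ Q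
  · have : {ψ : StrongDual ℝ (LinearMap.ker π) | T ⊆ sectionImage π Q ψ} =
        ⋂ x ∈ T, ⋂ k : LinearMap.ker π, {ψ | x + (k : EuclideanSpace ℝ (Fin n)) ∈ Q → ψ k ≤ 0} := by
      ext ψ
      simp only [mem_iInter]
      exact ⟨fun h x hx k => (h hx).2 k, fun h x hx => ⟨hT hx, h x hx⟩⟩
    rw [this]
    refine isClosed_biInter fun x _ => isClosed_iInter fun k => ?_
    by_cases hk : x + (k : EuclideanSpace ℝ (Fin n)) ∈ Q
    · simp only [hk, true_imp_iff]
      exact isClosed_le (ContinuousLinearMap.apply ℝ ℝ k).continuous continuous_const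
    · simp [hk]
  · have : {ψ : StrongDual ℝ (LinearMap.ker π) | T ⊆ sectionImage π Q ψ} = ∅ := by
      ext ψ
      exact ⟨fun h => (hT (Subset.trans h sectionImage_subset)).elim, fun h => h.elim⟩
    rw [this]
    exact isClosed_empty

/-- Upper semicontinuity: containing a given face is a closed condition on `ψ`, and there are only
finitely many faces, so near `ψ₀` no new face can appear. -/
theorem eventually_sectionImage_subset (hQ : IsPolytope Q) (hint : (interior Q).Nonempty)
    (ψ₀ : StrongDual ℝ (LinearMap.ker π)) :
    ∀ᶠ ψ in 𝓝 ψ₀, sectionImage π Q ψ ⊆ sectionImage π Q ψ₀ := by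
  have h : ∀ᶠ ψ in 𝓝 ψ₀, ∀ T ∈ {T | IsExposed ℝ Q T}, T ⊆ sectionImage π Q ψ →
      T ⊆ sectionImage π Q ψ₀ := by
    refine (eventually_all_finite hQ.finite_isExposed).2 fun T _ => ?_
    by_cases hT : T ⊆ sectionImage π Q ψ₀
    · simp [hT]
    · filter_upwards [(isClosed_setOf_subset_sectionImage (π := π) (Q := Q) T).isOpen_compl.mem_nhds
        hT] with ψ hψ h
      exact (hψ h).elim
  filter_upwards [h] with ψ hψ
  intro x hx
  exact hψ _ (isExposed_minFace hQ x) (minFace_subset_sectionImage hQ hint hx) (mem_minFace hx.1)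

theorem exists_mem_sectionImage (hQ : IsPolytope Q) (ψ : StrongDual ℝ (LinearMap.ker π))
    {y : EuclideanSpace ℝ (Fin m)} (hy : y ∈ π '' Q) : ∃ x ∈ sectionImage π Q ψ, π x = y := by
  obtain ⟨φ, hφ⟩ := exists_extension ψ
  obtain ⟨x₀, hx₀, rfl⟩ := hy
  have hcomp : IsCompact (Q ∩ π ⁻¹' {π x₀}) :=
    hQ.isCompact.inter_right (isClosed_singleton.preimage continuous_linear)
  obtain ⟨x, hx, hmax⟩ := hcomp.exists_isMaxOn ⟨x₀, hx₀, rfl⟩ φ.continuous.continuousOn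
  refine ⟨x, (mem_sectionImage_iff hφ x).2 ⟨hx.1, fun z hz hzx => hmax ⟨hz, ?_⟩⟩, hx.2⟩
  exact hzx.trans hx.2

/-- If a face in the section image contains two points of one fiber, then `ψ` takes its maximum at
both and vanishes on their difference. This confines `ψ` to a hyperplane, one for each face. -/
theorem exists_generic_injOn (hQ : IsPolytope Q) :
    ∀ᶠ ψ in generic (StrongDual ℝ (LinearMap.ker π)),
      ∀ T ∈ {T | IsExposed ℝ Q T}, T ⊆ sectionImage π Q ψ → InjOn π T := by
  refine (eventually_all_finite hQ.finite_isExposed).2 fun T _ => ?_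
  by_cases hT : InjOn π T
  · simp [hT]
  · simp only [InjOn, not_forall] at hT
    obtain ⟨x, hx, z, hz, hxz, hne⟩ := hT
    have hk : z - x ∈ LinearMap.ker π := by rw [LinearMap.mem_ker, map_sub, hxz, sub_self]
    have hk0 : (⟨z - x, hk⟩ : LinearMap.ker π) ≠ 0 := by
      intro h
      exact hne (sub_eq_zero.1 (congrArg Subtype.val h)).symm
    have ha : ((ContinuousLinearMap.apply ℝ ℝ (⟨z - x, hk⟩ : LinearMap.ker π) :
        StrongDual ℝ (LinearMap.ker π) →L[ℝ] ℝ) :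
        StrongDual ℝ (LinearMap.ker π) →ₗ[ℝ] ℝ).toAffineMap ≠ 0 := by
      intro h
      obtain ⟨θ, hθ⟩ := SeparatingDual.exists_ne_zero (R := ℝ) hk0
      exact hθ (by simpa using congrArg (fun b => b θ) h)
    filter_upwards [eventually_generic_ne_zero ha] with ψ hψ hTψ
    exfalso
    apply hψ
    have h1 := (hTψ hx).2 ⟨z - x, hk⟩ (by simpa using sectionImage_subset (hTψ hz))
    have h2 := (hTψ hz).2 (-⟨z - x, hk⟩) (by simpa using sectionImage_subset (hTψ hx))
    rw [map_neg] at h2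
    have : ψ ⟨z - x, hk⟩ = 0 := by linarith
    simpa using this

/-- Two maximal points of one fiber have a maximal midpoint, and the minimal face of the midpoint
contains both of them, so injectivity on faces suffices. -/
theorem injOn_sectionImage (hQ : IsPolytope Q) (hint : (interior Q).Nonempty)
    {ψ : StrongDual ℝ (LinearMap.ker π)}
    (h : ∀ T ∈ {T | IsExposed ℝ Q T}, T ⊆ sectionImage π Q ψ → InjOn π T) :
    InjOn π (sectionImage π Q ψ) := by
  intro x hx z hz hxz
  obtain ⟨φ, hφ⟩ := exists_extension ψ
  have hx' := (mem_sectionImage_iff hφ x).1 hx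
  have hz' := (mem_sectionImage_iff hφ z).1 hz
  have hmid : midpoint ℝ x z ∈ Q := hQ.convex.midpoint_mem hx.1 hz.1
  have hmidπ : π (midpoint ℝ x z) = π x := by
    rw [midpoint_eq_smul_add, map_smul, map_add, ← hxz, ← two_smul ℝ (π x), smul_smul]
    simp
  have hmid' : midpoint ℝ x z ∈ sectionImage π Q ψ := by
    refine (mem_sectionImage_iff hφ _).2 ⟨hmid, fun a ha haπ => ?_⟩
    have h1 := hx'.2 a ha (haπ.trans hmidπ)
    have h2 := hz'.2 a ha (haπ.trans (hmidπ.trans hxz))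
    rw [midpoint_eq_smul_add, map_smul, map_add, invOf_eq_inv, smul_eq_mul]
    linarith
  have hmem : ∀ G ∈ facets Q, midpoint ℝ x z ∈ G → x ∈ G ∧ z ∈ G := by
    intro G hG hm
    rw [mem_facet_iff hG hmid] at hm
    rw [mem_facet_iff hG hx.1, mem_facet_iff hG hz.1]
    have h1 := facetEq_nonneg hG hx.1
    have h2 := facetEq_nonneg hG hz.1
    rw [AffineMap.map_midpoint, midpoint_eq_smul_add, invOf_eq_inv, smul_eq_mul] at hm
    constructor <;> linarith
  exact h (minFace Q (midpoint ℝ x z)) (isExposed_minFace hQ _)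
    (minFace_subset_sectionImage hQ hint hmid')
    ⟨hx.1, fun G hG hm => (hmem G hG hm).1⟩ ⟨hz.1, fun G hG hm => (hmem G hG hm).2⟩ hxz

theorem exists_section_of_injOn (hQ : IsPolytope Q) (hint : (interior Q).Nonempty)
    {ψ : StrongDual ℝ (LinearMap.ker π)} (hinj : InjOn π (sectionImage π Q ψ)) :
    ∃ γ, IsFiberSection π Q γ ∧ ∀ y ∈ π '' Q, γ y ∈ sectionImage π Q ψ := by
  classical
  have hcomp : IsCompact (sectionImage π Q ψ) :=
    hQ.isCompact.of_isClosed_subset (isClosed_sectionImage hQ hint ψ) sectionImage_subset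
  have hbij : BijOn π (sectionImage π Q ψ) (π '' Q) :=
    ⟨fun x hx => ⟨x, hx.1, rfl⟩, hinj, fun y hy => by
      obtain ⟨x, hx, h⟩ := exists_mem_sectionImage hQ ψ hy
      exact ⟨x, hx, h⟩⟩
  -- The section is the inverse of `π` on the section image, a continuous bijection from a compact
  -- to a Hausdorff space.
  have : CompactSpace (sectionImage π Q ψ) := isCompact_iff_compactSpace.1 hcomp
  let e := hbij.equiv
  have he : Continuous e := (continuous_linear.comp continuous_subtype_val).subtype_mk _
  let H := he.homeoOfEquivCompactToT2
  have hπH : ∀ y : π '' Q, π (H.symm y : EuclideanSpace ℝ (Fin n)) = y := fun y =>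
    congrArg Subtype.val (H.apply_symm_apply y)
  refine ⟨fun y => if h : y ∈ π '' Q then (H.symm ⟨y, h⟩ : EuclideanSpace ℝ (Fin n)) else 0,
    ⟨?_, ?_⟩, ?_⟩
  · rw [continuousOn_iff_continuous_domRestrict]
    have : (π '' Q).domRestrict (fun y => if h : y ∈ π '' Q then
        (H.symm ⟨y, h⟩ : EuclideanSpace ℝ (Fin n)) else 0) = 
          fun y => ((H.symm y : sectionImage π Q ψ) : EuclideanSpace ℝ (Fin n)) := by
      ext1 y
      simp only [domRestrict_apply, dif_pos y.2]
    rw [this]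
    exact continuous_subtype_val.comp H.symm.continuous
  · intro y hy
    simp only [dif_pos hy]
    exact ⟨(H.symm ⟨y, hy⟩).2.1, hπH ⟨y, hy⟩⟩
  · intro y hy
    simp only [dif_pos hy]
    exact (H.symm ⟨y, hy⟩).2

/-! ### Integrals of sections and normal cones. -/

section Integrals

variable {γ γ' : EuclideanSpace ℝ (Fin m) → EuclideanSpace ℝ (Fin n)}

theorem IsFiberSection.integrableOn (hQ : IsPolytope Q) (hγ : IsFiberSection π Q γ) :
    IntegrableOn γ (π '' Q) := hγ.1.integrableOn_compact (isCompact_image hQ)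

theorem measurableSet_image (hQ : IsPolytope Q) : MeasurableSet (π '' Q) :=
  (isCompact_image hQ).isClosed.measurableSet

theorem map_integral (φ : StrongDual ℝ (EuclideanSpace ℝ (Fin n))) (hQ : IsPolytope Q)
    (hγ : IsFiberSection π Q γ) : φ (∫ y in π '' Q, γ y) = ∫ y in π '' Q, φ (γ y) :=
  (φ.integral_comp_comm (hγ.integrableOn hQ)).symm

theorem integrableOn_comp (φ : StrongDual ℝ (EuclideanSpace ℝ (Fin n))) (hQ : IsPolytope Q)
    (hγ : IsFiberSection π Q γ) : IntegrableOn (fun y => φ (γ y)) (π '' Q) :=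
  φ.integrable_comp (hγ.integrableOn hQ)

theorem IsFiberSection.map_integral_eq (hQ : IsPolytope Q) (hγ : IsFiberSection π Q γ) :
    π (∫ y in π '' Q, γ y) = ∫ y in π '' Q, y := by
  have h := (LinearMap.toContinuousLinearMap π).integral_comp_comm (hγ.integrableOn hQ)
  change _ = π (∫ y in π '' Q, γ y) at h
  rw [← h]
  exact setIntegral_congr_fun (measurableSet_image hQ) fun y hy => (hγ.2 y hy).2

/-- All points of the fiber polytope have the same image under `π`, so their differences are in the
kernel, where `φ` and `ψ` agree. -/
theorem mem_normalConeKer_iff (hQ : IsPolytope Q) {ψ : StrongDual ℝ (LinearMap.ker π)}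
    {φ : StrongDual ℝ (EuclideanSpace ℝ (Fin n))} (hφ : ∀ k : LinearMap.ker π, φ k = ψ k)
    {Γ : Set (EuclideanSpace ℝ (Fin n))} (hΓ : Γ ⊆ fiberPolytope π Q) :
    ψ ∈ normalConeKer π (fiberPolytope π Q) Γ ↔
      ∀ a ∈ Γ, ∀ b ∈ fiberPolytope π Q, φ b ≤ φ a := by
  refine forall₂_congr fun a ha => ⟨fun h b hb => ?_, fun h k hk => ?_⟩
  · obtain ⟨γ, hγ1, hγ2, rfl⟩ := hΓ ha
    obtain ⟨γ', hγ1', hγ2', rfl⟩ := hb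
    have hk : (∫ y in π '' Q, γ' y) - (∫ y in π '' Q, γ y) ∈ LinearMap.ker π := by
      rw [LinearMap.mem_ker, map_sub, IsFiberSection.map_integral_eq hQ ⟨hγ1, hγ2⟩,
        IsFiberSection.map_integral_eq hQ ⟨hγ1', hγ2'⟩, sub_self]
    have := h ⟨_, hk⟩ (by
      rw [add_sub_cancel]
      exact ⟨γ', hγ1', hγ2', rfl⟩)
    rw [← hφ] at this
    simpa using this
  · have := h _ hk
    rw [map_add, hφ] at this
    linarith

/-- Sections on which `ψ` is maximal in the fibers yield maximal points of the fiber polytope. -/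
theorem le_integral_of_mem_sectionImage (hQ : IsPolytope Q)
    {ψ : StrongDual ℝ (LinearMap.ker π)} {φ : StrongDual ℝ (EuclideanSpace ℝ (Fin n))}
    (hφ : ∀ k : LinearMap.ker π, φ k = ψ k) (hγ : IsFiberSection π Q γ)
    (h : ∀ y ∈ π '' Q, γ y ∈ sectionImage π Q ψ) :
    ∀ b ∈ fiberPolytope π Q, φ b ≤ φ (∫ y in π '' Q, γ y) := by
  rintro _ ⟨γ', hγ1', hγ2', rfl⟩
  rw [map_integral φ hQ hγ, map_integral φ hQ ⟨hγ1', hγ2'⟩]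
  refine setIntegral_mono_on (integrableOn_comp φ hQ ⟨hγ1', hγ2'⟩) (integrableOn_comp φ hQ hγ)
    (measurableSet_image hQ) fun y hy => ?_
  refine ((mem_sectionImage_iff hφ _).1 (h y hy)).2 _ (hγ2' y hy).1 ?_
  rw [(hγ2' y hy).2, (hγ.2 y hy).2]

/-- Sections which yield maximal points of the fiber polytope are maximal in the fibers. -/
theorem mem_sectionImage_of_le_integral (hQ : IsPolytope Q) (hint : (interior Q).Nonempty)
    (hπ : Function.Surjective π)
    {ψ : StrongDual ℝ (LinearMap.ker π)} {φ : StrongDual ℝ (EuclideanSpace ℝ (Fin n))}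
    (hφ : ∀ k : LinearMap.ker π, φ k = ψ k) (hγ : IsFiberSection π Q γ)
    (h : ∀ b ∈ fiberPolytope π Q, φ b ≤ φ (∫ y in π '' Q, γ y)) :
    ∀ y ∈ π '' Q, γ y ∈ sectionImage π Q ψ := by
  have hinterior : ∀ y ∈ interior (π '' Q), γ y ∈ sectionImage π Q ψ := by
    intro y₀ hy₀
    have hy₀P := interior_subset hy₀
    by_contra hcon
    rw [mem_sectionImage_iff hφ] at hcon
    push Not at hcon
    obtain ⟨z, hz, hzπ, hlt⟩ := hcon (hγ.2 y₀ hy₀P).1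
    rw [(hγ.2 y₀ hy₀P).2] at hzπ
    obtain ⟨q, hq, hqπ⟩ := exists_interior_preimage hQ hint hy₀
    -- The better point `z` may lie on the boundary. A small admixture of the interior point `q` of
    -- the same fiber gives an interior point `x` still better than `γ y₀`, through which an affine
    -- section `δ` stays in `Q` locally.
    have hlim : Tendsto (fun t : ℝ => φ (t • q + (1 - t) • z)) (𝓝[>] 0) (𝓝 (φ z)) := by
      have : Continuous fun t : ℝ => φ (t • q + (1 - t) • z) := by fun_prop
      have := this.tendsto 0
      simp only [zero_smul, sub_zero, one_smul, zero_add] at this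
      exact this.mono_left nhdsWithin_le_nhds
    have hlt1 : ∀ᶠ t : ℝ in 𝓝[>] 0, t < 1 :=
      (eventually_lt_nhds one_pos).filter_mono nhdsWithin_le_nhds
    obtain ⟨t, ⟨ht1, ht2⟩, ht3⟩ := (((hlim.eventually (lt_mem_nhds hlt)).and hlt1).and
      self_mem_nhdsWithin).exists
    have ht3' : 0 < t := ht3
    set x := t • q + (1 - t) • z with hx
    have hxint : x ∈ interior Q := hQ.convex.combo_interior_self_mem_interior hq hz ht3'
      (by linarith) (by ring)
    have hxπ : π x = y₀ := by
      rw [hx, map_add, map_smul, map_smul, hqπ, hzπ]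
      module
    obtain ⟨ρ, hρ⟩ := π.exists_rightInverse_of_surjective (LinearMap.range_eq_top.2 hπ)
    have hρ' : ∀ y, π (ρ y) = y := fun y => LinearMap.congr_fun hρ y
    have hρc : Continuous ρ := LinearMap.continuous_of_finiteDimensional ρ
    let δ : EuclideanSpace ℝ (Fin m) → EuclideanSpace ℝ (Fin n) := fun y => x + ρ (y - y₀)
    have hδc : Continuous δ := continuous_const.add (hρc.comp (continuous_id.sub continuous_const))
    have hδ0 : δ y₀ = x := by simp [δ]
    have hδπ : ∀ y, π (δ y) = y := fun y => by simp [δ, hρ', hxπ]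
    have e1 : ∀ᶠ y in 𝓝 y₀, δ y ∈ Q := by
      filter_upwards [hδc.continuousAt.eventually_mem (isOpen_interior.mem_nhds (hδ0 ▸ hxint))]
        with y hy using interior_subset hy
    have hγc : ContinuousAt γ y₀ := hγ.1.continuousAt (mem_interior_iff_mem_nhds.1 hy₀)
    have e2 : ∀ᶠ y in 𝓝 y₀, φ (γ y) < φ (δ y) :=
      (φ.continuous.continuousAt.comp hγc).eventually_lt
        (φ.continuous.comp hδc).continuousAt (by
          change φ (γ y₀) < φ (δ y₀)
          rw [hδ0]; exact ht1)
    have e3 : ∀ᶠ y in 𝓝 y₀, y ∈ π '' Q := mem_interior_iff_mem_nhds.1 hy₀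
    obtain ⟨R, hR, hball⟩ := Metric.eventually_nhds_iff_ball.1 ((e1.and e2).and e3)
    -- The bump function `χ` interpolates between `γ` and the locally better section `δ`; by
    -- convexity the result is a section, and its integral is strictly larger under `φ`.
    let χ : EuclideanSpace ℝ (Fin m) → ℝ := fun y => max 0 (1 - dist y y₀ / R)
    have hχc : Continuous χ := by fun_prop
    have hχ0 : ∀ y, 0 ≤ χ y := fun y => le_max_left _ _
    have hχ1 : ∀ y, χ y ≤ 1 := fun y => max_le zero_le_one (by
      have : 0 ≤ dist y y₀ / R := by positivity
      linarith)
    have hχout : ∀ y, y ∉ Metric.ball y₀ R → χ y = 0 := by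
      intro y hy
      refine max_eq_left ?_
      rw [Metric.mem_ball, not_lt] at hy
      have : 1 ≤ dist y y₀ / R := (one_le_div hR).2 hy
      linarith
    have hχin : ∀ y, y ∈ Metric.ball y₀ R → 0 < χ y := by
      intro y hy
      refine lt_max_of_lt_right ?_
      rw [Metric.mem_ball] at hy
      have : dist y y₀ / R < 1 := (div_lt_one hR).2 hy
      linarith
    let γ' : EuclideanSpace ℝ (Fin m) → EuclideanSpace ℝ (Fin n) :=
      fun y => (1 - χ y) • γ y + χ y • δ y
    have hγ' : IsFiberSection π Q γ' := by
      refine ⟨((continuous_const.sub hχc).continuousOn.smul hγ.1).add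
        (hχc.smul hδc).continuousOn, fun y hy => ⟨?_, ?_⟩⟩
      · by_cases hyb : y ∈ Metric.ball y₀ R
        · exact hQ.convex (hγ.2 y hy).1 (hball y hyb).1.1 (by linarith [hχ1 y]) (hχ0 y) (by ring)
        · simp only [γ', hχout y hyb, sub_zero, one_smul, zero_smul, add_zero]
          exact (hγ.2 y hy).1
      · simp only [γ', map_add, map_smul, (hγ.2 y hy).2, hδπ]
        module
    have hle := h _ ⟨γ', hγ'.1, hγ'.2, rfl⟩
    rw [map_integral φ hQ hγ, map_integral φ hQ hγ'] at hle
    have hdiff : ∀ y, φ (γ' y) - φ (γ y) = χ y * (φ (δ y) - φ (γ y)) := by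
      intro y
      simp only [γ', map_add, map_smul, smul_eq_mul]
      ring
    have hint1 := (integrableOn_comp φ hQ hγ').sub (integrableOn_comp φ hQ hγ)
    have hpos : 0 < ∫ y in π '' Q, (φ (γ' y) - φ (γ y)) := by
      rw [setIntegral_pos_iff_support_of_nonneg_ae]
      · refine lt_of_lt_of_le (Metric.measure_ball_pos volume y₀ hR) (measure_mono fun y hy => ?_)
        refine ⟨?_, (hball y hy).2⟩
        rw [Function.mem_support, hdiff]
        exact (mul_pos (hχin y hy) (sub_pos.2 (hball y hy).1.2)).ne'
      · refine Eventually.of_forall fun y => ?_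
        change 0 ≤ φ (γ' y) - φ (γ y)
        rw [hdiff]
        by_cases hyb : y ∈ Metric.ball y₀ R
        · exact (mul_pos (hχin y hyb) (sub_pos.2 (hball y hyb).1.2)).le
        · rw [hχout y hyb, zero_mul]
      · exact hint1
    rw [integral_sub (integrableOn_comp φ hQ hγ') (integrableOn_comp φ hQ hγ)] at hpos
    linarith
  intro y hy
  have hcl : y ∈ closure (interior (π '' Q)) := by
    rw [(isPolytope_image hQ).convex.closure_interior_eq_closure_of_nonempty_interior
      (interior_image_nonempty hπ hint)]
    exact subset_closure hy
  have h1 : Tendsto γ (𝓝[interior (π '' Q)] y) (𝓝 (γ y)) :=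
    (hγ.1 y hy).mono_left (nhdsWithin_mono _ interior_subset)
  have := mem_closure_iff_nhdsWithin_neBot.1 hcl
  refine (isClosed_sectionImage hQ hint ψ).mem_of_tendsto h1 ?_
  filter_upwards [self_mem_nhdsWithin] with z hz using hinterior z hz

end Integrals

/-- A maximal cone of the fiber fan has interior points, and the sections of its interior points
have a common section whose image they are. -/
theorem exists_section_of_isMaximalFiberCone (hQ : IsPolytope Q) (hint : (interior Q).Nonempty)
    (hπ : Function.Surjective π) {σ : Set (StrongDual ℝ (LinearMap.ker π))}
    (hσ : IsMaximalFiberCone π Q σ) :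
    (interior σ).Nonempty ∧ ∃ γ, IsFiberSection π Q γ ∧
      (∀ ψ ∈ σ, ∀ y ∈ π '' Q, γ y ∈ sectionImage π Q ψ) ∧
      ∀ ψ ∈ interior σ, sectionImage π Q ψ = γ '' (π '' Q) := by
  obtain ⟨⟨Γ, hΓne, hΓexp, hσΓ⟩, hmax⟩ := hσ
  constructor
  -- A generic `ψ` close to a functional exposing `Γ` has an injective section image contained in
  -- that of `ψ₀`. Its unique section integrates to a point of `Γ` which is a vertex of the fiber
  -- polytope.
  · obtain ⟨l, hl⟩ := hΓexp hΓne
    let ψ₀ : StrongDual ℝ (LinearMap.ker π) := l.comp (LinearMap.ker π).subtypeL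
    have hlψ : ∀ k : LinearMap.ker π, l k = ψ₀ k := fun k => rfl
    have hev : ∀ᶠ ψ in 𝓝 ψ₀ ⊓ generic (StrongDual ℝ (LinearMap.ker π)),
        sectionImage π Q ψ ⊆ sectionImage π Q ψ₀ ∧
        ∀ T ∈ {T | IsExposed ℝ Q T}, T ⊆ sectionImage π Q ψ → InjOn π T :=
      ((eventually_sectionImage_subset hQ hint ψ₀).filter_mono inf_le_left).and
        ((exists_generic_injOn hQ).filter_mono inf_le_right)
    have : FiniteDimensional ℝ (StrongDual ℝ (LinearMap.ker π)) :=
      LinearEquiv.finiteDimensional LinearMap.toContinuousLinearMap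
    have := nhds_inf_generic_neBot ψ₀
    obtain ⟨ψ, hψ1, hψ2⟩ := hev.exists
    have hinj := injOn_sectionImage hQ hint hψ2
    obtain ⟨γ, hγ, hγψ⟩ := exists_section_of_injOn hQ hint hinj
    obtain ⟨φ, hφ⟩ := exists_extension ψ
    set w := ∫ y in π '' Q, γ y with hw
    have hwS : w ∈ fiberPolytope π Q := ⟨γ, hγ.1, hγ.2, rfl⟩
    have hwΓ : w ∈ Γ := by
      rw [hl]
      exact ⟨hwS, le_integral_of_mem_sectionImage hQ hlψ hγ fun y hy => hψ1 (hγψ y hy)⟩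
    have hexp : IsExposed ℝ (fiberPolytope π Q) {w} := by
      refine fun _ => ⟨φ, ?_⟩
      ext b
      constructor
      · rintro rfl
        exact ⟨hwS, le_integral_of_mem_sectionImage hQ hφ hγ hγψ⟩
      · rintro ⟨⟨γ', hγ1', hγ2', rfl⟩, hb⟩
        have h1 := mem_sectionImage_of_le_integral hQ hint hπ hφ ⟨hγ1', hγ2'⟩ hb
        refine setIntegral_congr_fun (measurableSet_image hQ) fun y hy => ?_
        exact hinj (h1 y hy) (hγψ y hy) ((hγ2' y hy).2.trans (hγ.2 y hy).2.symm)
    have hsub : σ ⊆ normalConeKer π (fiberPolytope π Q) {w} := by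
      rw [hσΓ]
      rintro θ hθ a rfl
      exact hθ _ hwΓ
    -- By maximality `σ` contains the normal cone of the vertex `w`. This cone is a neighbourhood of
    -- `ψ`, since nearby functionals have the same section.
    have hσ' := hmax ⟨{w}, singleton_nonempty w, hexp, rfl⟩ hsub
    refine ⟨ψ, mem_interior_iff_mem_nhds.2 (mem_of_superset ?_ hσ')⟩
    filter_upwards [eventually_sectionImage_subset hQ hint ψ] with θ hθ
    obtain ⟨φ', hφ'⟩ := exists_extension θ
    refine (mem_normalConeKer_iff hQ hφ' (singleton_subset_iff.2 hwS)).2 ?_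
    rintro a rfl
    refine le_integral_of_mem_sectionImage hQ hφ' hγ fun y hy => ?_
    obtain ⟨x, hx, hxy⟩ := exists_mem_sectionImage hQ θ hy
    rwa [hinj (hγψ y hy) (hθ hx) ((hγ.2 y hy).2.trans hxy.symm)]
  · obtain ⟨w, hw⟩ := hΓne
    obtain ⟨γ, hγ1, hγ2, rfl⟩ := hΓexp.subset hw
    have hγσ : ∀ ψ ∈ σ, ∀ y ∈ π '' Q, γ y ∈ sectionImage π Q ψ := by
      intro ψ hψ
      obtain ⟨φ, hφ⟩ := exists_extension ψ
      rw [hσΓ, mem_normalConeKer_iff hQ hφ hΓexp.subset] at hψ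
      exact mem_sectionImage_of_le_integral hQ hint hπ hφ ⟨hγ1, hγ2⟩ (hψ _ hw)
    refine ⟨γ, ⟨hγ1, hγ2⟩, hγσ, fun ψ hψ => Subset.antisymm (fun x hx => ?_) ?_⟩
    · have hy : π x ∈ π '' Q := ⟨x, hx.1, rfl⟩
      have hkmem : γ (π x) - x ∈ LinearMap.ker π := by
        rw [LinearMap.mem_ker, map_sub, (hγ2 _ hy).2, sub_self]
      let k : LinearMap.ker π := ⟨γ (π x) - x, hkmem⟩
      have hk1 : x + (k : EuclideanSpace ℝ (Fin n)) = γ (π x) := add_sub_cancel _ _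
      have hk2 : γ (π x) + ((-k : LinearMap.ker π) : EuclideanSpace ℝ (Fin n)) = x := by
        simp [k]
      have h1 : ψ k ≤ 0 := hx.2 k (by rw [hk1]; exact (hγ2 _ hy).1)
      have h2 : ∀ θ ∈ σ, 0 ≤ θ k := by
        intro θ hθ
        have := (hγσ θ hθ _ hy).2 (-k) (by rw [hk2]; exact hx.1)
        rw [map_neg] at this
        linarith
      -- `k` leads from `x` to the common section. It is non-negative under all of `σ` and
      -- non-positive under the interior functional `ψ`; if it were non-zero, a small change of `ψ`
      -- within `σ` would make it negative.
      have hk0 : k = 0 := by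
        by_contra hk0
        obtain ⟨θ, hθ⟩ : ∃ θ : StrongDual ℝ (LinearMap.ker π), 0 < θ k := by
          obtain ⟨θ, hθ⟩ := SeparatingDual.exists_ne_zero (R := ℝ) hk0
          rcases lt_or_gt_of_ne hθ with h | h
          · exact ⟨-θ, by simpa using h⟩
          · exact ⟨θ, h⟩
        have hc : Tendsto (fun t : ℝ => ψ - t • θ) (𝓝[>] 0) (𝓝 ψ) := by
          have : Continuous fun t : ℝ => ψ - t • θ := by fun_prop
          have := this.tendsto 0
          simp only [zero_smul, sub_zero] at this
          exact this.mono_left nhdsWithin_le_nhds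
        obtain ⟨t, ht, ht0⟩ := ((hc.eventually_mem (mem_interior_iff_mem_nhds.1 hψ)).and
          self_mem_nhdsWithin).exists
        have h3 := h2 _ ht
        have h4 : (ψ - t • θ) k = ψ k - t * θ k := rfl
        have h5 : 0 < t * θ k := mul_pos ht0 hθ
        linarith
      refine ⟨π x, hy, ?_⟩
      rw [← hk1, hk0]
      simp
    · rintro _ ⟨y, hy, rfl⟩
      exact hγσ ψ (interior_subset hψ) y hy

end Sections

/-! ### Faces and their affine spans -/

section FaceSpans

variable {E E' : Type*} [NormedAddCommGroup E] [NormedSpace ℝ E] [FiniteDimensional ℝ E]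
  [NormedAddCommGroup E'] [NormedSpace ℝ E'] [FiniteDimensional ℝ E'] {Q S T : Set E}

theorem facetsThrough_finite (hQ : IsPolytope Q) (S : Set E) : (facetsThrough Q S).Finite :=
  hQ.finite_facets.subset fun _ h => h.1

theorem eq_setOf_facetsThrough (hQ : IsPolytope Q) (hint : (interior Q).Nonempty)
    (hS : IsExposed ℝ Q S) (hne : S.Nonempty) :
    S = {x ∈ Q | ∀ G ∈ facetsThrough Q S, facetEq Q G x = 0} := by
  ext x
  refine ⟨fun hx => ⟨hS.subset hx, fun G hG => (mem_facet_iff hG.1 (hS.subset hx)).1 (hG.2 hx)⟩,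
    fun hx => mem_of_forall_facets hQ hint hS hne hx.1 fun G hG hSG =>
      (mem_facet_iff hG hx.1).2 (hx.2 G ⟨hG, hSG⟩)⟩

/-- Near suitable points of a face, a polytope is cut out by the facets through the face. -/
theorem exists_eventually_mem (hQ : IsPolytope Q) (hint : (interior Q).Nonempty)
    (hS : IsExposed ℝ Q S) (hne : S.Nonempty) :
    ∃ p ∈ S, ∀ᶠ x in 𝓝 p, (∀ G ∈ facetsThrough Q S, 0 ≤ facetEq Q G x) → x ∈ Q := by
  obtain ⟨p, hp, hpG⟩ := exists_relint_point hQ hS hne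
  refine ⟨p, hp, ?_⟩
  filter_upwards [eventually_mem_of_facets hQ hint (hS.subset hp)] with x hx h
  exact hx fun G hG hpG' => h G ⟨hG, hpG G hG hpG'⟩

theorem exists_pos_add_smul {p : E → Prop} {x : E} (h : ∀ᶠ z in 𝓝 x, p z) (v : E) :
    ∃ t : ℝ, 0 < t ∧ p (x + t • v) := by
  have hc : Tendsto (fun t : ℝ => x + t • v) (𝓝[>] 0) (𝓝 x) := by
    have : Continuous fun t : ℝ => x + t • v := by fun_prop
    have := this.tendsto 0
    simp only [zero_smul, add_zero] at this
    exact this.mono_left nhdsWithin_le_nhds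
  obtain ⟨t, ht, ht0⟩ := ((hc.eventually h).and self_mem_nhdsWithin).exists
  exact ⟨t, ht0, ht⟩

theorem affine_add_smul (ℓ : E →ᵃ[ℝ] ℝ) (x v : E) (t : ℝ) :
    ℓ (x + t • v) = ℓ x + t * ℓ.linear v := by
  have := ℓ.map_vadd x (t • v)
  rw [vadd_eq_add, add_comm] at this
  rw [this, map_smul, vadd_eq_add, smul_eq_mul, add_comm]

/-- Start at a point of the face that lies on no further facets: there, moving along the common
kernel of the active equations stays in `Q`, and in the face. -/
theorem exists_add_smul_mem_face (hQ : IsPolytope Q) (hint : (interior Q).Nonempty)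
    (hS : IsExposed ℝ Q S) (hne : S.Nonempty) {v : E}
    (hv : ∀ G ∈ facetsThrough Q S, (facetEq Q G).linear v = 0) :
    ∃ p ∈ S, ∃ t : ℝ, 0 < t ∧ p + t • v ∈ S := by
  obtain ⟨p, hp, hloc⟩ := exists_eventually_mem hQ hint hS hne
  obtain ⟨t, ht, h⟩ := exists_pos_add_smul hloc v
  have h0 : ∀ G ∈ facetsThrough Q S, facetEq Q G (p + t • v) = 0 := fun G hG => by
    rw [affine_add_smul, hv G hG, (mem_facet_iff hG.1 (hS.subset hp)).1 (hG.2 hp)]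
    simp
  refine ⟨p, hp, t, ht, ?_⟩
  rw [eq_setOf_facetsThrough hQ hint hS hne]
  exact ⟨h fun G hG => (h0 G hG).ge, h0⟩

theorem mem_vectorSpan_face (hQ : IsPolytope Q) (hint : (interior Q).Nonempty)
    (hS : IsExposed ℝ Q S) (hne : S.Nonempty) (v : E) :
    v ∈ vectorSpan ℝ S ↔ ∀ G ∈ facetsThrough Q S, (facetEq Q G).linear v = 0 := by
  constructor
  · intro hv G hG
    exact vectorSpan_le_ker (fun x hx => (mem_facet_iff hG.1 (hS.subset hx)).1 (hG.2 hx)) hv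
  · intro hv
    obtain ⟨p, hp, t, ht, h⟩ := exists_add_smul_mem_face hQ hint hS hne hv
    have := vsub_mem_vectorSpan ℝ h hp
    rw [vsub_eq_sub, add_sub_cancel_left] at this
    exact (Submodule.smul_mem_iff _ ht.ne').1 this

theorem mem_affineSpan_face (hQ : IsPolytope Q) (hint : (interior Q).Nonempty)
    (hS : IsExposed ℝ Q S) (hne : S.Nonempty) (x : E) :
    x ∈ affineSpan ℝ S ↔ ∀ G ∈ facetsThrough Q S, facetEq Q G x = 0 := by
  obtain ⟨p, hp⟩ := hne
  rw [mem_affineSpan_iff_vectorSpan hp, mem_vectorSpan_face hQ hint hS ⟨p, hp⟩]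
  refine forall₂_congr fun G hG => ?_
  rw [← vsub_eq_sub, AffineMap.linearMap_vsub, (mem_facet_iff hG.1 (hS.subset hp)).1 (hG.2 hp)]
  simp

/-- A linear map which is injective on a face is injective on its direction. -/
theorem eq_zero_of_injOn_face (hQ : IsPolytope Q) (hint : (interior Q).Nonempty)
    (hS : IsExposed ℝ Q S) (hne : S.Nonempty) {f : E →ₗ[ℝ] E'} (hf : InjOn f S) {v : E}
    (hv : v ∈ vectorSpan ℝ S) (h0 : f v = 0) : v = 0 := by
  obtain ⟨p, hp, t, ht, h⟩ := exists_add_smul_mem_face hQ hint hS hne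
    ((mem_vectorSpan_face hQ hint hS hne v).1 hv)
  have := hf h hp (by rw [map_add, map_smul, h0, smul_zero, add_zero])
  rw [add_eq_left] at this
  exact (smul_eq_zero.1 this).resolve_left ht.ne'

theorem vectorSpan_image_linear (f : E →ₗ[ℝ] E') (S : Set E) :
    vectorSpan ℝ (f '' S) = (vectorSpan ℝ S).map f :=
  (f.toAffineMap.map_vectorSpan (s := S)).symm

theorem finrank_vectorSpan_image_face (hQ : IsPolytope Q) (hint : (interior Q).Nonempty)
    (hS : IsExposed ℝ Q S) (hne : S.Nonempty) {f : E →ₗ[ℝ] E'} (hf : InjOn f S) :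
    Module.finrank ℝ (vectorSpan ℝ (f '' S)) = Module.finrank ℝ (vectorSpan ℝ S) := by
  have hinj : Function.Injective (f.domRestrict (vectorSpan ℝ S)) := by
    rw [← LinearMap.ker_eq_bot, LinearMap.ker_eq_bot']
    rintro ⟨v, hv⟩ h
    exact Subtype.ext (eq_zero_of_injOn_face hQ hint hS hne hf hv h)
  rw [vectorSpan_image_linear, ← LinearMap.range_domRestrict]
  exact LinearMap.finrank_range_of_inj hinj

theorem affineSpan_eq_top_iff_finrank (hne : S.Nonempty) :
    affineSpan ℝ S = ⊤ ↔ Module.finrank ℝ (vectorSpan ℝ S) = Module.finrank ℝ E := by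
  rw [← AffineSubspace.direction_eq_top_iff_of_nonempty ((affineSpan_nonempty ℝ).2 hne),
    direction_affineSpan]
  exact ⟨fun h => by rw [h, finrank_top], Submodule.eq_top_of_finrank_eq⟩

theorem isExposed_inter_left {T : Set E} (hST : (S ∩ T).Nonempty → IsExposed ℝ Q T)
    (hS : S ⊆ Q) : IsExposed ℝ S (S ∩ T) := by
  intro hne
  obtain ⟨l, hl⟩ := hST hne (hne.mono inter_subset_right)
  obtain ⟨p, hpS, hpT⟩ := hne
  refine ⟨l, ?_⟩
  ext x
  constructor
  · rintro ⟨hxS, hxT⟩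
    rw [hl] at hxT
    exact ⟨hxS, fun y hy => hxT.2 y (hS hy)⟩
  · rintro ⟨hxS, h⟩
    refine ⟨hxS, ?_⟩
    rw [hl] at hpT ⊢
    exact ⟨hS hxS, fun y hy => (hpT.2 y hy).trans (h p hpS)⟩

/-- A linear map which is injective on a polytope, in all directions, maps faces to faces. -/
theorem isExposed_image_linear (hT : IsExposed ℝ S T) (f : E →ₗ[ℝ] E')
    (hf : ∀ v ∈ vectorSpan ℝ S, f v = 0 → v = 0) : IsExposed ℝ (f '' S) (f '' T) := by
  intro hne
  obtain ⟨l, hl⟩ := hT hne.of_image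
  have hinj : LinearMap.ker (f.domRestrict (vectorSpan ℝ S)) = ⊥ := by
    rw [LinearMap.ker_eq_bot']
    rintro ⟨v, hv⟩ h
    exact Subtype.ext (hf v hv h)
  -- A left inverse of `f` on the direction of `S` transports the exposing functional; only
  -- differences of points of `S` matter.
  obtain ⟨ρ, hρ⟩ := LinearMap.exists_leftInverse_of_injective _ hinj
  have hρ' : ∀ x ∈ S, ∀ z ∈ S, ((ρ (f (x - z)) : vectorSpan ℝ S) : E) = x - z := by
    intro x hx z hz
    have := LinearMap.congr_fun hρ ⟨x - z, vsub_mem_vectorSpan ℝ hx hz⟩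
    exact congrArg Subtype.val this
  let l' : StrongDual ℝ E' := LinearMap.toContinuousLinearMap
    ((l : E →ₗ[ℝ] ℝ) ∘ₗ (vectorSpan ℝ S).subtype ∘ₗ ρ)
  have hl' : ∀ x ∈ S, ∀ z ∈ S, l' (f x) - l' (f z) = l x - l z := by
    intro x hx z hz
    rw [← map_sub, ← map_sub, ← map_sub]
    exact congrArg l (hρ' x hx z hz)
  refine ⟨l', ?_⟩
  ext y
  constructor
  · rintro ⟨x, hx, rfl⟩
    rw [hl] at hx
    refine ⟨⟨x, hx.1, rfl⟩, ?_⟩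
    rintro _ ⟨z, hz, rfl⟩
    have := hl' x hx.1 z hz
    have := hx.2 z hz
    linarith
  · rintro ⟨⟨x, hx, rfl⟩, h⟩
    refine ⟨x, ?_, rfl⟩
    rw [hl]
    refine ⟨hx, fun z hz => ?_⟩
    have := hl' x hx z hz
    have := h _ ⟨z, hz, rfl⟩
    linarith

/-- Equal dimensions give equal directions, so the equation that cuts out `S` vanishes on all of
`T`. -/
theorem eq_of_isExposed_of_subset (hS : IsExposed ℝ Q S) (hne : S.Nonempty)
    (hT : T ⊆ Q) (hST : S ⊆ T)
    (h : Module.finrank ℝ (vectorSpan ℝ S) = Module.finrank ℝ (vectorSpan ℝ T)) : S = T := by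
  refine hST.antisymm fun x hx => ?_
  obtain ⟨ℓ, hℓ⟩ := exists_isFacetEquation_of_isExposed hS hne
  obtain ⟨p, hp⟩ := hne
  have hspan := Submodule.eq_of_le_of_finrank_eq (vectorSpan_mono ℝ hST) h
  have hker := vectorSpan_le_ker (S := S) (ℓ := ℓ) fun z hz => by rw [hℓ.2] at hz; exact hz.2
  have hx' := hker (hspan ▸ vsub_mem_vectorSpan ℝ hx (hST hp))
  rw [LinearMap.mem_ker, AffineMap.linearMap_vsub] at hx'
  rw [hℓ.2] at hp ⊢
  rw [hp.2] at hx'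
  exact ⟨hT hx, by simpa using hx'⟩

end FaceSpans

/-! ### The coherent subdivision defined by a fiberwise injective functional. -/

section Subdivision

variable {n m : ℕ} {π : EuclideanSpace ℝ (Fin n) →ₗ[ℝ] EuclideanSpace ℝ (Fin m)}
  {Q : Set (EuclideanSpace ℝ (Fin n))} {ψ : StrongDual ℝ (LinearMap.ker π)}

theorem injOn_image_subdivisionFaces (hinj : InjOn π (sectionImage π Q ψ)) :
    InjOn (fun S => π '' S) (subdivisionFaces π Q ψ m) := fun _ hS _ hT h =>
  (hinj.image_eq_image_iff hS.2 hT.2).1 h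

theorem interior_image_face_nonempty (hQ : IsPolytope Q) (hint : (interior Q).Nonempty)
    {S : Set (EuclideanSpace ℝ (Fin n))} (hS : S ∈ faces Q m) (hf : InjOn π S) :
    (interior (π '' S)).Nonempty := by
  have hpoly := (hQ.of_isExposed hS.2.1).image π.toAffineMap
  have : affineSpan ℝ (π '' S) = ⊤ := by
    rw [affineSpan_eq_top_iff_finrank (hS.1.image _),
      finrank_vectorSpan_image_face hQ hint hS.2.1 hS.1 hf, hS.2.2, finrank_euclideanSpace_fin]
  exact (hpoly.convex.interior_nonempty_iff_affineSpan_eq_top).2 this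

/-- A generic interior point of `π '' Q` is in the image of no face whose image is
lower-dimensional. The minimal face of its lift to the section image then has dimension `m`. The
union is closed, so it contains the remaining points as well. -/
theorem subset_sUnion_image (hQ : IsPolytope Q) (hint : (interior Q).Nonempty)
    (hπ : Function.Surjective π) (hinj : InjOn π (sectionImage π Q ψ)) :
    π '' Q ⊆ ⋃₀ ((fun S => π '' S) '' subdivisionFaces π Q ψ m) := by
  set K := ⋃₀ ((fun S => π '' S) '' subdivisionFaces π Q ψ m) with hK
  have hfin : (subdivisionFaces π Q ψ m).Finite := (hQ.finite_faces m).subset fun _ h => h.1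
  have hKc : IsClosed K := by
    rw [hK, sUnion_image]
    exact hfin.isClosed_biUnion fun S hS =>
      ((hQ.of_isExposed hS.1.2.1).image π.toAffineMap).isClosed
  have hgen : ∀ᶠ y in generic (EuclideanSpace ℝ (Fin m)), ∀ T ∈ {T | IsExposed ℝ Q T},
      affineSpan ℝ (π '' T) ≠ ⊤ → y ∉ affineSpan ℝ (π '' T) :=
    (eventually_all_finite hQ.finite_isExposed).2 fun T _ => by
      by_cases h : affineSpan ℝ (π '' T) = ⊤
      · simp [h]
      · filter_upwards [eventually_generic_notMem _ h] with q hq _ using hq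
  have hPK : interior (π '' Q) ⊆ K := by
    intro y hy
    by_contra hyK
    obtain ⟨z, ⟨hz, hzK⟩, hzT⟩ := exists_generic_mem hgen
      (isOpen_interior.inter hKc.isOpen_compl) ⟨y, hy, hyK⟩
    obtain ⟨x, hx, rfl⟩ := exists_mem_sectionImage hQ ψ (interior_subset hz)
    have hTψ := minFace_subset_sectionImage hQ hint hx
    have hTe := isExposed_minFace hQ x
    have hxT := mem_minFace hx.1
    have htop : affineSpan ℝ (π '' minFace Q x) = ⊤ := by
      by_contra h
      exact hzT _ hTe h (subset_affineSpan ℝ _ ⟨x, hxT, rfl⟩)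
    rw [affineSpan_eq_top_iff_finrank (Set.Nonempty.image _ ⟨x, hxT⟩),
      finrank_vectorSpan_image_face hQ hint hTe ⟨x, hxT⟩ (hinj.mono hTψ),
      finrank_euclideanSpace_fin] at htop
    exact hzK ⟨_, ⟨minFace Q x, ⟨⟨⟨x, hxT⟩, hTe, htop⟩, hTψ⟩, rfl⟩, x, hxT, rfl⟩
  have hcl : closure (interior (π '' Q)) = π '' Q := by
    rw [(isPolytope_image hQ).convex.closure_interior_eq_closure_of_nonempty_interior
      (interior_image_nonempty hπ hint), (isPolytope_image hQ).isClosed.closure_eq]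
  rw [← hcl]
  exact closure_minimal hPK hKc

/-- Injectivity on the section image gives `π S ∩ π T = π (S ∩ T)`, and `π` carries the face `S ∩ T`
of `S` to a face of the image. -/
theorem isExposed_image_inter (hQ : IsPolytope Q) (hint : (interior Q).Nonempty)
    (hinj : InjOn π (sectionImage π Q ψ)) {S T : Set (EuclideanSpace ℝ (Fin n))}
    (hS : S ∈ subdivisionFaces π Q ψ m) (hT : T ∈ subdivisionFaces π Q ψ m) :
    IsExposed ℝ (π '' S) (π '' S ∩ π '' T) := by
  rw [← hinj.image_inter hS.2 hT.2]
  exact isExposed_image_linear (isExposed_inter_left (fun _ => hT.1.2.1) hS.1.2.1.subset) π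
    fun v hv h => eq_zero_of_injOn_face hQ hint hS.1.2.1 hS.1.1 (hinj.mono hS.2) hv h

theorem image_inter_ne (hinj : InjOn π (sectionImage π Q ψ))
    {S T : Set (EuclideanSpace ℝ (Fin n))}
    (hS : S ∈ subdivisionFaces π Q ψ m) (hT : T ∈ subdivisionFaces π Q ψ m)
    (hne : π '' S ≠ π '' T) : π '' S ∩ π '' T ≠ π '' S := by
  intro h
  rw [inter_eq_left, hinj.image_subset_image_iff hS.2 hT.2] at h
  exact hne (congrArg _ (eq_of_isExposed_of_subset hS.1.2.1 hS.1.1 hT.1.2.1.subset h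
    (hS.1.2.2.trans hT.1.2.2.symm)))

/-- The coherent subdivision of `π '' Q` defined by a functional which is maximal at a single point
of each fiber. -/
theorem isSubdivision_image_subdivisionFaces (hQ : IsPolytope Q) (hint : (interior Q).Nonempty)
    (hπ : Function.Surjective π) (hinj : InjOn π (sectionImage π Q ψ)) :
    IsSubdivision (π '' Q) ((fun S => π '' S) '' subdivisionFaces π Q ψ m) := by
  refine ⟨((hQ.finite_faces m).subset fun _ h => h.1).image _, ?_,
    Subset.antisymm ?_ (subset_sUnion_image hQ hint hπ hinj), ?_⟩
  · rintro _ ⟨S, hS, rfl⟩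
    exact ⟨(hQ.of_isExposed hS.1.2.1).image π.toAffineMap,
      interior_image_face_nonempty hQ hint hS.1 (hinj.mono hS.2)⟩
  · refine sUnion_subset ?_
    rintro _ ⟨S, hS, rfl⟩
    exact image_mono hS.1.2.1.subset
  · rintro _ ⟨S, hS, rfl⟩ _ ⟨T, hT, rfl⟩ hne
    refine ⟨isExposed_image_inter hQ hint hinj hS hT, ?_, image_inter_ne hinj hS hT hne, ?_⟩
    · rw [inter_comm]
      exact isExposed_image_inter hQ hint hinj hT hS
    · rw [inter_comm]
      exact image_inter_ne hinj hT hS hne.symm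

end Subdivision

/-! ### Faces on which the projection is injective -/

section Transversal

variable {r m : ℕ} {π : EuclideanSpace ℝ (Fin (r + m)) →ₗ[ℝ] EuclideanSpace ℝ (Fin m)}
  {Q S : Set (EuclideanSpace ℝ (Fin (r + m)))}

/-- The facet equations through `S` cut out the direction of `S`, where `π` is injective. Simplicity
enters through `e`: there are exactly `r` equations, so injectivity implies bijectivity. -/
theorem bijective_linear_facetEq (hQ : IsPolytope Q) (hint : (interior Q).Nonempty)
    (hS : S ∈ faces Q m) (hf : InjOn π S) (e : Fin r ≃ facetsThrough Q S) :
    Function.Bijective fun v =>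
      ((fun i => (facetEq Q (e i)).linear v, π v) : (Fin r → ℝ) × EuclideanSpace ℝ (Fin m)) := by
  let L : EuclideanSpace ℝ (Fin (r + m)) →ₗ[ℝ] (Fin r → ℝ) × EuclideanSpace ℝ (Fin m) :=
    (LinearMap.pi fun i => (facetEq Q (e i)).linear).prod π
  have hinj : Function.Injective L := by
    rw [← LinearMap.ker_eq_bot, LinearMap.ker_eq_bot']
    intro v hv
    have h1 := congrArg Prod.fst hv
    refine eq_zero_of_injOn_face hQ hint hS.2.1 hS.1 hf
      ((mem_vectorSpan_face hQ hint hS.2.1 hS.1 v).2 fun G hG => ?_) (congrArg Prod.snd hv)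
    have h2 := congrFun h1 (e.symm ⟨G, hG⟩)
    simpa [L] using h2
  refine ⟨hinj, ?_⟩
  refine (LinearMap.injective_iff_surjective_of_finrank_eq_finrank ?_).1 hinj
  rw [Module.finrank_prod, finrank_euclideanSpace_fin, finrank_euclideanSpace_fin,
    Module.finrank_fin_fun]

/-- The equations of the facets through `S` and the projection form a system of coordinates. -/
theorem bijective_facetEq (hQ : IsPolytope Q) (hint : (interior Q).Nonempty)
    (hS : S ∈ faces Q m) (hf : InjOn π S) (e : Fin r ≃ facetsThrough Q S) :
    Function.Bijective fun x =>
      ((fun i => facetEq Q (e i) x, π x) : (Fin r → ℝ) × EuclideanSpace ℝ (Fin m)) := by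
  have h := bijective_linear_facetEq hQ hint hS hf e
  have hdec : ∀ (ℓ : EuclideanSpace ℝ (Fin (r + m)) →ᵃ[ℝ] ℝ) x, ℓ x = ℓ.linear x + ℓ 0 :=
    fun ℓ x => by simpa using ℓ.map_vadd 0 x
  have : (fun x => ((fun i => facetEq Q (e i) x, π x) :
      (Fin r → ℝ) × EuclideanSpace ℝ (Fin m))) =
      (Equiv.addRight ((fun i => facetEq Q (e i) 0, 0) :
        (Fin r → ℝ) × EuclideanSpace ℝ (Fin m))) ∘ fun v =>
        ((fun i => (facetEq Q (e i)).linear v, π v) :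
          (Fin r → ℝ) × EuclideanSpace ℝ (Fin m)) := by
    ext1 x
    refine Prod.ext (funext fun i => ?_) ?_
    · exact hdec _ x
    · simp
  rw [this]
  exact (Equiv.bijective _).comp h

theorem exists_equiv_facetsThrough (hQ : IsPolytope Q) (hcard : (facetsThrough Q S).ncard = r) :
    Nonempty (Fin r ≃ facetsThrough Q S) := by
  have := (facetsThrough_finite hQ S).to_subtype
  exact ⟨(Finite.equivFinOfCardEq hcard).symm⟩

theorem existsUnique_mem_affineSpan (hQ : IsPolytope Q) (hint : (interior Q).Nonempty)
    (hS : S ∈ faces Q m) (hf : InjOn π S) (e : Fin r ≃ facetsThrough Q S)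
    (y : EuclideanSpace ℝ (Fin m)) : ∃! q, q ∈ affineSpan ℝ S ∧ π q = y := by
  have h := (bijective_facetEq hQ hint hS hf e).existsUnique (0, y)
  refine (existsUnique_congr fun q => ?_).1 h
  rw [mem_affineSpan_face hQ hint hS.2.1 hS.1, Prod.ext_iff]
  refine and_congr_left fun _ => ⟨fun h G hG => ?_, fun h => funext fun i => h _ (e i).2⟩
  simpa using congrFun h (e.symm ⟨G, hG⟩)

/-- Each generator of the shadow is maximal along a facet containing `S`, and maximality along `S`
is preserved by non-negative combinations. -/
theorem subset_sectionImage_of_mem_shadow (hS : S ⊆ Q) {ψ : StrongDual ℝ (LinearMap.ker π)}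
    (hψ : ψ ∈ shadow π Q S) : S ⊆ sectionImage π Q ψ := by
  intro x hx
  refine ⟨hS hx, fun k hk => ?_⟩
  rw [shadow, SetLike.mem_coe] at hψ
  induction hψ using Submodule.span_induction with
  | mem ψ h =>
    obtain ⟨G, hG, φ, hφ, rfl⟩ := h
    have hxG := hG.2 hx
    rw [show G = φ.toExposed Q from hφ] at hxG
    have := hxG.2 _ hk
    rw [map_add] at this
    change φ (k : EuclideanSpace ℝ (Fin (r + m))) ≤ 0
    linarith
  | zero => exact le_rfl
  | add ψ₁ ψ₂ _ _ h₁ h₂ => exact add_nonpos h₁ h₂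
  | smul c ψ _ h => exact mul_nonpos_of_nonneg_of_nonpos c.2 h

/-- Let `b i` be the basis of the kernel dual to the facet equations. From a suitable point of `S`,
a short move along `b i` stays in `Q`, so maximality gives `ψ (b i) ≤ 0`. The numbers `-ψ (b i)` are
the coefficients of `ψ` with respect to the outward normals. -/
theorem mem_shadow_of_subset_sectionImage (hQ : IsPolytope Q) (hint : (interior Q).Nonempty)
    (hS : S ∈ faces Q m) (hf : InjOn π S) (e : Fin r ≃ facetsThrough Q S)
    {ψ : StrongDual ℝ (LinearMap.ker π)} (hψ : S ⊆ sectionImage π Q ψ) : ψ ∈ shadow π Q S := by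
  obtain ⟨hinj, hsurj⟩ := bijective_linear_facetEq hQ hint hS hf e
  choose b hb using fun i : Fin r => hsurj (Pi.single i 1, 0)
  have hb1 : ∀ i j, (facetEq Q (e j)).linear (b i) = if j = i then 1 else 0 := fun i j => by
    have := congrFun (congrArg Prod.fst (hb i)) j
    simpa [Pi.single_apply] using this
  have hb2 : ∀ i, b i ∈ LinearMap.ker π := fun i => congrArg Prod.snd (hb i)
  have hneg : ∀ i, ψ ⟨b i, hb2 i⟩ ≤ 0 := by
    intro i
    obtain ⟨p, hp, hloc⟩ := exists_eventually_mem hQ hint hS.2.1 hS.1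
    obtain ⟨t, ht, h⟩ := exists_pos_add_smul hloc (b i)
    have hmem : p + t • b i ∈ Q := h fun G hG => by
      have h1 := hb1 i (e.symm ⟨G, hG⟩)
      rw [Equiv.apply_symm_apply] at h1
      rw [affine_add_smul, (mem_facet_iff hG.1 (hS.2.1.subset hp)).1 (hG.2 hp), h1]
      split_ifs <;> simp [ht.le]
    have := (hψ hp).2 (t • ⟨b i, hb2 i⟩) hmem
    rw [map_smul, smul_eq_mul] at this
    exact nonpos_of_mul_nonpos_right this ht
  have hsum : ψ = ∑ i, (⟨-ψ ⟨b i, hb2 i⟩, by simpa using hneg i⟩ : NNReal) •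
      (-(LinearMap.toContinuousLinearMap (facetEq Q (e i)).linear)).comp
        (LinearMap.ker π).subtypeL := by
    ext k
    have hk : k = ∑ i, (facetEq Q (e i)).linear k • (⟨b i, hb2 i⟩ : LinearMap.ker π) := by
      apply Subtype.ext
      apply hinj
      refine Prod.ext (funext fun j => ?_) ?_
      · simp [hb1]
      · simp [LinearMap.mem_ker.1 (hb2 _)]
    conv_lhs => rw [hk]
    rw [map_sum, sum_apply]
    refine Finset.sum_congr rfl fun i _ => ?_
    rw [map_smul]
    change _ = (-ψ ⟨b i, hb2 i⟩) * (-(facetEq Q (e i)).linear k)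
    rw [smul_eq_mul]
    ring
  rw [hsum]
  refine Submodule.sum_mem _ fun i _ => Submodule.smul_mem _ _ (Submodule.subset_span ?_)
  exact ⟨e i, (e i).2, _, (isFacetEquation_facetEq (e i).2.1).neg_linear_mem_outwardNormals
    (e i).2.1.1, rfl⟩

/-- The maximal-dimensional faces of the coherent subdivision of a maximal cone of the fiber fan are
the faces whose shadow contains the cone. -/
theorem subdivisionFaces_eq_coneFaces (hQ : IsPolytope Q) (hint : (interior Q).Nonempty)
    (hsimple : IsSimpleInDim Q m r) {σ : Set (StrongDual ℝ (LinearMap.ker π))}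
    {γ : EuclideanSpace ℝ (Fin m) → EuclideanSpace ℝ (Fin (r + m))}
    (hγ : ∀ ψ ∈ σ, ∀ y ∈ π '' Q, γ y ∈ sectionImage π Q ψ)
    {ψ : StrongDual ℝ (LinearMap.ker π)} (hψ : ψ ∈ interior σ)
    (hψγ : sectionImage π Q ψ = γ '' (π '' Q)) (hinj : InjOn π (sectionImage π Q ψ)) :
    subdivisionFaces π Q ψ m = coneFaces π Q σ := by
  ext S
  constructor
  · rintro ⟨hS, hSψ⟩
    obtain ⟨e⟩ := exists_equiv_facetsThrough hQ (hsimple S hS)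
    refine ⟨hS, fun θ hθ => mem_shadow_of_subset_sectionImage hQ hint hS (hinj.mono hSψ) e ?_⟩
    intro x hx
    have := hSψ hx
    rw [hψγ] at this
    obtain ⟨y, hy, rfl⟩ := this
    exact hγ θ hθ y hy
  · rintro ⟨hS, hσ⟩
    exact ⟨hS, subset_sectionImage_of_mem_shadow hS.2.1.subset (hσ (interior_subset hψ))⟩

theorem IsFiberSection.injOn_sectionImage {γ : EuclideanSpace ℝ (Fin m) →
    EuclideanSpace ℝ (Fin (r + m))} (hγ : IsFiberSection π Q γ)
    {ψ : StrongDual ℝ (LinearMap.ker π)} (hψγ : sectionImage π Q ψ = γ '' (π '' Q)) :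
    InjOn π (sectionImage π Q ψ) := by
  rw [hψγ]
  rintro _ ⟨y, hy, rfl⟩ _ ⟨z, hz, rfl⟩ h
  rw [(hγ.2 y hy).2, (hγ.2 z hz).2] at h
  rw [h]

end Transversal

/-! ### The fiber volume form near a face -/

section Wedge

/-- In the sum over shuffles only the trivial coset contributes, since the vectors `v` are killed by
`f`. -/
theorem wedge_comp_apply {E E' : Type*} [AddCommGroup E] [Module ℝ E] [AddCommGroup E']
    [Module ℝ E'] {r m : ℕ} (a : E [⋀^Fin r]→ₗ[ℝ] ℝ) (b : E' [⋀^Fin m]→ₗ[ℝ] ℝ) (f : E →ₗ[ℝ] E')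
    (v : Fin r → E) (w : Fin m → E) (hv : ∀ j, f (v j) = 0) :
    wedge a (b.compLinearMap f) (Sum.elim v w ∘ finSumFinEquiv.symm) = a v * b (f ∘ w) := by
  have h0 : (Sum.elim v w ∘ finSumFinEquiv.symm) ∘ finSumFinEquiv = Sum.elim v w := by
    ext x; simp
  have h1 : wedge a (b.compLinearMap f) (Sum.elim v w ∘ finSumFinEquiv.symm) =
      LinearMap.mul' ℝ ℝ (a.domCoprod (b.compLinearMap f) (Sum.elim v w)) := by
    conv_rhs => rw [← h0]
    rfl
  have h2 : a.domCoprod (b.compLinearMap f) (Sum.elim v w) =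
      ∑ σ : Equiv.Perm.ModSumCongr (Fin r) (Fin m),
        AlternatingMap.domCoprod.summand a (b.compLinearMap f) σ (Sum.elim v w) := by
    rw [← sum_apply, ← AlternatingMap.domCoprod_coe]
    rfl
  rw [h1, h2]
  refine (congrArg _ (Finset.sum_eq_single
    (Quotient.mk'' 1 : Equiv.Perm.ModSumCongr (Fin r) (Fin m)) ?_ ?_)).trans ?_
  rotate_left 2
  · rw [AlternatingMap.domCoprod.summand_mk'']
    simp only [Equiv.Perm.sign_one, one_smul, MultilinearMap.domDomCongr_apply,
      MultilinearMap.domCoprod_apply, LinearMap.mul'_apply]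
    rfl
  · intro σ
    induction σ using Quotient.inductionOn' with | _ σ
    intro _ hσ
    -- A permutation preserving the right block is in the trivial coset. Any other one feeds some `v
    -- i` to the pulled-back form, which then vanishes.
    have hmaps : ¬ MapsTo σ (range Sum.inr) (range Sum.inr) := by
      intro h
      have h' := Equiv.Perm.mem_sumCongrHom_range_of_perm_mapsTo_inl
        ((Equiv.Perm.perm_mapsTo_inl_iff_mapsTo_inr σ).2 h)
      refine hσ (Quotient.sound' ?_)
      rw [QuotientGroup.leftRel_apply, mul_one]
      exact inv_mem h'
    simp only [MapsTo, mem_range, forall_exists_index, forall_apply_eq_imp_iff, not_forall] at hmaps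
    obtain ⟨j, hj⟩ := hmaps
    have hj' : ∃ i, σ (Sum.inr j) = Sum.inl i := by
      rcases h : σ (Sum.inr j) with i | k
      · exact ⟨i, rfl⟩
      · exact (hj ⟨k, h.symm⟩).elim
    obtain ⟨i, hi⟩ := hj'
    rw [AlternatingMap.domCoprod.summand_mk'']
    have hb : b (fun k => f (Sum.elim v w (σ (Sum.inr k)))) = 0 :=
      b.map_coord_zero j (by rw [hi]; exact hv i)
    change Equiv.Perm.sign σ • (a (fun k => Sum.elim v w (σ (Sum.inl k))) ⊗ₜ[ℝ]
      b (fun k => f (Sum.elim v w (σ (Sum.inr k))))) = 0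
    rw [hb, TensorProduct.tmul_zero, smul_zero]
  · simp

/-- The alternating map obtained by fixing the last arguments. -/
def fixRight {E ι ι' : Type*} [AddCommGroup E] [Module ℝ E] (g : E [⋀^ι ⊕ ι']→ₗ[ℝ] ℝ)
    (w : ι' → E) : E [⋀^ι]→ₗ[ℝ] ℝ where
  toFun v := g (Sum.elim v w)
  map_update_add' v i x y := by
    classical
    simp only [← Sum.update_elim_inl]
    exact g.map_update_add _ _ _ _
  map_update_smul' v i c x := by
    classical
    simp only [← Sum.update_elim_inl]
    exact g.map_update_smul _ _ _ _
  map_eq_zero_of_eq' v i j h hij := g.map_eq_zero_of_eq _ (i := Sum.inl i) (j := Sum.inl j)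
    (by simpa using h) (by simpa using hij)

end Wedge

/-! ### Residues of the fiber volume form at a face. -/

section FaceResidues

variable {r m : ℕ} {π : EuclideanSpace ℝ (Fin (r + m)) →ₗ[ℝ] EuclideanSpace ℝ (Fin m)}
  {Q S : Set (EuclideanSpace ℝ (Fin (r + m)))}

/-- The affine section of the projection over the affine span of a face. -/
theorem exists_faceSection (hQ : IsPolytope Q) (hint : (interior Q).Nonempty)
    (hS : S ∈ faces Q m) (hf : InjOn π S) (e : Fin r ≃ facetsThrough Q S) :
    ∃ ρ : EuclideanSpace ℝ (Fin m) →ᵃ[ℝ] EuclideanSpace ℝ (Fin (r + m)),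
      (∀ y, π (ρ y) = y) ∧ (∀ y, ρ y ∈ affineSpan ℝ S) ∧ ∀ q ∈ affineSpan ℝ S, ρ (π q) = q := by
  let L : EuclideanSpace ℝ (Fin (r + m)) →ₗ[ℝ] (Fin r → ℝ) × EuclideanSpace ℝ (Fin m) :=
    (LinearMap.pi fun i => (facetEq Q (e i)).linear).prod π
  let B := LinearEquiv.ofBijective L (bijective_linear_facetEq hQ hint hS hf e)
  obtain ⟨p, hp⟩ := hS.1
  let ρ : EuclideanSpace ℝ (Fin m) →ᵃ[ℝ] EuclideanSpace ℝ (Fin (r + m)) :=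
    ((B.symm : _ →ₗ[ℝ] _) ∘ₗ LinearMap.inr ℝ (Fin r → ℝ) _).toAffineMap +
      AffineMap.const ℝ _ (p - B.symm (0, π p))
  have hBπ : ∀ y, π (B.symm (0, y)) = y := fun y => congrArg Prod.snd (B.apply_symm_apply (0, y))
  have hBl : ∀ y i, (facetEq Q (e i)).linear (B.symm (0, y)) = 0 := fun y i =>
    congrFun (congrArg Prod.fst (B.apply_symm_apply (0, y))) i
  have hρ : ∀ y, ρ y = B.symm (0, y) + (p - B.symm (0, π p)) := fun y => rfl
  have hρπ : ∀ y, π (ρ y) = y := fun y => by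
    rw [hρ, map_add, map_sub, hBπ, hBπ, sub_self, add_zero]
  have hρS : ∀ y, ρ y ∈ affineSpan ℝ S := fun y => by
    rw [mem_affineSpan_iff_vectorSpan hp, mem_vectorSpan_face hQ hint hS.2.1 ⟨p, hp⟩]
    intro G hG
    have h1 := hBl y (e.symm ⟨G, hG⟩)
    have h2 := hBl (π p) (e.symm ⟨G, hG⟩)
    rw [Equiv.apply_symm_apply] at h1 h2
    rw [hρ, show B.symm (0, y) + (p - B.symm (0, π p)) - p =
      B.symm (0, y) - B.symm (0, π p) by abel, map_sub, h1, h2, sub_zero]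
  refine ⟨ρ, hρπ, hρS, fun q hq => ?_⟩
  exact (existsUnique_mem_affineSpan hQ hint hS hf e (π q)).unique ⟨hρS _, hρπ _⟩ ⟨hq, rfl⟩

theorem mem_interior_image_of_mem_intrinsicInterior
    {ρ : EuclideanSpace ℝ (Fin m) →ᵃ[ℝ] EuclideanSpace ℝ (Fin (r + m))}
    (hρ : (∀ y, π (ρ y) = y) ∧ (∀ y, ρ y ∈ affineSpan ℝ S) ∧ ∀ q ∈ affineSpan ℝ S, ρ (π q) = q)
    {x : EuclideanSpace ℝ (Fin (r + m))} (hx : x ∈ intrinsicInterior ℝ S) :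
    π x ∈ interior (π '' S) := by
  obtain ⟨z, hz, rfl⟩ := hx
  let g : EuclideanSpace ℝ (Fin m) → affineSpan ℝ S := fun y => ⟨ρ y, hρ.2.1 y⟩
  have hg : Continuous g := (AffineMap.continuous_of_finiteDimensional ρ).subtype_mk _
  have hgz : g (π z) = z := Subtype.ext (hρ.2.2 z z.2)
  rw [mem_interior_iff_mem_nhds]
  filter_upwards [hg.continuousAt.eventually_mem (isOpen_interior.mem_nhds (hgz.symm ▸ hz))]
    with y hy
  exact ⟨ρ y, interior_subset (s := ((↑) : affineSpan ℝ S → _) ⁻¹' S) hy, hρ.1 y⟩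

/-- The product of the equations of the facets which do not contain the face `S`. -/
noncomputable def otherFacets (hQ : IsPolytope Q) (S : Set (EuclideanSpace ℝ (Fin (r + m))))
    (x : EuclideanSpace ℝ (Fin (r + m))) : ℝ :=
  open Classical in ∏ G ∈ hQ.finite_facets.toFinset with ¬ S ⊆ G, facetEq Q G x

theorem analyticAt_otherFacets (hQ : IsPolytope Q) (S : Set (EuclideanSpace ℝ (Fin (r + m))))
    (x : EuclideanSpace ℝ (Fin (r + m))) : AnalyticAt ℝ (otherFacets hQ S) x :=
  Finset.analyticAt_fun_prod _ fun G _ => analyticAt_affine (facetEq Q G) x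

theorem otherFacets_ne_zero_iff (hQ : IsPolytope Q) (hint : (interior Q).Nonempty)
    (q : EuclideanSpace ℝ (Fin (r + m))) : otherFacets hQ S q ≠ 0 ↔ IsOffOtherFacets Q S q := by
  rw [otherFacets, Finset.prod_ne_zero_iff]
  simp only [Finset.mem_filter, Set.Finite.mem_toFinset, and_imp]
  exact forall₂_congr fun G hG => imp_congr_right fun _ =>
    not_congr (mem_affineSpan_facet hint hG (isFacetEquation_facetEq hG) q).symm

theorem prod_facetEq_eq (hQ : IsPolytope Q) (e : Fin r ≃ facetsThrough Q S)
    (x : EuclideanSpace ℝ (Fin (r + m))) :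
    ∏ G ∈ hQ.finite_facets.toFinset, facetEq Q G x =
      (∏ i, facetEq Q (e i) x) * otherFacets hQ S x := by
  classical
  rw [otherFacets, ← Finset.prod_filter_mul_prod_filter_not hQ.finite_facets.toFinset (S ⊆ ·)]
  congr 1
  · symm
    refine Finset.prod_bij (fun i _ => (e i : Set _)) (fun i _ => ?_) (fun i _ j _ h => ?_)
      (fun G hG => ?_) fun i _ => rfl
    · exact Finset.mem_filter.2 ⟨hQ.finite_facets.mem_toFinset.2 (e i).2.1, (e i).2.2⟩
    · exact e.injective (Subtype.ext h)
    · have hG' : G ∈ facetsThrough Q S :=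
        ⟨hQ.finite_facets.mem_toFinset.1 (Finset.mem_filter.1 hG).1, (Finset.mem_filter.1 hG).2⟩
      exact ⟨e.symm ⟨G, hG'⟩, Finset.mem_univ _, by simp⟩
theorem mem_offFacets_iff_otherFacets (hQ : IsPolytope Q) (hint : (interior Q).Nonempty)
    (e : Fin r ≃ facetsThrough Q S) (x : EuclideanSpace ℝ (Fin (r + m))) :
    x ∈ offFacets Q ↔ (∀ i, facetEq Q (e i) x ≠ 0) ∧ otherFacets hQ S x ≠ 0 := by
  have h := prod_facetEq_eq hQ e x
  have h1 : x ∈ offFacets Q ↔ ∏ G ∈ hQ.finite_facets.toFinset, facetEq Q G x ≠ 0 := by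
    rw [mem_offFacets_iff hint, Finset.prod_ne_zero_iff]
    simp
  rw [h1, h, mul_ne_zero_iff, Finset.prod_ne_zero_iff]
  simp

theorem stdVolume_single (m : ℕ) :
    stdVolume m (fun j => EuclideanSpace.single j (1 : ℝ)) = 1 := by
  rw [stdVolume_apply]
  convert Matrix.det_one (R := ℝ) (n := Fin m)
  ext i j
  simp [Matrix.one_apply]

/-- Top-degree forms on the kernel of the projection are multiples of the determinant of the facet
equations. -/
theorem exists_eq_smul_det (hQ : IsPolytope Q) (hint : (interior Q).Nonempty)
    (hS : S ∈ faces Q m) (hf : InjOn π S) (e : Fin r ≃ facetsThrough Q S)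
    (η : LinearMap.ker π [⋀^Fin r]→ₗ[ℝ] ℝ) :
    ∃ (κ : ℝ) (b : Fin r → LinearMap.ker π),
      (∀ i j, (facetEq Q (e j)).linear (b i) = if j = i then 1 else 0) ∧
      ∀ v : Fin r → LinearMap.ker π,
        η v = κ * Matrix.det (Matrix.of fun i j => (facetEq Q (e i)).linear (v j)) := by
  obtain ⟨hinj, hsurj⟩ := bijective_linear_facetEq hQ hint hS hf e
  let L : LinearMap.ker π →ₗ[ℝ] Fin r → ℝ :=
    (LinearMap.pi fun i => (facetEq Q (e i)).linear) ∘ₗ (LinearMap.ker π).subtype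
  have hL : Function.Bijective L := by
    constructor
    · intro k k' h
      refine Subtype.ext (hinj (Prod.ext h ?_))
      exact (LinearMap.mem_ker.1 k.2).trans (LinearMap.mem_ker.1 k'.2).symm
    · intro a
      obtain ⟨v, hv⟩ := hsurj (a, 0)
      exact ⟨⟨v, congrArg Prod.snd hv⟩, congrArg Prod.fst hv⟩
  let b := Module.Basis.ofEquivFun (LinearEquiv.ofBijective L hL)
  have hb : ∀ k i, b.repr k i = (facetEq Q (e i)).linear k := fun k i => rfl
  refine ⟨η b, b, fun i j => ?_, fun v => ?_⟩
  · rw [← hb, b.repr_self, Finsupp.single_apply]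
    simp only [eq_comm]
  · conv_lhs => rw [η.eq_smul_basis_det b]
    rfl

theorem IsFacetListing.exists_perm (hint : (interior Q).Nonempty) (e : Fin r ≃ facetsThrough Q S)
    {ℓ : Fin r → EuclideanSpace ℝ (Fin (r + m)) →ᵃ[ℝ] ℝ} (hℓ : IsFacetListing Q S ℓ) :
    ∃ (p : Equiv.Perm (Fin r)) (c : Fin r → ℝ), (∀ i, 0 < c i) ∧
      ∀ i x, ℓ i x = c i * facetEq Q (e (p i)) x := by
  obtain ⟨e', he'⟩ := hℓ
  have hp : ∀ i, ∃ c : ℝ, 0 < c ∧ ∀ x, ℓ i x = c * facetEq Q (e (e'.trans e.symm i)) x := by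
    intro i
    have h : e (e'.trans e.symm i) = e' i := by simp
    rw [h]
    exact (he' i).exists_pos_mul hint (e' i).2.1 (isFacetEquation_facetEq (e' i).2.1)
  choose c hc h using hp
  exact ⟨e'.trans e.symm, c, hc, h⟩

theorem linear_eq_of_eq_mul {E : Type*} [NormedAddCommGroup E] [NormedSpace ℝ E]
    {ℓ ℓ' : E →ᵃ[ℝ] ℝ} {c : ℝ} (h : ∀ x, ℓ x = c * ℓ' x) (v : E) :
    ℓ.linear v = c * ℓ'.linear v := by
  have h1 := ℓ.linearMap_vsub v 0
  have h2 := ℓ'.linearMap_vsub v 0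
  simp only [vsub_eq_sub, sub_zero] at h1 h2
  rw [h1, h2, h, h]
  ring

theorem hasFDerivAt_affine_ker (ℓ : EuclideanSpace ℝ (Fin (r + m)) →ᵃ[ℝ] ℝ)
    (q : EuclideanSpace ℝ (Fin (r + m))) (k : LinearMap.ker π) :
    HasFDerivAt (fun k : LinearMap.ker π => ℓ (q + (k : EuclideanSpace ℝ (Fin (r + m)))))
      ((LinearMap.toContinuousLinearMap ℓ.linear).comp (LinearMap.ker π).subtypeL) k := by
  have h : (fun k : LinearMap.ker π => ℓ (q + (k : EuclideanSpace ℝ (Fin (r + m))))) = fun k =>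
      ((LinearMap.toContinuousLinearMap ℓ.linear).comp (LinearMap.ker π).subtypeL) k + ℓ q := by
    ext1 k
    have := affine_add_smul ℓ q k 1
    rw [one_smul, one_mul] at this
    rw [this, add_comm]
    rfl
  rw [h]
  exact (ContinuousLinearMap.hasFDerivAt _).add_const _

theorem analyticAt_fiber {g : EuclideanSpace ℝ (Fin (r + m)) → ℝ}
    {q : EuclideanSpace ℝ (Fin (r + m))} (hg : AnalyticAt ℝ g q) :
    AnalyticAt ℝ (fun k : LinearMap.ker π => g (q + (k : EuclideanSpace ℝ (Fin (r + m))))) 0 := by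
  have h : AnalyticAt ℝ
      (fun k : LinearMap.ker π => q + (k : EuclideanSpace ℝ (Fin (r + m)))) 0 :=
    analyticAt_const.add ((LinearMap.ker π).subtypeL.analyticAt 0)
  refine AnalyticAt.fun_comp (g := g) ?_ h
  simpa using hg

/-- The fiber volume form has a residue at the points of the affine span of a face. -/
theorem isResidueAt_of_isFacetListing (hQ : IsPolytope Q) (hint : (interior Q).Nonempty)
    (hS : S ∈ faces Q m) (e : Fin r ≃ facetsThrough Q S)
    {f N : EuclideanSpace ℝ (Fin (r + m)) → ℝ} (hN : AnalyticOnNhd ℝ N univ)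
    (hfN : ∀ x ∈ offFacets Q, f x = N x / ∏ G ∈ hQ.finite_facets.toFinset, facetEq Q G x)
    {ω : EuclideanSpace ℝ (Fin (r + m)) → EuclideanSpace ℝ (Fin (r + m)) [⋀^Fin r]→ₗ[ℝ] ℝ}
    (hω : IsFiberVolumeForm π Q f ω) {κ : ℝ} {b : Fin r → LinearMap.ker π}
    (hb : ∀ i j, (facetEq Q (e j)).linear (b i) = if j = i then 1 else 0)
    {w : Fin m → EuclideanSpace ℝ (Fin (r + m))} (hw : ∀ j, π (w j) = EuclideanSpace.single j 1)
    (hκ : ∀ v : Fin r → LinearMap.ker π,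
      stdVolume (r + m) (Sum.elim (fun j => (v j : EuclideanSpace ℝ (Fin (r + m)))) w ∘
        finSumFinEquiv.symm) =
        κ * Matrix.det (Matrix.of fun i j => (facetEq Q (e i)).linear (v j)))
    {ℓ : Fin r → EuclideanSpace ℝ (Fin (r + m)) →ᵃ[ℝ] ℝ} (p : Equiv.Perm (Fin r)) {c : Fin r → ℝ}
    (hc : ∀ i, 0 < c i) (hℓ : ∀ i x, ℓ i x = c i * facetEq Q (e (p i)) x)
    {q : EuclideanSpace ℝ (Fin (r + m))} (hq : q ∈ affineSpan ℝ S)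
    (hqoff : IsOffOtherFacets Q S q) :
    IsResidueAt (restrictToFiber π ω q)
      (fun i (k : LinearMap.ker π) => ℓ i (q + (k : EuclideanSpace ℝ (Fin (r + m))))) 0
      ((Equiv.Perm.sign p : ℤ) * κ * (N q / otherFacets hQ S q)) := by
  have hO : otherFacets hQ S q ≠ 0 := (otherFacets_ne_zero_iff hQ hint q).2 hqoff
  have hfd : ∀ i (k : LinearMap.ker π), fderiv ℝ (fun k : LinearMap.ker π =>
      ℓ i (q + (k : EuclideanSpace ℝ (Fin (r + m))))) k =
      (LinearMap.toContinuousLinearMap (ℓ i).linear).comp (LinearMap.ker π).subtypeL :=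
    fun i k => (hasFDerivAt_affine_ker (ℓ i) q k).fderiv
  have hlin : ∀ i v, (ℓ i).linear v = c i * (facetEq Q (e (p i))).linear v := fun i v =>
    linear_eq_of_eq_mul (hℓ i) v
  refine ⟨fun i => ⟨analyticAt_fiber (analyticAt_affine (ℓ i) q), ?_⟩, ?_, ?_⟩
  · have h0 := (mem_affineSpan_face hQ hint hS.2.1 hS.1 q).1 hq _ (e (p i)).2
    simp [hℓ, h0]
  · rw [Fintype.linearIndependent_iff]
    intro g hg i
    have h1 := congrArg (fun l => l (b (p i))) hg
    simp only [hfd, sum_apply, smul_apply, zero_apply, smul_eq_mul] at h1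
    have h2 : ∀ j, ((LinearMap.toContinuousLinearMap (ℓ j).linear).comp
        (LinearMap.ker π).subtypeL) (b (p i)) = if j = i then c i else 0 := by
      intro j
      change (ℓ j).linear (b (p i)) = _
      rw [hlin, hb]
      by_cases h : j = i
      · simp [h]
      · simp [h]
    simp only [h2, mul_ite, mul_zero, Finset.sum_ite_eq', Finset.mem_univ, if_true] at h1
    exact (mul_eq_zero.1 h1).resolve_right (hc i).ne'
  · refine ⟨fun k => (Equiv.Perm.sign p : ℤ) * κ * (N (q + (k : EuclideanSpace ℝ (Fin (r + m)))) /
      otherFacets hQ S (q + (k : EuclideanSpace ℝ (Fin (r + m))))), ?_, ?_, ?_⟩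
    · refine analyticAt_const.mul ((analyticAt_fiber (hN q (mem_univ q))).div
        (analyticAt_fiber (analyticAt_otherFacets hQ S q)) ?_)
      simpa using hO
    · simp
    · have hev : ∀ᶠ k : LinearMap.ker π in 𝓝 0,
          otherFacets hQ S (q + (k : EuclideanSpace ℝ (Fin (r + m)))) ≠ 0 := by
        refine (analyticAt_fiber (analyticAt_otherFacets hQ S q)).continuousAt.eventually_ne ?_
        simpa using hO
      filter_upwards [hev] with k hk hne v
      set x := q + (k : EuclideanSpace ℝ (Fin (r + m))) with hx
      have hxoff : x ∈ offFacets Q := by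
        rw [mem_offFacets_iff_otherFacets hQ hint e]
        refine ⟨fun i => ?_, hk⟩
        have := hne (p.symm i)
        rw [hℓ, Equiv.apply_symm_apply] at this
        exact right_ne_zero_of_mul this
      -- Both sides of the equation for the fiber volume form are evaluated on vectors of the kernel
      -- followed by lifts `w` of the standard basis; this isolates the value of `ω` on the fiber.
      have h1 := congrArg (fun η => η (Sum.elim
        (fun j => (v j : EuclideanSpace ℝ (Fin (r + m)))) w ∘ finSumFinEquiv.symm)) (hω x hxoff)
      simp only [AlternatingMap.smul_apply, smul_eq_mul] at h1
      rw [wedge_comp_apply _ _ _ _ _ fun j => LinearMap.mem_ker.1 (v j).2,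
        show π ∘ w = fun j => EuclideanSpace.single j 1 from funext hw, stdVolume_single,
        mul_one, hκ, hfN x hxoff, prod_facetEq_eq hQ e] at h1
      change ω x (fun j => (v j : EuclideanSpace ℝ (Fin (r + m)))) = _
      rw [← h1]
      have h2 : Matrix.det (Matrix.of fun i j => (ℓ i).linear (v j)) =
          (∏ i, c i) * ((Equiv.Perm.sign p : ℤ) *
            Matrix.det (Matrix.of fun i j => (facetEq Q (e i)).linear (v j))) := by
        rw [← Matrix.det_permute, ← Matrix.det_mul_column]
        congr 1
        ext i j
        exact hlin i _
      have h3 : ∏ i, ℓ i x = (∏ i, c i) * ∏ i, facetEq Q (e i) x := by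
        simp only [hℓ, Finset.prod_mul_distrib]
        congr 1
        exact Equiv.prod_comp p fun i => facetEq Q (e i) x
      have h4 : Matrix.det (Matrix.of fun i j => fderiv ℝ (fun k : LinearMap.ker π =>
          ℓ i (q + (k : EuclideanSpace ℝ (Fin (r + m))))) k (v j)) =
          Matrix.det (Matrix.of fun i j => (ℓ i).linear (v j)) := by
        simp only [hfd]
        rfl
      rw [h4, h2, h3]
      have h5 : (∏ i, c i) ≠ 0 := (Finset.prod_pos fun i _ => hc i).ne'
      have h6 : ∏ i, facetEq Q (e i) x ≠ 0 := Finset.prod_ne_zero_iff.2 fun i _ =>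
        ((mem_offFacets_iff_otherFacets hQ hint e x).1 hxoff).1 i
      -- Reordering the equations puts the sign of `p` into the determinant; the sign in the residue
      -- cancels it.
      have h7 : ((Equiv.Perm.sign p : ℤ) : ℝ) * ((Equiv.Perm.sign p : ℤ) : ℝ) = 1 := by
        rcases Int.units_eq_one_or (Equiv.Perm.sign p) with h | h <;> simp [h]
      field_simp
      linear_combination (-(N x * κ *
        Matrix.det (Matrix.of fun i j => (facetEq Q (e i)).linear (v j)))) * h7

/-- The residue function of a face: it is the canonical function of the projection of the face. -/
theorem exists_isResidueFunction (hQ : IsPolytope Q) (hint : (interior Q).Nonempty)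
    (hπ : Function.Surjective π) (hS : S ∈ faces Q m) (hf : InjOn π S)
    (hcard : (facetsThrough Q S).ncard = r)
    {f : EuclideanSpace ℝ (Fin (r + m)) → ℝ} (hfQ : IsWeakCanonical (r + m) Q f)
    {ω : EuclideanSpace ℝ (Fin (r + m)) → EuclideanSpace ℝ (Fin (r + m)) [⋀^Fin r]→ₗ[ℝ] ℝ}
    (hω : IsFiberVolumeForm π Q f ω) :
    ∃ R h : EuclideanSpace ℝ (Fin m) → ℝ, IsResidueFunction π Q S ω R ∧
      IsWeakCanonical m (π '' S) h ∧ (∀ᶠ y in generic (EuclideanSpace ℝ (Fin m)), R y = h y) ∧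
      ∀ q ∈ affineSpan ℝ S, IsOffOtherFacets Q S q → ContinuousAt R (π q) := by
  obtain ⟨e⟩ := exists_equiv_facetsThrough hQ hcard
  obtain ⟨ρ, hρ⟩ := exists_faceSection hQ hint hS hf e
  obtain ⟨N, hN, hfN⟩ := hfQ.exists_numerator hQ hint
  have hSeq : {x ∈ Q | ∀ i, facetEq Q (e i) x = 0} = S := by
    conv_rhs => rw [eq_setOf_facetsThrough hQ hint hS.2.1 hS.1]
    ext x
    refine and_congr_right fun _ => ⟨fun h G hG => ?_, fun h i => h _ (e i).2⟩
    simpa using h (e.symm ⟨G, hG⟩)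
  obtain ⟨p₀, hp₀, hloc⟩ := exists_eventually_mem hQ hint hS.2.1 hS.1
  obtain ⟨D, h, hD, hvol, hpoly, hintS, hh, hlim⟩ := exists_face_canonical (add_comm r m) hQ hint
    hfQ (fun i => facetEq Q (e i)) π (fun x hx i => facetEq_nonneg (e i).2.1 hx)
    (bijective_facetEq hQ hint hS hf e) p₀
    (fun i => (mem_facet_iff (e i).2.1 (hS.2.1.subset hp₀)).1 ((e i).2.2 hp₀))
    (by
      filter_upwards [hloc] with x hx hx'
      refine hx fun G hG => ?_
      simpa using hx' (e.symm ⟨G, hG⟩))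
  rw [hSeq] at hpoly hintS hh
  have hρc : Continuous ρ := AffineMap.continuous_of_finiteDimensional ρ
  have hquot : ∀ q, otherFacets hQ S q ≠ 0 → ContinuousAt (fun x => N x / otherFacets hQ S x) q :=
    fun q hq => (hN q (mem_univ q)).continuousAt.div (analyticAt_otherFacets hQ S q).continuousAt hq
  have hoff₀ : ∀ G ∈ facets Q, ¬ S ⊆ G → (facetEq Q G).comp ρ ≠ 0 := by
    intro G hG hSG h0
    obtain ⟨x, hx, hxG⟩ := not_subset.1 hSG
    refine hxG ((mem_facet_iff hG (hS.2.1.subset hx)).2 ?_)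
    rw [← hρ.2.2 x (subset_affineSpan ℝ _ hx)]
    exact congrArg (fun a => a (π x)) h0
  -- This is defined by a formula on the affine span of `S`, so it is continuous wherever the other
  -- facet equations do not vanish, whereas `h` is only compared with it generically.
  let R : EuclideanSpace ℝ (Fin m) → ℝ := fun y => D * (N (ρ y) / otherFacets hQ S (ρ y))
  have hRc : ∀ y, otherFacets hQ S (ρ y) ≠ 0 → ContinuousAt R y := fun y hy =>
    continuousAt_const.mul (ContinuousAt.comp (f := ρ) (hquot _ hy) hρc.continuousAt)
  have hgenO : ∀ᶠ y in generic (EuclideanSpace ℝ (Fin m)), otherFacets hQ S (ρ y) ≠ 0 := by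
    have h1 : {G | G ∈ facets Q ∧ ¬ S ⊆ G}.Finite := hQ.finite_facets.subset fun _ h => h.1
    filter_upwards [finite_eventually_generic_ne_zero h1 (fun G => (facetEq Q G).comp ρ)
      fun G hG => hoff₀ G hG.1 hG.2] with y hy
    rw [otherFacets_ne_zero_iff hQ hint]
    intro G hG hSG hmem
    exact hy G ⟨hG, hSG⟩
      ((mem_affineSpan_facet hint hG (isFacetEquation_facetEq hG) _).1 hmem)
  have hℓρ : ∀ y i, facetEq Q (e i) (ρ y) = 0 := fun y i =>
    (mem_affineSpan_face hQ hint hS.2.1 hS.1 _).1 (hρ.2.1 y) _ (e i).2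
  have hRh : ∀ᶠ y in generic (EuclideanSpace ℝ (Fin m)), R y = h y := by
    filter_upwards [hgenO, hlim] with y hy1 hy2
    refine hy2 (ρ y) (hℓρ y) (hρ.1 y) _ ?_
    refine Tendsto.congr' ?_ ((hquot _ hy1).tendsto.mono_left inf_le_left)
    have h1 : ∀ᶠ x in 𝓝 (ρ y) ⊓ generic _, x ∈ offFacets Q :=
      (eventually_generic_offFacets hQ hint).filter_mono inf_le_right
    filter_upwards [h1] with x hx
    have h2 := (mem_offFacets_iff_otherFacets hQ hint e x).1 hx
    have h3 : ∏ i, facetEq Q (e i) x ≠ 0 := Finset.prod_ne_zero_iff.2 fun i _ => h2.1 i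
    have h4 := h2.2
    rw [hfN x hx, prod_facetEq_eq hQ e]
    field_simp
  refine ⟨R, h, ⟨fun ℓ hℓ => ?_, fun x hx => ?_⟩, hh, hRh, fun q hq hqoff => hRc _ ?_⟩
  · choose w hw using fun j : Fin m => hπ (EuclideanSpace.single j 1)
    obtain ⟨κ, b, hb, hκ⟩ := exists_eq_smul_det hQ hint hS hf e
      ((fixRight ((stdVolume (r + m)).domDomCongr finSumFinEquiv.symm) w).compLinearMap
        (LinearMap.ker π).subtype)
    have hκ' : ∀ v : Fin r → LinearMap.ker π,
        stdVolume (r + m) (Sum.elim (fun j => (v j : EuclideanSpace ℝ (Fin (r + m)))) w ∘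
          finSumFinEquiv.symm) =
        κ * Matrix.det (Matrix.of fun i j => (facetEq Q (e i)).linear (v j)) := hκ
    obtain ⟨p, c, hc, hℓc⟩ := hℓ.exists_perm hint e
    -- Evaluated at the dual basis `b`, where the determinant of the facet equations is `1`, the
    -- volume formula for `D` gives the absolute value of `κ`. Hence `κ / D` is a sign, and it is
    -- the same for all points of the affine span.
    have hκD : |κ| = D := by
      have h1 := hvol finSumFinEquiv (fun j => (b j : EuclideanSpace ℝ (Fin (r + m)))) w
        (fun j => LinearMap.mem_ker.1 (b j).2) hw
      have h2 : Matrix.det (Matrix.of fun i j => (facetEq Q (e i)).linear (b j)) = 1 := by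
        convert Matrix.det_one (R := ℝ) (n := Fin r)
        ext i j
        simp [hb, Matrix.one_apply]
      rw [hκ', h2] at h1
      simpa using h1.symm
    refine ⟨(Equiv.Perm.sign p : ℤ) * (κ / D), ?_, fun q hq hqoff => ?_⟩
    · have h1 : κ / D = 1 ∨ κ / D = -1 := by
        rcases abs_choice κ with h | h <;> rw [h] at hκD
        · left; rw [hκD, div_self hD.ne']
        · right; rw [← hκD, div_neg, div_self]
          rintro rfl
          simp at hκD
          exact hD.ne hκD
      rcases Int.units_eq_one_or (Equiv.Perm.sign p) with h | h <;>
        rcases h1 with h1 | h1 <;> simp [h, h1]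
    · have h1 := isResidueAt_of_isFacetListing hQ hint hS e hN hfN hω hb hw hκ' p hc hℓc hq hqoff
      convert h1 using 1
      simp only [R, hρ.2.2 q hq]
      field_simp
  · have hxint := mem_interior_image_of_mem_intrinsicInterior hρ hx
    have hxS := intrinsicInterior_subset hx
    have hO : otherFacets hQ S (ρ (π x)) ≠ 0 := by
      rw [otherFacets_ne_zero_iff hQ hint]
      intro G hG hSG hmem
      rw [mem_affineSpan_facet hint hG (isFacetEquation_facetEq hG)] at hmem
      refine (pos_of_mem_interior (ℓ := (facetEq Q G).comp ρ) ?_ (hoff₀ G hG hSG) hxint).ne' hmem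
      rintro _ ⟨z, hz, rfl⟩
      rw [AffineMap.comp_apply, hρ.2.2 z (subset_affineSpan ℝ _ hz)]
      exact facetEq_nonneg hG (hS.2.1.subset hz)
    -- `R` and the canonical function of the projected face agree generically and are both
    -- continuous at this point, so they agree here and positivity carries over.
    have h1 : Tendsto R (𝓝 (π x) ⊓ generic _) (𝓝 (R (π x))) :=
      (hRc _ hO).tendsto.mono_left inf_le_left
    have h2 : Tendsto h (𝓝 (π x) ⊓ generic _) (𝓝 (h (π x))) :=
      (hh.continuousAt hpoly hintS (interior_subset_offFacets hintS hxint)).tendsto.mono_left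
        inf_le_left
    rw [tendsto_nhds_unique h1 (h2.congr' ?_)]
    · exact hh.pos hxint
    · filter_upwards [hRh.filter_mono inf_le_right] with y hy using hy.symm
  · rw [hρ.2.2 q hq]
    exact (otherFacets_ne_zero_iff hQ hint q).2 hqoff

end FaceResidues

/-! ### Canonical functions and subdivisions -/

section SubdivisionSums

/-- A point avoiding the earlier subspaces can be moved slightly towards a point outside the next
one: the earlier ones are closed, and a line meeting a subspace in two points lies inside it. -/
theorem exists_mem_forall_notMem_affineSubspace {E : Type*} [NormedAddCommGroup E]
    [NormedSpace ℝ E] [FiniteDimensional ℝ E] {F : Set E} (hF : Convex ℝ F) (hne : F.Nonempty)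
    {ι : Type*} (s : Finset ι) (A : ι → AffineSubspace ℝ E) (hA : ∀ i ∈ s, ∃ x ∈ F, x ∉ A i) :
    ∃ p ∈ F, ∀ i ∈ s, p ∉ A i := by
  classical
  induction s using Finset.induction_on with
  | empty => exact ⟨hne.some, hne.some_mem, by simp⟩
  | insert j s _ ih =>
    obtain ⟨p, hp, hps⟩ := ih fun i hi => hA i (Finset.mem_insert_of_mem hi)
    obtain ⟨q, hq, hqj⟩ := hA j (Finset.mem_insert_self _ _)
    by_cases hpj : p ∈ A j
    · have hc : Tendsto (fun t : ℝ => AffineMap.lineMap p q t) (𝓝[>] 0) (𝓝 p) := by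
        have : Continuous (fun t : ℝ => AffineMap.lineMap p q t) := AffineMap.lineMap_continuous
        have := this.tendsto 0
        simp only [AffineMap.lineMap_apply_zero] at this
        exact this.mono_left nhdsWithin_le_nhds
      have h1 : ∀ᶠ x in 𝓝 p, ∀ i ∈ s, x ∉ A i := (eventually_all_finset s).2 fun i hi =>
        (A i).closed_of_finiteDimensional.isOpen_compl.mem_nhds (hps i hi)
      have h2 : ∀ᶠ t : ℝ in 𝓝[>] 0, t < 1 :=
        (eventually_lt_nhds one_pos).filter_mono nhdsWithin_le_nhds
      obtain ⟨t, ⟨ht1, ht2⟩, ht3⟩ := (((hc.eventually h1).and h2).and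
        self_mem_nhdsWithin).exists
      have ht3' : (0 : ℝ) < t := ht3
      refine ⟨AffineMap.lineMap p q t, hF.lineMap_mem hp hq ⟨ht3'.le, ht2.le⟩, fun i hi => ?_⟩
      rcases Finset.mem_insert.1 hi with rfl | hi
      · intro hmem
        refine hqj ?_
        have : q = AffineMap.lineMap p (AffineMap.lineMap p q t : E) (1 / t) := by
          simp only [AffineMap.lineMap_apply, vsub_eq_sub, vadd_eq_add, add_sub_cancel_right,
            smul_smul, one_div, inv_mul_cancel₀ ht3'.ne', one_smul, sub_add_cancel]
        rw [this]
        exact AffineMap.lineMap_mem _ hpj hmem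
      · exact ht1 i hi
    · refine ⟨p, hp, fun i hi => ?_⟩
      rcases Finset.mem_insert.1 hi with rfl | hi
      · exact hpj
      · exact hps i hi

variable {n m : ℕ} {π : EuclideanSpace ℝ (Fin n) →ₗ[ℝ] EuclideanSpace ℝ (Fin m)}
  {Q : Set (EuclideanSpace ℝ (Fin n))} {ψ : StrongDual ℝ (LinearMap.ker π)}

/-- A facet hyperplane of the projection is spanned by the projection of a face of one of the
members of the subdivision. -/
theorem mem_offFacets_image (hQ : IsPolytope Q) (hint : (interior Q).Nonempty)
    (hπ : Function.Surjective π) (hinj : InjOn π (sectionImage π Q ψ))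
    {y : EuclideanSpace ℝ (Fin m)}
    (hy : ∀ S ∈ subdivisionFaces π Q ψ m, ∀ q ∈ affineSpan ℝ S, π q = y →
      IsOffOtherFacets Q S q) : y ∈ offFacets (π '' Q) := by
  intro F hF hyF
  have hfin : (subdivisionFaces π Q ψ m).Finite := (hQ.finite_faces m).subset fun _ h => h.1
  have hP := isPolytope_image (π := π) hQ
  have hcover := subset_sUnion_image hQ hint hπ hinj
  -- The cells cover `F`, and a convex set covered by finitely many subspaces is contained in one of
  -- them.
  obtain ⟨S, hS, hFS⟩ : ∃ S ∈ subdivisionFaces π Q ψ m, F ⊆ affineSpan ℝ (π '' S ∩ F) := by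
    by_contra! hcon
    obtain ⟨p, hp, hpA⟩ := exists_mem_forall_notMem_affineSubspace
      (hF.2.1.convex hP.convex) hF.1 hfin.toFinset (fun S => affineSpan ℝ (π '' S ∩ F))
      fun S hS => not_subset.1 (hcon S (hfin.mem_toFinset.1 hS))
    obtain ⟨_, ⟨S, hS, rfl⟩, hpS⟩ := hcover (hF.2.1.subset hp)
    exact hpA S (hfin.mem_toFinset.2 hS) (subset_affineSpan ℝ _ ⟨hpS, hp⟩)
  set T := S ∩ π ⁻¹' F with hT
  have hTF : π '' T = π '' S ∩ F := image_inter_preimage _ _ _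
  have hyT : y ∈ affineSpan ℝ (π '' T) := by
    rw [hTF]
    exact affineSpan_le.2 hFS hyF
  have hTne : T.Nonempty := by
    obtain ⟨z, hz⟩ := hF.1
    have h1 := (affineSpan_nonempty ℝ).1 ⟨z, hFS hz⟩
    rw [← hTF] at h1
    exact h1.of_image
  obtain ⟨q, hq, hqy⟩ : ∃ q ∈ affineSpan ℝ T, π q = y := by
    have h1 := AffineSubspace.map_span π.toAffineMap T
    have h2 : y ∈ (affineSpan ℝ T).map π.toAffineMap := by rw [h1]; exact hyT
    exact h2
  have ha := isFacetEquation_facetEq hF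
  have hQF : IsFacetEquation Q (Q ∩ π ⁻¹' F) ((facetEq (π '' Q) F).comp π.toAffineMap) := by
    refine ⟨fun x hx => facetEq_nonneg hF ⟨x, hx, rfl⟩, ?_⟩
    ext x
    exact and_congr_right fun hx => mem_facet_iff hF ⟨x, hx, rfl⟩
  have hTexp : IsExposed ℝ Q T := by
    have h1 : T = S ∩ (Q ∩ π ⁻¹' F) := by
      rw [← inter_assoc, inter_eq_left.2 hS.1.2.1.subset]
    rw [h1]
    exact hS.1.2.1.inter hQF.isExposed
  obtain ⟨x, hxS, hxT⟩ : ∃ x ∈ S, x ∉ T := by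
    by_contra! hcon
    obtain ⟨z, hz⟩ := interior_image_face_nonempty hQ hint hS.1 (hinj.mono hS.2)
    refine (pos_of_mem_interior (Q := π '' S) (ℓ := facetEq (π '' Q) F) ?_
      (facetEq_ne_zero hF) hz).ne' ?_
    · rintro _ ⟨x, hx, rfl⟩
      exact facetEq_nonneg hF ⟨x, hS.1.2.1.subset hx, rfl⟩
    · obtain ⟨x, hx, rfl⟩ := interior_subset hz
      exact (mem_facet_iff hF ⟨x, hS.1.2.1.subset hx, rfl⟩).1 (hcon x hx).2
  -- `T` is a proper face of `S`, so some facet of `Q` contains `T` but not `S`. Its hyperplane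
  -- contains `q`, against the assumption on `y`.
  obtain ⟨G, hG, hTG, hxG⟩ : ∃ G ∈ facets Q, T ⊆ G ∧ x ∉ G := by
    by_contra! hcon
    exact hxT (mem_of_forall_facets hQ hint hTexp hTne (hS.1.2.1.subset hxS) hcon)
  exact hy S hS q (affineSpan_mono ℝ inter_subset_left hq) hqy G hG (fun h => hxG (h hxS))
    (affineSpan_mono ℝ hTG hq)

/-- The overlap of two cells is a proper face of a full-dimensional polytope, so it lies in a proper
affine subspace. -/
theorem eventually_generic_notMem_inter (hQ : IsPolytope Q) (hint : (interior Q).Nonempty)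
    (hinj : InjOn π (sectionImage π Q ψ)) {S T : Set (EuclideanSpace ℝ (Fin n))}
    (hS : S ∈ subdivisionFaces π Q ψ m) (hT : T ∈ subdivisionFaces π Q ψ m) (hST : S ≠ T) :
    ∀ᶠ y in generic (EuclideanSpace ℝ (Fin m)), y ∈ π '' S → y ∉ π '' T := by
  have htop : affineSpan ℝ (π '' S ∩ π '' T) ≠ ⊤ := by
    intro h
    have hne : (π '' S ∩ π '' T).Nonempty := AffineSubspace.nonempty_of_affineSpan_eq_top ℝ _ _ h
    refine image_inter_ne hinj hS hT
      (fun h => hST (injOn_image_subdivisionFaces hinj hS hT h)) ?_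
    refine eq_of_isExposed_of_subset (isExposed_image_inter hQ hint hinj hS hT) hne Subset.rfl
      inter_subset_left ?_
    rw [(affineSpan_eq_top_iff_finrank hne).1 h, finrank_vectorSpan_of_interior
      (interior_image_face_nonempty hQ hint hS.1 (hinj.mono hS.2))]
  filter_upwards [eventually_generic_notMem _ htop] with y hy h1 h2
  exact hy (subset_affineSpan ℝ _ ⟨h1, h2⟩)

/-- The canonical function is additive along a coherent subdivision. -/
theorem eventually_eq_sum_subdivisionFaces (hQ : IsPolytope Q) (hint : (interior Q).Nonempty)
    (hπ : Function.Surjective π) (hinj : InjOn π (sectionImage π Q ψ))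
    {f : EuclideanSpace ℝ (Fin m) → ℝ} (hf : IsWeakCanonical m (π '' Q) f)
    {h : Set (EuclideanSpace ℝ (Fin n)) → EuclideanSpace ℝ (Fin m) → ℝ}
    (hh : ∀ S ∈ subdivisionFaces π Q ψ m, IsWeakCanonical m (π '' S) (h S))
    {s : Finset (Set (EuclideanSpace ℝ (Fin n)))} (hs : ∀ S, S ∈ s ↔ S ∈ subdivisionFaces π Q ψ m) :
    ∀ᶠ y in generic (EuclideanSpace ℝ (Fin m)), f y = ∑ S ∈ s, h S y := by
  classical
  -- The index `none` stands for `π '' Q`, with coefficient `1`, and `some S` for a cell, with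
  -- coefficient `-1`. Generically the cells partition `π '' Q`, which is the required relation.
  have key := respectsRelations (Option (Set (EuclideanSpace ℝ (Fin n)))) m (Finset.insertNone s)
    (fun o => o.elim (π '' Q) fun S => π '' S) (fun o => o.elim f h)
    (fun o => o.elim 1 fun _ => -1) ?_ ?_
  · filter_upwards [key] with y hy
    rw [Finset.sum_insertNone] at hy
    simp only [Option.elim, one_mul, neg_one_mul, Finset.sum_neg_distrib] at hy
    linarith
  · intro o ho
    cases o with
    | none => exact ⟨isPolytope_image hQ, interior_image_nonempty hπ hint, hf⟩
    | some S =>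
      have hS := (hs S).1 (Finset.some_mem_insertNone.1 ho)
      exact ⟨(hQ.of_isExposed hS.1.2.1).image π.toAffineMap,
        interior_image_face_nonempty hQ hint hS.1 (hinj.mono hS.2), hh S hS⟩
  · have hgen : ∀ᶠ y in generic (EuclideanSpace ℝ (Fin m)), ∀ S ∈ s, ∀ T ∈ s, S ≠ T →
        y ∈ π '' S → y ∉ π '' T :=
      (eventually_all_finset s).2 fun S hS => (eventually_all_finset s).2 fun T hT => by
        by_cases hST : S = T
        · simp [hST]
        · filter_upwards [eventually_generic_notMem_inter hQ hint hinj ((hs S).1 hS)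
            ((hs T).1 hT) hST] with y hy _ using hy
    filter_upwards [hgen] with y hy
    rw [Finset.sum_insertNone]
    simp only [Option.elim, one_mul, neg_one_mul, Finset.sum_neg_distrib]
    rw [add_neg_eq_zero]
    by_cases hyP : y ∈ π '' Q
    · obtain ⟨_, ⟨S, hS, rfl⟩, hyS⟩ := subset_sUnion_image hQ hint hπ hinj hyP
      have hSs := (hs S).2 hS
      rw [Finset.sum_eq_single_of_mem S hSs fun T hT hTS =>
        indicator_of_notMem (hy S hSs T hT hTS.symm hyS) _, indicator_of_mem hyP,
        indicator_of_mem hyS]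
    · rw [indicator_of_notMem hyP, Finset.sum_eq_zero]
      exact fun S hS => indicator_of_notMem
        (fun h => hyP (image_mono ((hs S).1 hS).1.2.1.subset h)) _

end SubdivisionSums

end FiberPolytope

theorem mainTheorem12 (r m : ℕ)
    (Q : Set (EuclideanSpace ℝ (Fin (r + m)))) (hQ : IsPolytope Q) (hQdim : (interior Q).Nonempty)
    (hsimple : IsSimpleInDim Q m r)
    (π : EuclideanSpace ℝ (Fin (r + m)) →ₗ[ℝ] EuclideanSpace ℝ (Fin m))
    (hπ : Function.Surjective π)
    (σ : Set (StrongDual ℝ (LinearMap.ker π))) (hσ : IsMaximalFiberCone π Q σ) :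
    ((interior σ).Nonempty ∧
      (∀ ψ ∈ interior σ, subdivisionFaces π Q ψ m = coneFaces π Q σ) ∧
      Set.InjOn (fun S => π '' S) (coneFaces π Q σ) ∧
      IsSubdivision (π '' Q) ((fun S => π '' S) '' coneFaces π Q σ)) ∧
    (∀ S ∈ coneFaces π Q σ, ∀ y, ∃! q, q ∈ affineSpan ℝ S ∧ π q = y) ∧
    ∀ (ΩQ : EuclideanSpace ℝ (Fin (r + m)) → ℝ) (ΩP : EuclideanSpace ℝ (Fin m) → ℝ)
      (ω : EuclideanSpace ℝ (Fin (r + m)) → EuclideanSpace ℝ (Fin (r + m)) [⋀^Fin r]→ₗ[ℝ] ℝ),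
      IsCanonicalFunction (r + m) Q ΩQ → IsCanonicalFunction m (π '' Q) ΩP →
      IsFiberVolumeForm π Q ΩQ ω →
      ∃ R : Set (EuclideanSpace ℝ (Fin (r + m))) → EuclideanSpace ℝ (Fin m) → ℝ,
        (∀ S ∈ coneFaces π Q σ, IsResidueFunction π Q S ω (R S)) ∧
        ∀ y : EuclideanSpace ℝ (Fin m),
          (∀ S ∈ coneFaces π Q σ, ∀ q ∈ affineSpan ℝ S, π q = y → IsOffOtherFacets Q S q) →
          ΩP y = ∑ᶠ S ∈ coneFaces π Q σ, R S y := by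
  obtain ⟨hσint, γ, hγ, hγσ, hγψ⟩ := exists_section_of_isMaximalFiberCone hQ hQdim hπ hσ
  have heq : ∀ ψ ∈ interior σ, subdivisionFaces π Q ψ m = coneFaces π Q σ := fun ψ hψ =>
    subdivisionFaces_eq_coneFaces hQ hQdim hsimple hγσ hψ (hγψ ψ hψ)
      (hγ.injOn_sectionImage (hγψ ψ hψ))
  obtain ⟨ψ, hψ⟩ := id hσint
  have hinj := hγ.injOn_sectionImage (hγψ ψ hψ)
  rw [← heq ψ hψ]
  have huniq : ∀ S ∈ subdivisionFaces π Q ψ m, ∀ y, ∃! q, q ∈ affineSpan ℝ S ∧ π q = y := by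
    intro S hS y
    obtain ⟨e⟩ := exists_equiv_facetsThrough hQ (hsimple S hS.1)
    exact existsUnique_mem_affineSpan hQ hQdim hS.1 (hinj.mono hS.2) e y
  refine ⟨⟨hσint, fun θ hθ => (heq θ hθ).trans (heq ψ hψ).symm,
    injOn_image_subdivisionFaces hinj,
    isSubdivision_image_subdivisionFaces hQ hQdim hπ hinj⟩, huniq, ?_⟩
  intro ΩQ ΩP ω hΩQ hΩP hω
  choose! R h hR hh hRh hRc using fun S (hS : S ∈ subdivisionFaces π Q ψ m) =>
    exists_isResidueFunction hQ hQdim hπ hS.1 (hinj.mono hS.2) (hsimple S hS.1)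
      hΩQ.isWeakCanonical hω
  have hfin : (subdivisionFaces π Q ψ m).Finite := (hQ.finite_faces m).subset fun _ h => h.1
  refine ⟨R, hR, fun y hy => ?_⟩
  rw [finsum_mem_eq_finite_toFinset_sum _ hfin]
  have hgen : ∀ᶠ z in generic (EuclideanSpace ℝ (Fin m)), ΩP z = ∑ S ∈ hfin.toFinset, R S z := by
    have h1 := (Filter.eventually_all_finset hfin.toFinset).2 fun S hS =>
      hRh S (hfin.mem_toFinset.1 hS)
    filter_upwards [eventually_eq_sum_subdivisionFaces hQ hQdim hπ hinj hΩP.isWeakCanonical hh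
      (fun S => hfin.mem_toFinset), h1] with z hz hz1
    rw [hz]
    exact Finset.sum_congr rfl fun S hS => (hz1 S hS).symm
  -- The condition on the points over `y` keeps `y` off all facet hyperplanes of the projection, so
  -- both sides of the claim are continuous at `y` and the generic identity passes to the limit.
  have hPc : ContinuousAt ΩP y := hΩP.isWeakCanonical.continuousAt (isPolytope_image hQ)
    (interior_image_nonempty hπ hQdim) (mem_offFacets_image hQ hQdim hπ hinj hy)
  have hsumc : ContinuousAt (fun z => ∑ S ∈ hfin.toFinset, R S z) y := by
    refine tendsto_finsetSum _ fun S hS => ?_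
    have hS' := hfin.mem_toFinset.1 hS
    obtain ⟨q, ⟨hq, rfl⟩, -⟩ := huniq S hS' y
    exact hRc S hS' q hq (hy S hS' q hq rfl)
  refine tendsto_nhds_unique
    (hPc.tendsto.mono_left (inf_le_left (b := generic (EuclideanSpace ℝ (Fin m))))) ?_
  refine (hsumc.tendsto.mono_left inf_le_left).congr' ?_
  filter_upwards [hgen.filter_mono inf_le_right] with z hz using hz.symm
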